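/- **Setting.** Let $n\ge 2$, $\varrho>0$, $\mathbb T^{n-1}=\mathbb R^{n-1}/2\pi\mathbb Z^{n-1}$. For $\sigma\in[0,1]$ and an integer $d\ge0$, $\mathcal A_{\sigma,d}$ is the Banach space of functions $u$ on the strip $\{\xi\in\mathbb C^{n-1}:|\mathrm{Im}\,\xi_j|\le\sigma\varrho\}$ that are $2\pi$-periodic in each variable, holomorphic in the interior and, together with their derivatives of order $\le d$, continuous up to the boundary, with norm $\|u\|_{\sigma,d}=\max_{|l|\le d}\sup|\partial^l u|$. For $s\in\mathbb R$, $|u|_s=\big(\sum_{m\in\mathbb Z^{n-1}}(1+|m|^2)^s|\hat u(m)|^2\big)^{1/2}$ with $\hat u(m)=(2\pi)^{-(n-1)/2}\int_{\mathbb T^{n-1}}e^{-im\cdot\xi}u(\xi)\,d\xi$. Norms of vector and matrix functions are sums of the norms of the entries, and $|\cdot|$ of a constant vector is the sum of the moduli of its components. Write $\overline f=(2\pi)^{1-n}\int_{\mathbb T^{n-1}}f\,d\xi$. Let $\omega\in\mathbb R^{n-1}$ satisfy $|\omega\cdot m|^{-1}\le c_0|m|^{n}$ for all $m\in\mathbb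 Z^{n-1}\setminus\{0\}$, and put $\boldsymbol\partial=\omega\cdot\nabla_\xi$. Let $H_0(y,z_2)$, $y\in\mathbb R^{n-1}$, $z_2\in\mathbb R$, be real analytic near $(0,0)$ with $\nabla_yH_0(0,0)=\omega$, $\partial_{z_2}H_0(0,0)=0$. Put $S_0=\partial_y^2H_0(0,0)$, $t_0=\nabla_y\partial_{z_2}H_0(0,0)$, let $T_0$ be the $2\times(n-1)$ matrix with rows $0$ and $t_0^\top$, and assume $\det(S_0-t_0\otimes t_0)\ne0$. Put $J=\begin{pmatrix}0&1\\-1&0\end{pmatrix}$, $\Omega=\mathrm{diag}(-k,1)$, $e_1=(1,0)^\top$. **Theorem.** Let $C\in\mathbb R$, let $d\ge2$ be an integer, $s\in\mathbb R$ and $\sigma\in(1/2,1]$. There are constants $c>0$ and $\varepsilon_1>0$, depending only on the objects fixed so far (in particular not on $\alpha$, $k$, $\varepsilon_0$, $\varepsilon$, the coefficients or the data below), such that the following holds for all $\varepsilon_0\in(0,\varepsilon_1]$, $|\varepsilon|\le\varepsilon_0$, $\alpha\in\mathbb R$, $k\in[0,1]$. Let $w_1$ (scalar), $W$ ($2\times2$),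 $V$ ($(n-1)\times(n-1)$, pointwise invertible), $S$ ($(n-1)\times(n-1)$) and $T$ ($2\times(n-1)$) be functions on the strip $|\mathrm{Im}\,\xi_j|\le\sigma\varrho/2$ such that the differences below lie in the indicated spaces and $$\|V^{-1}-I\|_{\sigma/2,0}+\|w_1-\alpha\|_{\sigma/2,d}+\|W-I\|_{\sigma/2,d}\le C|\varepsilon|,\qquad \|S-S_0\|_{\sigma/2,d-1}+\|T-T_0\|_{\sigma/2,d-1}\le C|\varepsilon|.$$ Then for all $g_1\in\mathcal A_{\sigma/2,0}$, $g_2\in\mathcal A_{\sigma/2,0}^2$ and $\gamma\in\mathbb C$ the problem $$\boldsymbol\partial\mu=-p\nabla w_1-\nabla g_1,\qquad J\boldsymbol\partial\lambda+\Omega\lambda+T\mu+p\,W^\top e_1=g_2,\qquad -\boldsymbol\partial\chi+S\mu+T^\top\lambda=0,$$ $$\overline{W\lambda\cdot e_1}+\overline{\chi\cdot\nabla w_1}=\gamma,\qquad \overline{V^{-\top}\chi}=0$$ has a unique solution $\mu\in\mathcal A_{\sigma/4,0}^{n-1}$, $\lambda\in\mathcal A_{\sigma/4,0}^{2}$, $\chi\in\mathcal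 A_{\sigma/4,0}^{n-1}$, $p\in\mathbb C$. If $w_1,W,V,S,T,g_1,g_2$ are real on $\mathbb R^{n-1}$ and $\gamma\in\mathbb R$, then $\mu,\lambda,\chi$ are real on $\mathbb R^{n-1}$ and $p\in\mathbb R$. The solution lies in $H_s$ (its Sobolev norms of order $s$ are finite) and satisfies $$\|\mu\|_{\sigma/4,0}+\|\lambda\|_{\sigma/4,0}+\|\chi\|_{\sigma/4,0}+|p|\le c\big(\|g_1\|_{\sigma/2,0}+\|g_2\|_{\sigma/2,0}+|\gamma|\big),$$ $$|\mu|_s+|\lambda|_s+|\chi|_s+|p|\le c\big(|g_1|_{s+4n+6}+|g_2|_{s+4n+6}+|\gamma|\big),$$ $$|\overline\mu|\le c\,|\overline{g_2}|+\varepsilon_0\,c\,\big(|g_1|_{s+4n+6}+|g_2|_{s+4n+6}+|\gamma|\big).$$ -/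

import Mathlib

namespace TorusLinear

/-- Complex points `ξ ∈ ℂ^N`; functions on (complex neighbourhoods of) the torus `𝕋^N` are
`2π`-periodic functions of `ξ`. In the theorem `N = n - 1`. -/
abbrev CSpace (N : ℕ) : Type := Fin N → ℂ

/-- The closed strip `|Im ξ_j| ≤ a`. -/
def closedStrip (N : ℕ) (a : ℝ) : Set (CSpace N) := {ξ | ∀ j, |(ξ j).im| ≤ a}

/-- The open strip `|Im ξ_j| < a`. -/
def openStrip (N : ℕ) (a : ℝ) : Set (CSpace N) := {ξ | ∀ j, |(ξ j).im| < a}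

/-- A real point regarded as a complex one. -/
def toC {N : ℕ} (x : Fin N → ℝ) : CSpace N := fun j => (x j : ℂ)

/-- The partial derivative `∂u/∂ξ_j`. -/
noncomputable def pderiv {N : ℕ} (j : Fin N) (u : CSpace N → ℂ) (ξ : CSpace N) : ℂ :=
  fderiv ℂ u ξ (Pi.single j 1)

/-- The mixed partial derivative of order `l` in the coordinate directions `J 0, …, J (l-1)`. -/
noncomputable def mixedDeriv {N l : ℕ} (J : Fin l → Fin N) (u : CSpace N → ℂ) (ξ : CSpace N) : ℂ :=
  iteratedFDeriv ℂ l u ξ (fun i => Pi.single (J i) 1)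

/-- The gradient of a scalar function. -/
noncomputable def grad {N : ℕ} (u : CSpace N → ℂ) (ξ : CSpace N) : Fin N → ℂ :=
  fun j => pderiv j u ξ

/-- The derivative `∂ = ω · ∇` along the frequency vector, of a vector function, componentwise. -/
noncomputable def dOmega {N r : ℕ} (ω : Fin N → ℝ) (u : CSpace N → Fin r → ℂ) (ξ : CSpace N) :
    Fin r → ℂ :=
  fun i => ∑ j, (ω j : ℂ) * pderiv j (fun η => u η i) ξ

/-- All values of moduli of derivatives of order at most `d` in the strip of half-width `σ ϱ`. -/
def derivValues {N : ℕ} (ϱ σ : ℝ) (d : ℕ) (u : CSpace N → ℂ) : Set ℝ :=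
  {r | ∃ l ≤ d, ∃ J : Fin l → Fin N, ∃ ξ ∈ openStrip N (σ * ϱ), r = ‖mixedDeriv J u ξ‖}

/-- Membership in `𝒜_{σ,d}`: `u` is `2π`-periodic and continuous in the closed strip of half-width
`σ ϱ`, holomorphic inside, its derivatives of order at most `d` extend continuously to the closed
strip, and its norm is finite. Values of `u` outside the closed strip are irrelevant. -/
structure MemA {N : ℕ} (ϱ σ : ℝ) (d : ℕ) (u : CSpace N → ℂ) : Prop where
  periodic : ∀ ξ ∈ closedStrip N (σ * ϱ), ∀ j : Fin N,
    u (ξ + Pi.single j ((2 * Real.pi : ℝ) : ℂ)) = u ξ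
  holomorphic : DifferentiableOn ℂ u (openStrip N (σ * ϱ))
  continuous : ContinuousOn u (closedStrip N (σ * ϱ))
  derivs_extend : ∀ l ≤ d, ∀ J : Fin l → Fin N, ∃ v : CSpace N → ℂ,
    ContinuousOn v (closedStrip N (σ * ϱ)) ∧ Set.EqOn v (mixedDeriv J u) (openStrip N (σ * ϱ))
  finite_norm : BddAbove (derivValues ϱ σ d u)

/-- The norm `‖u‖_{σ,d}`; by continuity the supremum over the open strip is the one over the closed
strip. -/
noncomputable def normA {N : ℕ} (ϱ σ : ℝ) (d : ℕ) (u : CSpace N → ℂ) : ℝ :=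
  sSup (derivValues ϱ σ d u)

/-- `𝒜_{σ,d}` for vector functions. -/
def MemAVec {N r : ℕ} (ϱ σ : ℝ) (d : ℕ) (u : CSpace N → Fin r → ℂ) : Prop :=
  ∀ i, MemA ϱ σ d (fun ξ => u ξ i)

/-- The norm of a vector function: the sum of the norms of its components. -/
noncomputable def normAVec {N r : ℕ} (ϱ σ : ℝ) (d : ℕ) (u : CSpace N → Fin r → ℂ) : ℝ :=
  ∑ i, normA ϱ σ d (fun ξ => u ξ i)

/-- `𝒜_{σ,d}` for matrix functions. -/
def MemAMat {N r t : ℕ} (ϱ σ : ℝ) (d : ℕ) (A : CSpace N → Matrix (Fin r) (Fin t) ℂ) : Prop :=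
  ∀ i j, MemA ϱ σ d (fun ξ => A ξ i j)

/-- The norm of a matrix function: the sum of the norms of its entries. -/
noncomputable def normAMat {N r t : ℕ} (ϱ σ : ℝ) (d : ℕ)
    (A : CSpace N → Matrix (Fin r) (Fin t) ℂ) : ℝ :=
  ∑ i, ∑ j, normA ϱ σ d (fun ξ => A ξ i j)

/-- The period cell `[0, 2π]^N`. -/
def cell (N : ℕ) : Set (Fin N → ℝ) := Set.Icc (fun _ => 0) (fun _ => 2 * Real.pi)

/-- The mean value `(2π)^{-N} ∫_{𝕋^N} f`. -/
noncomputable def mean {N : ℕ} (f : CSpace N → ℂ) : ℂ :=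
  (((2 * Real.pi) ^ N)⁻¹ : ℝ) * ∫ x in cell N, f (toC x)

/-- The mean value of a vector function. -/
noncomputable def meanVec {N r : ℕ} (f : CSpace N → Fin r → ℂ) : Fin r → ℂ :=
  fun i => mean (fun ξ => f ξ i)

/-- The length of a constant vector (sum of the moduli of the components). -/
noncomputable def absVec {r : ℕ} (v : Fin r → ℂ) : ℝ := ∑ i, ‖v i‖

/-- `|m|² = ∑ m_j²` for an integer vector. -/
def sqLen {N : ℕ} (m : Fin N → ℤ) : ℝ := ∑ j, (m j : ℝ) ^ 2

/-- The Fourier coefficient `û(m) = (2π)^{-N/2} ∫_{𝕋^N} e^{-i m·ξ} u(ξ) dξ`. -/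
noncomputable def fourier {N : ℕ} (u : CSpace N → ℂ) (m : Fin N → ℤ) : ℂ :=
  (((2 * Real.pi) ^ (-(N : ℝ) / 2) : ℝ) : ℂ) *
    ∫ x in cell N, Complex.exp (-Complex.I * ∑ j, (m j : ℂ) * (x j : ℂ)) * u (toC x)

/-- Finiteness of the Sobolev norm of order `s`, i.e. `u ∈ H_s`. -/
def MemSobolev {N : ℕ} (s : ℝ) (u : CSpace N → ℂ) : Prop :=
  Summable (fun m : Fin N → ℤ => (1 + sqLen m) ^ s * ‖fourier u m‖ ^ 2)

/-- The Sobolev norm `|u|_s`. -/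
noncomputable def sobolev {N : ℕ} (s : ℝ) (u : CSpace N → ℂ) : ℝ :=
  Real.sqrt (∑' m : Fin N → ℤ, (1 + sqLen m) ^ s * ‖fourier u m‖ ^ 2)

/-- `H_s` for vector functions. -/
def MemSobolevVec {N r : ℕ} (s : ℝ) (u : CSpace N → Fin r → ℂ) : Prop :=
  ∀ i, MemSobolev s (fun ξ => u ξ i)

/-- The Sobolev norm of a vector function: the sum of the norms of its components. -/
noncomputable def sobolevVec {N r : ℕ} (s : ℝ) (u : CSpace N → Fin r → ℂ) : ℝ :=
  ∑ i, sobolev s (fun ξ => u ξ i)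

/-- The function takes real values at real points. -/
def IsRealFun {N : ℕ} (u : CSpace N → ℂ) : Prop := ∀ x : Fin N → ℝ, (u (toC x)).im = 0

/-- The diophantine condition `|ω · m|⁻¹ ≤ c₀ |m|^n` for integer vectors `m ≠ 0`; in particular
`ω · m ≠ 0`. -/
def Diophantine {N : ℕ} (n : ℕ) (c₀ : ℝ) (ω : Fin N → ℝ) : Prop :=
  ∀ m : Fin N → ℤ, m ≠ 0 → 1 ≤ c₀ * Real.sqrt (sqLen m) ^ n * |∑ j, ω j * (m j : ℝ)|

/-- `S₀ = ∂²H₀/∂y²(0,0)` for a Hamiltonian `H₀ = H₀(y, z₂)`. -/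
noncomputable def hessS {N : ℕ} (H₀ : (Fin N → ℝ) × ℝ → ℝ) : Matrix (Fin N) (Fin N) ℝ :=
  Matrix.of fun i j => iteratedFDeriv ℝ 2 H₀ 0 ![(Pi.single i 1, 0), (Pi.single j 1, 0)]

/-- `t₀ = ∇_y ∂_{z₂} H₀(0,0)`. -/
noncomputable def vecT {N : ℕ} (H₀ : (Fin N → ℝ) × ℝ → ℝ) : Fin N → ℝ :=
  fun j => iteratedFDeriv ℝ 2 H₀ 0 ![(Pi.single j 1, 0), (0, 1)]

/-- `T₀ = ∂²H₀/∂z∂y(0,0)`, `z = (z₁, z₂)`; the first row vanishes as `H₀` does not depend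
on `z₁`. -/
noncomputable def matT {N : ℕ} (H₀ : (Fin N → ℝ) × ℝ → ℝ) : Matrix (Fin 2) (Fin N) ℝ :=
  Matrix.of ![0, vecT H₀]

/-- `K₀ = S₀ - t₀ ⊗ t₀`. -/
noncomputable def matK {N : ℕ} (H₀ : (Fin N → ℝ) × ℝ → ℝ) : Matrix (Fin N) (Fin N) ℝ :=
  hessS H₀ - Matrix.vecMulVec (vecT H₀) (vecT H₀)

/-- The symplectic matrix `J`. -/
def matJ : Matrix (Fin 2) (Fin 2) ℂ := !![0, 1; -1, 0]

/-- `Ω = diag(-k, 1)`. -/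
def matOmega (k : ℝ) : Matrix (Fin 2) (Fin 2) ℂ := !![-(k : ℂ), 0; 0, 1]

/-- The first basis vector of `ℂ²`. -/
def e1 : Fin 2 → ℂ := ![1, 0]

/-- The variable coefficients of the linear problem. -/
structure Coeffs (N : ℕ) where
  w₁ : CSpace N → ℂ
  W : CSpace N → Matrix (Fin 2) (Fin 2) ℂ
  V : CSpace N → Matrix (Fin N) (Fin N) ℂ
  S : CSpace N → Matrix (Fin N) (Fin N) ℂ
  T : CSpace N → Matrix (Fin 2) (Fin N) ℂ

/-- The assumptions on the coefficients: `V` is invertible, and, with `δ = C |ε|`,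
`‖V⁻¹ - I‖_{σ/2,0} + ‖w₁ - α‖_{σ/2,d} + ‖W - I‖_{σ/2,d} ≤ δ` and
`‖S - S₀‖_{σ/2,d-1} + ‖T - T₀‖_{σ/2,d-1} ≤ δ`. -/
structure Coeffs.Admissible {N : ℕ} (K : Coeffs N) (ϱ σ : ℝ) (d : ℕ)
    (H₀ : (Fin N → ℝ) × ℝ → ℝ) (α δ : ℝ) : Prop where
  unit_V : ∀ ξ ∈ closedStrip N (σ / 2 * ϱ), IsUnit (K.V ξ)
  mem_V : MemAMat ϱ (σ / 2) 0 (fun ξ => (K.V ξ)⁻¹ - 1)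
  mem_w₁ : MemA ϱ (σ / 2) d (fun ξ => K.w₁ ξ - (α : ℂ))
  mem_W : MemAMat ϱ (σ / 2) d (fun ξ => K.W ξ - 1)
  mem_S : MemAMat ϱ (σ / 2) (d - 1) (fun ξ => K.S ξ - (hessS H₀).map Complex.ofReal)
  mem_T : MemAMat ϱ (σ / 2) (d - 1) (fun ξ => K.T ξ - (matT H₀).map Complex.ofReal)
  bound₁ : normAMat ϱ (σ / 2) 0 (fun ξ => (K.V ξ)⁻¹ - 1)
      + normA ϱ (σ / 2) d (fun ξ => K.w₁ ξ - (α : ℂ))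
      + normAMat ϱ (σ / 2) d (fun ξ => K.W ξ - 1) ≤ δ
  bound₂ : normAMat ϱ (σ / 2) (d - 1) (fun ξ => K.S ξ - (hessS H₀).map Complex.ofReal)
      + normAMat ϱ (σ / 2) (d - 1) (fun ξ => K.T ξ - (matT H₀).map Complex.ofReal) ≤ δ

/-- All coefficients are real at real points. -/
structure Coeffs.IsReal {N : ℕ} (K : Coeffs N) : Prop where
  w₁ : IsRealFun K.w₁
  W : ∀ i j, IsRealFun (fun ξ => K.W ξ i j)
  V : ∀ i j, IsRealFun (fun ξ => K.V ξ i j)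
  S : ∀ i j, IsRealFun (fun ξ => K.S ξ i j)
  T : ∀ i j, IsRealFun (fun ξ => K.T ξ i j)

open scoped Matrix in
/-- `(μ, lam, χ, p)` with `μ, lam, χ ∈ 𝒜_{σ/4,0}` solves the linear boundary value problem with right
hand sides `g₁, g₂, γ`. -/
structure IsSolution {N : ℕ} (ϱ σ : ℝ) (ω : Fin N → ℝ) (k : ℝ) (K : Coeffs N)
    (g₁ : CSpace N → ℂ) (g₂ : CSpace N → Fin 2 → ℂ) (γ : ℂ)
    (μ : CSpace N → Fin N → ℂ) (lam : CSpace N → Fin 2 → ℂ) (χ : CSpace N → Fin N → ℂ)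
    (p : ℂ) : Prop where
  mem_μ : MemAVec ϱ (σ / 4) 0 μ
  mem_lam : MemAVec ϱ (σ / 4) 0 lam
  mem_χ : MemAVec ϱ (σ / 4) 0 χ
  eq_μ : ∀ ξ ∈ openStrip N (σ / 4 * ϱ), dOmega ω μ ξ = -(p • grad K.w₁ ξ) - grad g₁ ξ
  eq_lam : ∀ ξ ∈ openStrip N (σ / 4 * ϱ),
    matJ *ᵥ dOmega ω lam ξ + matOmega k *ᵥ lam ξ + K.T ξ *ᵥ μ ξ + p • ((K.W ξ)ᵀ *ᵥ e1) = g₂ ξ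
  eq_χ : ∀ ξ ∈ openStrip N (σ / 4 * ϱ),
    -dOmega ω χ ξ + K.S ξ *ᵥ μ ξ + (K.T ξ)ᵀ *ᵥ lam ξ = 0
  mean_γ : mean (fun ξ => (K.W ξ *ᵥ lam ξ) ⬝ᵥ e1) + mean (fun ξ => χ ξ ⬝ᵥ grad K.w₁ ξ) = γ
  mean_χ : meanVec (fun ξ => ((K.V ξ)⁻¹)ᵀ *ᵥ χ ξ) = 0

end TorusLinear

namespace TorusLinear
open MeasureTheory Set
open scoped Real Pointwise

/-! On Fourier coefficients the problem is a triangular system with bounded perturbations. Put `δ =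
C|ε|`. The coefficients are constants plus functions analytic in the strip of half-width `σϱ/2`,
whose Fourier coefficients are at most `δ * env b m` with `b = σϱ/2`. Convolution with such a
sequence is bounded, with norm `O(δ)`, on every `ℓ²`-space with weight `(1+|m|²)^{r/2} e^{a|m|}`, `0
≤ a < b` (`Bd.conv`). It loses no derivatives. Derivatives are lost only in dividing by `ω·m`.

For `m ≠ 0` the equations are solved in turn: `p` and `g₁` give `μ` (loss `n+1`). Then `μ` and `p`
give `λ` through a 2×2 block of determinant `±((ω·m)² + k)`, nonzero uniformly in `k ≥ 0` (loss
`2n`). Finally `μ` and `λ` give `χ` (loss `n`). The total `4n+1` fits into `4n+6`. No iteration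
scheme is needed, since each unknown is perturbed only through unknowns already found. A solution is
thus controlled by the data and the finitely many parameters `μ̄`, `λ̄₁`, `p`, `χ̄`
(`exists_bound_of_paramNorm`).

As many scalar equations remain as there are parameters: the mean of the `χ`-equation, the mean of
the first `λ`-equation, and the two side conditions. At `δ = 0` they can be inverted: the side
conditions give `λ̄₁` and `χ̄`, the first `λ`-equation gives `p` because the first row of `T₀`
vanishes, and elimination of `λ̄₂` leaves `(S₀ - t₀⊗t₀) μ̄` equal to a multiple of a mean of `g₂`.
For small `δ` the perturbation is absorbed, which yields the a priori estimate `exists_apriori` and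
the refined bound of `μ̄`.

Uniqueness is this estimate with zero data. Existence is linear algebra: in the space `Rapid` of
sequences decaying faster than every power no loss is felt, so the remaining equations define an
endomorphism of the parameter space, injective by uniqueness and hence surjective (`exists_seqSol`).
Reality follows from uniqueness and conjugation. The two norm estimates are the a priori estimate
with weights `a = 0` and `a = 3σϱ/8`. `isSolution_iff` is the dictionary between functions and
sequences. -/

/-- `2π`-periodicity in every variable. -/
def IsPer {N : ℕ} (f : (Fin N → ℝ) → ℂ) : Prop :=
  ∀ x j, f (x + Pi.single j (2 * Real.pi)) = f x

/-- The mean value of a function on the torus. -/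
noncomputable def avg {N : ℕ} (f : (Fin N → ℝ) → ℂ) : ℂ :=
  (((2 * Real.pi) ^ N)⁻¹ : ℝ) * ∫ x in cell N, f x

variable {N : ℕ}

/-! ### Periodic functions and the standard torus. -/

lemma IsPer.add_int {f : (Fin N → ℝ) → ℂ} (hf : IsPer f) (n : Fin N → ℤ) (x : Fin N → ℝ) :
    f (x + fun j => 2 * Real.pi * (n j : ℝ)) = f x := by
  have h1 : ∀ (j : Fin N) (k : ℤ) x, f (x + Pi.single j (2 * Real.pi * (k : ℝ))) = f x := by
    intro j k x
    have hp : Function.Periodic (fun t : ℝ => f (x + Pi.single j t)) (2 * Real.pi) := by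
      intro t
      simp only [Pi.single_add, ← add_assoc]
      exact hf _ j
    have := hp.int_mul k 0
    simpa [mul_comm] using this
  have h2 : ∀ s : Finset (Fin N), ∀ x,
      f (x + ∑ j ∈ s, Pi.single j (2 * Real.pi * (n j : ℝ))) = f x := by
    intro s
    induction s using Finset.induction_on with
    | empty => simp
    | insert j s hj ih =>
      intro x
      rw [Finset.sum_insert hj, ← add_assoc, ih, h1]
  have := h2 Finset.univ x
  rwa [Finset.univ_sum_single] at this

/-- Evaluation at an arbitrary lift is independent of the lift, because two lifts differ by an
integer vector; continuity descends along the quotient map. -/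
lemma IsPer.exists_torus {f : (Fin N → ℝ) → ℂ} (hf : IsPer f) (hc : Continuous f) :
    ∃ F : C(UnitAddTorus (Fin N), ℂ), ∀ y : Fin N → ℝ,
      F (fun j => (y j : UnitAddCircle)) = f (fun j => 2 * Real.pi * y j) := by
  have hq : IsOpenQuotientMap (Pi.map (fun (_ : Fin N) (t : ℝ) => (t : UnitAddCircle))) :=
    IsOpenQuotientMap.piMap fun _ => QuotientAddGroup.isOpenQuotientMap_mk
  let F : UnitAddTorus (Fin N) → ℂ := fun z => f (fun j => 2 * Real.pi * Function.surjInv hq.surjective z j)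
  have hF : ∀ y : Fin N → ℝ, F (fun j => (y j : UnitAddCircle)) = f (fun j => 2 * Real.pi * y j) := by
    intro y
    set y' := Function.surjInv hq.surjective (fun j => (y j : UnitAddCircle)) with hy'
    have h1 : ∀ j, ((y' j : ℝ) : UnitAddCircle) = (y j : UnitAddCircle) := fun j =>
      congrFun (Function.surjInv_eq hq.surjective (fun j => (y j : UnitAddCircle))) j
    have h2 : ∀ j, ∃ k : ℤ, y' j = y j + k := by
      intro j
      obtain ⟨k, hk⟩ := AddSubgroup.mem_zmultiples_iff.1 ((QuotientAddGroup.eq_iff_sub_mem).1 (h1 j))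
      exact ⟨k, by simp only [zsmul_eq_mul, mul_one] at hk; linarith⟩
    choose k hk using h2
    change f (fun j => 2 * Real.pi * y' j) = _
    rw [← hf.add_int k (fun j => 2 * Real.pi * y j)]
    congr 1
    ext j
    simp only [hk, mul_add, Pi.add_apply]
  refine ⟨⟨F, ?_⟩, hF⟩
  rw [hq.isQuotientMap.continuous_iff]
  have : F ∘ Pi.map (fun (_ : Fin N) (t : ℝ) => (t : UnitAddCircle)) =
      fun y => f (fun j => 2 * Real.pi * y j) := funext hF
  rw [this]
  fun_prop

lemma avg_eq_unit (f : (Fin N → ℝ) → ℂ) :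
    avg f = ∫ y in {y : Fin N → ℝ | ∀ i, y i ∈ Ioc (0:ℝ) (0 + 1)}, f (fun j => 2 * Real.pi * y j) := by
  have h2 : (0:ℝ) < 2 * Real.pi := by positivity
  have h3 := Measure.setIntegral_comp_smul_of_pos (μ := (volume : Measure (Fin N → ℝ))) f
    {y : Fin N → ℝ | ∀ i, y i ∈ Ioc (0:ℝ) (0 + 1)} h2
  have h4 : (2 * Real.pi) • {y : Fin N → ℝ | ∀ i, y i ∈ Ioc (0:ℝ) (0 + 1)} =
      Set.pi univ (fun _ => Ioc (0:ℝ) (2 * Real.pi)) := by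
    ext x
    simp only [Set.mem_smul_set_iff_inv_smul_mem₀ h2.ne', mem_ofPred_eq, Set.mem_pi, mem_univ,
      true_imp_iff, Pi.smul_apply, smul_eq_mul, mem_Ioc, zero_add]
    refine forall_congr' fun i => and_congr ?_ ?_
    · simp [Real.pi_pos]
    · rw [inv_mul_le_iff₀ h2, mul_one]
  have h5 : ∫ x in cell N, f x = ∫ x in Set.pi univ (fun _ => Ioc (0:ℝ) (2 * Real.pi)), f x :=
    setIntegral_congr_set (Measure.univ_pi_Ioc_ae_eq_Icc).symm
  rw [h4] at h3
  rw [avg, h5]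
  have h6 : ∀ y : Fin N → ℝ, f ((2 * Real.pi) • y) = f (fun j => 2 * Real.pi * y j) := fun y => rfl
  simp only [h6] at h3
  rw [h3]
  simp

/-- The integral over the torus may be computed on the unit box at any base point; the boxes based
at `0` and at `v/2π` are compared. -/
lemma avg_translate {f : (Fin N → ℝ) → ℂ} (hf : IsPer f) (hc : Continuous f) (v : Fin N → ℝ) :
    avg (fun x => f (x + v)) = avg f := by
  obtain ⟨F, hF⟩ := hf.exists_torus hc
  have key := (UnitAddTorus.integral_preimage F 0).symm.trans
    (UnitAddTorus.integral_preimage F (fun j => (2 * Real.pi)⁻¹ * v j))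
  simp only [hF] at key
  rw [avg_eq_unit, avg_eq_unit]
  simp only [Pi.zero_apply] at key
  rw [key]
  have hmp := measurePreserving_add_right (volume : Measure (Fin N → ℝ)) (fun j => (2 * Real.pi)⁻¹ * v j)
  have key2 := hmp.setIntegral_preimage_emb (MeasurableEquiv.addRight _).measurableEmbedding
    (fun x => f (fun j => 2 * Real.pi * x j))
    {x | ∀ i, x i ∈ Ioc ((2 * Real.pi)⁻¹ * v i) ((2 * Real.pi)⁻¹ * v i + 1)}
  rw [← key2]
  have hp : (2 * Real.pi) ≠ 0 := by positivity
  have : ((fun x : Fin N → ℝ => x + fun j => (2 * Real.pi)⁻¹ * v j) ⁻¹'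
    {x | ∀ i, x i ∈ Ioc ((2 * Real.pi)⁻¹ * v i) ((2 * Real.pi)⁻¹ * v i + 1)}) =
      {y : Fin N → ℝ | ∀ i, y i ∈ Ioc (0:ℝ) (0 + 1)} := by
    ext y
    simp [add_comm]
  rw [this]
  congr 1
  ext y
  congr 1
  ext j
  simp only [Pi.add_apply, mul_add]
  rw [mul_inv_cancel_left₀ hp]

/-- The exponential `e^{i m·ξ}`. -/
noncomputable def ex (m : Fin N → ℤ) (ξ : CSpace N) : ℂ :=
  Complex.exp (Complex.I * ∑ j, (m j : ℂ) * ξ j)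

lemma mFourier_coe (m : Fin N → ℤ) (y : Fin N → ℝ) :
    UnitAddTorus.mFourier m (fun j => (y j : UnitAddCircle)) =
      ex m (toC (fun j => 2 * Real.pi * y j)) := by
  simp only [UnitAddTorus.mFourier, ContinuousMap.coe_mk, fourier_coe_apply, ex, toC,
    ← Complex.exp_sum, Finset.mul_sum]
  congr 1
  refine Finset.sum_congr rfl fun j _ => ?_
  push_cast
  ring

/-- The Fourier coefficient of a function on the real torus. -/
noncomputable def avgCoef (f : (Fin N → ℝ) → ℂ) (m : Fin N → ℤ) : ℂ :=
  avg (fun x => ex (-m) (toC x) * f x)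

lemma hasSum_avgCoef {f : (Fin N → ℝ) → ℂ} (hf : IsPer f) (hc : Continuous f)
    (hs : Summable (avgCoef f)) (x : Fin N → ℝ) :
    HasSum (fun m => avgCoef f m * ex m (toC x)) (f x) := by
  obtain ⟨F, hF⟩ := hf.exists_torus hc
  have hcoef : UnitAddTorus.mFourierCoeff F = avgCoef f := by
    ext m
    rw [UnitAddTorus.mFourierCoeff_eq_integral F m 0, avgCoef, avg_eq_unit]
    simp only [mFourier_coe, hF, smul_eq_mul, Pi.zero_apply]
  have hp : (2 * Real.pi) ≠ 0 := by positivity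
  have := UnitAddTorus.hasSum_mFourier_series_apply_of_summable (f := F) (by rwa [hcoef])
    (fun j => (((2 * Real.pi)⁻¹ * x j : ℝ) : UnitAddCircle))
  rw [hcoef, hF] at this
  simp only [mFourier_coe, mul_inv_cancel_left₀ hp, smul_eq_mul] at this
  exact this

/-! ### Elementary properties of mean values -/

lemma continuous_toC : Continuous (toC : (Fin N → ℝ) → CSpace N) := by
  unfold toC; fun_prop

lemma isCompact_cell : IsCompact (cell N) := isCompact_Icc

lemma integrableOn_cell {f : (Fin N → ℝ) → ℂ} (hf : Continuous f) :
    IntegrableOn f (cell N) := hf.continuousOn.integrableOn_compact isCompact_cell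

lemma avg_add {f g : (Fin N → ℝ) → ℂ} (hf : Continuous f) (hg : Continuous g) :
    avg (fun x => f x + g x) = avg f + avg g := by
  simp only [avg]
  rw [integral_add (integrableOn_cell hf) (integrableOn_cell hg), mul_add]

lemma avg_sub {f g : (Fin N → ℝ) → ℂ} (hf : Continuous f) (hg : Continuous g) :
    avg (fun x => f x - g x) = avg f - avg g := by
  simp only [avg]
  rw [integral_sub (integrableOn_cell hf) (integrableOn_cell hg), mul_sub]

lemma avg_const_mul (c : ℂ) (f : (Fin N → ℝ) → ℂ) : avg (fun x => c * f x) = c * avg f := by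
  simp only [avg]
  rw [integral_const_mul]
  ring

lemma volume_cell : (volume (cell N)).toReal = (2 * Real.pi) ^ N := by
  rw [cell, Real.volume_Icc_pi_toReal]
  · simp
  · intro i; positivity

lemma norm_avg_le {f : (Fin N → ℝ) → ℂ} {M : ℝ} (hM : ∀ x, ‖f x‖ ≤ M) : ‖avg f‖ ≤ M := by
  have h : ‖∫ x in cell N, f x‖ ≤ M * (volume (cell N)).toReal :=
    norm_setIntegral_le_of_norm_le_const isCompact_cell.measure_lt_top fun x _ => hM x
  rw [volume_cell] at h
  have hp : (0:ℝ) < (2 * Real.pi) ^ N := by positivity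
  rw [avg, norm_mul, Complex.norm_real, Real.norm_of_nonneg (by positivity),
    inv_mul_le_iff₀ hp]
  linarith

lemma avg_tsum {ι : Type*} [Countable ι] {f : ι → (Fin N → ℝ) → ℂ} {u : ι → ℝ}
    (hf : ∀ k, Continuous (f k)) (hu : Summable u) (hfu : ∀ k x, ‖f k x‖ ≤ u k) :
    avg (fun x => ∑' k, f k x) = ∑' k, avg (f k) := by
  simp only [avg]
  rw [← integral_tsum_of_summable_integral_norm (fun k => integrableOn_cell (hf k)), tsum_mul_left]
  refine Summable.of_nonneg_of_le (fun k => integral_nonneg fun x => norm_nonneg _) (fun k => ?_)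
    (hu.mul_right ((2 * Real.pi) ^ N))
  have : ‖∫ x in cell N, ‖f k x‖‖ ≤ u k * (volume (cell N)).toReal :=
    norm_setIntegral_le_of_norm_le_const isCompact_cell.measure_lt_top fun x _ => by
      simpa using hfu k x
  rw [volume_cell] at this
  exact (le_abs_self _).trans this

lemma avg_intervalIntegral {G : (Fin N → ℝ) → ℝ → ℂ}
    (hG : ContinuousOn (Function.uncurry G) (univ ×ˢ Icc 0 1)) :
    avg (fun x => ∫ t in (0:ℝ)..1, G x t) = ∫ t in (0:ℝ)..1, avg (fun x => G x t) := by
  simp only [avg]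
  rw [intervalIntegral.integral_const_mul]
  congr 1
  simp only [intervalIntegral.integral_of_le zero_le_one]
  refine integral_integral_swap ?_
  rw [Measure.prod_restrict]
  have : IntegrableOn (Function.uncurry G) (cell N ×ˢ Icc 0 1) (volume.prod volume) :=
    (hG.mono (Set.prod_mono (subset_univ _) subset_rfl)).integrableOn_compact
      (isCompact_cell.prod isCompact_Icc)
  exact this.mono_set (Set.prod_mono subset_rfl Ioc_subset_Icc_self)

/-! ### Exponentials -/

/-- The length `∑ |m_j|` of an integer vector. -/
def l1 (m : Fin N → ℤ) : ℝ := ∑ j, |(m j : ℝ)|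

lemma l1_nonneg (m : Fin N → ℤ) : 0 ≤ l1 m := Finset.sum_nonneg fun _ _ => abs_nonneg _

lemma l1_add_le (m k : Fin N → ℤ) : l1 (m + k) ≤ l1 m + l1 k := by
  rw [l1, l1, l1, ← Finset.sum_add_distrib]
  refine Finset.sum_le_sum fun j _ => ?_
  push_cast [Pi.add_apply]
  exact abs_add_le _ _

lemma ex_add_right (m : Fin N → ℤ) (ξ ζ : CSpace N) : ex m (ξ + ζ) = ex m ξ * ex m ζ := by
  simp [ex, ← Complex.exp_add, mul_add, Finset.sum_add_distrib]

lemma ex_add_left (m k : Fin N → ℤ) (ξ : CSpace N) : ex (m + k) ξ = ex m ξ * ex k ξ := by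
  simp [ex, ← Complex.exp_add, add_mul, mul_add, Finset.sum_add_distrib]

@[simp] lemma ex_zero_left (ξ : CSpace N) : ex 0 ξ = 1 := by simp [ex]

lemma continuous_ex (m : Fin N → ℤ) : Continuous (ex m) := by
  unfold ex; fun_prop

lemma differentiable_ex (m : Fin N → ℤ) : Differentiable ℂ (ex m) := by
  unfold ex; fun_prop

lemma norm_ex (m : Fin N → ℤ) (ξ : CSpace N) :
    ‖ex m ξ‖ = Real.exp (-∑ j, (m j : ℝ) * (ξ j).im) := by
  rw [ex, Complex.norm_exp]
  congr 1
  simp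

lemma norm_ex_toC (m : Fin N → ℤ) (x : Fin N → ℝ) : ‖ex m (toC x)‖ = 1 := by
  simp [norm_ex, toC]

lemma norm_ex_le (m : Fin N → ℤ) {ξ : CSpace N} {a : ℝ} (hξ : ξ ∈ closedStrip N a) :
    ‖ex m ξ‖ ≤ Real.exp (a * l1 m) := by
  rw [norm_ex, Real.exp_le_exp, l1, Finset.mul_sum, ← Finset.sum_neg_distrib]
  refine Finset.sum_le_sum fun j _ => (neg_le_abs _).trans ?_
  rw [abs_mul, mul_comm]
  exact mul_le_mul_of_nonneg_right (hξ j) (abs_nonneg _)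

lemma ex_periodic (m : Fin N → ℤ) (ξ : CSpace N) (j : Fin N) :
    ex m (ξ + Pi.single j ((2 * Real.pi : ℝ) : ℂ)) = ex m ξ := by
  rw [ex_add_right]
  have : ex m (Pi.single j ((2 * Real.pi : ℝ) : ℂ)) = 1 := by
    rw [ex, Complex.exp_eq_one_iff]
    refine ⟨m j, ?_⟩
    simp [Pi.single_apply]
    ring
  rw [this, mul_one]

lemma openStrip_subset_closedStrip (a : ℝ) : openStrip N a ⊆ closedStrip N a :=
  fun _ h j => (h j).le

lemma closedStrip_subset_openStrip {a b : ℝ} (h : a < b) : closedStrip N a ⊆ openStrip N b :=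
  fun _ hξ j => (hξ j).trans_lt h

lemma isOpen_openStrip (a : ℝ) : IsOpen (openStrip N a) := by
  simp only [openStrip, ofPred_forall]
  exact isOpen_iInter_of_finite fun j => isOpen_lt (by fun_prop) continuous_const

lemma toC_mem_openStrip {a : ℝ} (ha : 0 < a) (x : Fin N → ℝ) : toC x ∈ openStrip N a := by
  intro j; simpa [toC] using ha

lemma add_single_mem_openStrip {a : ℝ} {ξ : CSpace N} (hξ : ξ ∈ openStrip N a) (j : Fin N) (t : ℝ) :
    ξ + Pi.single j (t : ℂ) ∈ openStrip N a := by
  intro i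
  have : ((Pi.single j (t : ℂ) : CSpace N) i).im = 0 := by
    by_cases h : i = j
    · subst h; simp
    · simp [h]
  simpa [this] using hξ i

lemma convex_openStrip (a : ℝ) : Convex ℝ (openStrip N a) := by
  intro x hx y hy s t hs ht hst j
  have h1 := hx j
  have h2 := hy j
  have e : ((s • x + t • y) j).im = s * (x j).im + t * (y j).im := by simp
  rw [e, abs_lt]
  rw [abs_lt] at h1 h2
  rcases hs.eq_or_lt with rfl | hs'
  · have : t = 1 := by linarith
    subst this
    constructor <;> linarith
  · constructor <;> nlinarith

lemma exists_lt_mem_openStrip {a : ℝ} (ha : 0 < a) {ξ : CSpace N} (hξ : ξ ∈ openStrip N a) :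
    ∃ a', 0 < a' ∧ a' < a ∧ ξ ∈ openStrip N a' := by
  have h : ∀ᶠ a' in nhdsWithin a (Iio a), ∀ j, |(ξ j).im| < a' := by
    rw [Filter.eventually_all]
    intro j
    exact mem_nhdsWithin_of_mem_nhds (Ioi_mem_nhds (hξ j))
  have h0 : ∀ᶠ a' in nhdsWithin a (Iio a), 0 < a' := mem_nhdsWithin_of_mem_nhds (Ioi_mem_nhds ha)
  have h1 : ∀ᶠ a' in nhdsWithin a (Iio a), a' < a := self_mem_nhdsWithin
  obtain ⟨a', h2, h3, h4⟩ := (h0.and (h1.and h)).exists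
  exact ⟨a', h2, h3, h4⟩

/-! ### Periodic holomorphic functions on a strip -/

/-- Periodic holomorphic functions on the open strip of half-width `a`. -/
structure Nice (a : ℝ) (u : CSpace N → ℂ) : Prop where
  per : ∀ ξ ∈ openStrip N a, ∀ j : Fin N, u (ξ + Pi.single j ((2 * Real.pi : ℝ) : ℂ)) = u ξ
  hol : DifferentiableOn ℂ u (openStrip N a)

/-- The `m`-th Fourier coefficient, with `u = ∑ cf u m e^{i m·ξ}`. -/
noncomputable def cf (u : CSpace N → ℂ) : (Fin N → ℤ) → ℂ := avgCoef (fun x => u (toC x))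

lemma mean_eq_cf (u : CSpace N → ℂ) : mean u = cf u 0 := by
  simp [mean, cf, avgCoef, avg]

namespace Nice
variable {a : ℝ} {u v : CSpace N → ℂ}

lemma ex (m : Fin N → ℤ) : Nice a (TorusLinear.ex m) :=
  ⟨fun ξ _ j => ex_periodic m ξ j, (differentiable_ex m).differentiableOn⟩

lemma const (c : ℂ) : Nice a (fun _ : CSpace N => c) := ⟨fun _ _ _ => rfl, by fun_prop⟩

lemma add (hu : Nice a u) (hv : Nice a v) : Nice a (fun ξ => u ξ + v ξ) :=
  ⟨fun ξ h j => by rw [hu.per ξ h, hv.per ξ h], hu.hol.add hv.hol⟩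

lemma mul (hu : Nice a u) (hv : Nice a v) : Nice a (fun ξ => u ξ * v ξ) :=
  ⟨fun ξ h j => by rw [hu.per ξ h, hv.per ξ h], hu.hol.mul hv.hol⟩

lemma sum {ι : Type*} {s : Finset ι} {u : ι → CSpace N → ℂ} (hu : ∀ i ∈ s, Nice a (u i)) :
    Nice a (fun ξ => ∑ i ∈ s, u i ξ) :=
  ⟨fun ξ h j => Finset.sum_congr rfl fun i hi => (hu i hi).per ξ h j,
    DifferentiableOn.fun_sum fun i hi => (hu i hi).hol⟩

lemma congr (hu : Nice a u) (h : EqOn v u (openStrip N a)) : Nice a v :=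
  ⟨fun ξ hξ j => by
    rw [h hξ, h (add_single_mem_openStrip hξ j _), hu.per ξ hξ], hu.hol.congr h⟩

lemma mono {b : ℝ} (hu : Nice a u) (hb : b ≤ a) : Nice b u :=
  have hs : openStrip N b ⊆ openStrip N a := fun _ h j => (h j).trans_le hb
  ⟨fun ξ h j => hu.per ξ (hs h) j, hu.hol.mono hs⟩

/-- The restriction to a translate `ℝ^N + ζ` of the real torus. -/
lemma continuous_shift (hu : Nice a u) {ζ : CSpace N} (hζ : ζ ∈ openStrip N a) :
    Continuous (fun x => u (toC x + ζ)) := by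
  rw [← continuousOn_univ]
  refine hu.hol.continuousOn.comp (by have := @continuous_toC N; fun_prop) fun x _ j => ?_
  simpa [toC] using hζ j

lemma isPer_shift (hu : Nice a u) {ζ : CSpace N} (hζ : ζ ∈ openStrip N a) :
    IsPer (fun x => u (toC x + ζ)) := by
  intro x j
  have h := hu.per (toC x + ζ) (fun j => by simpa [toC] using hζ j) j
  refine Eq.trans ?_ h
  change u _ = u _
  congr 1
  ext i
  by_cases hi : i = j
  · subst hi
    simp [toC]
    ring
  · simp [toC, hi]

lemma continuous_real (hu : Nice a u) (ha : 0 < a) : Continuous (fun x => u (toC x)) := by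
  simpa using hu.continuous_shift (ζ := 0) (fun j => by simpa using ha)

lemma isPer_real (hu : Nice a u) (ha : 0 < a) : IsPer (fun x => u (toC x)) := by
  simpa using hu.isPer_shift (ζ := 0) (fun j => by simpa using ha)

/-- The mean value does not change when the torus is shifted in an imaginary direction. -/
lemma avg_shift (hu : Nice a u) {η : Fin N → ℝ} (hη : ∀ j, |η j| < a) :
    avg (fun x => u (toC x + Complex.I • toC η)) = avg (fun x => u (toC x)) := by
  have hmem : ∀ (x : Fin N → ℝ) (z : ℂ), 0 ≤ z.im → z.im ≤ 1 →
      toC x + z • toC η ∈ openStrip N a := by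
    intro x z h0 h1 j
    have e : ((toC x + z • toC η) j).im = z.im * η j := by simp [toC]
    rw [e, abs_mul, abs_of_nonneg h0]
    exact (mul_le_of_le_one_left (abs_nonneg _) h1).trans_lt (hη j)
  have hmem' : ∀ (z : ℂ), 0 ≤ z.im → z.im ≤ 1 → z • toC η ∈ openStrip N a := by
    intro z h0 h1
    have := hmem 0 z h0 h1
    have e : toC (0 : Fin N → ℝ) = 0 := by ext; simp [toC]
    simpa [e] using this
  -- `G` is invariant under real translations of `z`. Cauchy's theorem on the unit square, averaged
  -- over the torus, makes the vertical sides cancel and leaves `G 0 = G I`.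
  let G : ℂ → ℂ := fun z => avg (fun x => u (toC x + z • toC η))
  have hGt : ∀ (z : ℂ) (t : ℝ), 0 ≤ z.im → z.im ≤ 1 → G (z + t) = G z := by
    intro z t h0 h1
    have := avg_translate (hu.isPer_shift (hmem' z h0 h1)) (hu.continuous_shift (hmem' z h0 h1))
      (t • η)
    simp only [G]
    rw [← this]
    congr 1
    ext x
    congr 1
    ext j
    simp [toC]
    ring
  have hcont : ∀ γ : ℝ → ℂ, Continuous γ → (∀ t ∈ Icc (0:ℝ) 1, 0 ≤ (γ t).im ∧ (γ t).im ≤ 1) →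
      ContinuousOn (fun p : (Fin N → ℝ) × ℝ => u (toC p.1 + γ p.2 • toC η)) (univ ×ˢ Icc 0 1) := by
    intro γ hγ hγ'
    refine hu.hol.continuousOn.comp ?_ fun p hp => hmem _ _ (hγ' _ hp.2).1 (hγ' _ hp.2).2
    have := @continuous_toC N
    fun_prop
  let γ₁ : ℝ → ℂ := fun t => t
  let γ₂ : ℝ → ℂ := fun t => t + Complex.I
  let γ₃ : ℝ → ℂ := fun t => 1 + t * Complex.I
  let γ₄ : ℝ → ℂ := fun t => t * Complex.I
  have c₁ := hcont γ₁ (by fun_prop) (by intro t ht; simp [γ₁])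
  have c₂ := hcont γ₂ (by fun_prop) (by intro t ht; simp [γ₂])
  have c₃ := hcont γ₃ (by fun_prop) (by intro t ht; simpa [γ₃] using ht)
  have c₄ := hcont γ₄ (by fun_prop) (by intro t ht; simpa [γ₄] using ht)
  let F : (Fin N → ℝ) → ℝ → ℂ := fun x t =>
    u (toC x + γ₁ t • toC η) - u (toC x + γ₂ t • toC η)
      + (Complex.I * u (toC x + γ₃ t • toC η) - Complex.I * u (toC x + γ₄ t • toC η))
  have hF : ContinuousOn (Function.uncurry F) (univ ×ˢ Icc 0 1) :=
    (c₁.sub c₂).add ((c₃.const_smul Complex.I).sub (c₄.const_smul Complex.I))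
  have hzero : ∀ x, ∫ t in (0:ℝ)..1, F x t = 0 := by
    intro x
    have hr : ∀ {f : (Fin N → ℝ) × ℝ → ℂ}, ContinuousOn f (univ ×ˢ Icc 0 1) →
        IntervalIntegrable (fun t => f (x, t)) volume 0 1 := by
      intro f hf
      refine ContinuousOn.intervalIntegrable ?_
      rw [uIcc_of_le zero_le_one]
      exact hf.comp (by fun_prop) fun t ht => ⟨mem_univ _, ht⟩
    have key := Complex.integral_boundary_rect_eq_zero_of_differentiableOn
      (fun z => u (toC x + z • toC η)) 0 (1 + Complex.I) (by
        refine hu.hol.comp (by fun_prop) fun z hz => ?_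
        have h2 := hz.2
        simp only [Complex.zero_im, Complex.add_im, Complex.one_im, Complex.I_im, zero_add,
          mem_preimage, uIcc_of_le zero_le_one] at h2
        exact hmem x z h2.1 h2.2)
    simp only [F]
    rw [intervalIntegral.integral_add ((hr c₁).sub (hr c₂))
        (((hr c₃).const_mul Complex.I).sub ((hr c₄).const_mul Complex.I)),
      intervalIntegral.integral_sub (hr c₁) (hr c₂),
      intervalIntegral.integral_sub ((hr c₃).const_mul Complex.I) ((hr c₄).const_mul Complex.I),
      intervalIntegral.integral_const_mul, intervalIntegral.integral_const_mul]
    simp only [γ₁, γ₂, γ₃, γ₄]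
    simp at key ⊢
    linear_combination key
  have h := avg_intervalIntegral hF
  have hz : avg (fun x => ∫ t in (0:ℝ)..1, F x t) = 0 := by
    simp only [hzero]; simp [avg]
  have hav : ∀ t ∈ uIcc (0:ℝ) 1, avg (fun x => F x t) = G 0 - G Complex.I := by
    intro t ht
    rw [uIcc_of_le zero_le_one] at ht
    have d : ∀ z : ℂ, 0 ≤ z.im → z.im ≤ 1 → Continuous (fun x => u (toC x + z • toC η)) :=
      fun z h0 h1 => hu.continuous_shift (hmem' z h0 h1)
    have d₁ := d (γ₁ t) (by simp [γ₁]) (by simp [γ₁])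
    have d₂ := d (γ₂ t) (by simp [γ₂]) (by simp [γ₂])
    have d₃ := d (γ₃ t) (by simpa [γ₃] using ht.1) (by simpa [γ₃] using ht.2)
    have d₄ := d (γ₄ t) (by simpa [γ₄] using ht.1) (by simpa [γ₄] using ht.2)
    have : avg (fun x => F x t) = G (γ₁ t) - G (γ₂ t) + (Complex.I * G (γ₃ t) - Complex.I * G (γ₄ t)) := by
      simp only [F]
      have d₃' := d₃.const_smul Complex.I
      have d₄' := d₄.const_smul Complex.I
      rw [avg_add (by exact d₁.sub d₂) (by exact d₃'.sub d₄'), avg_sub (by exact d₁) (by exact d₂),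
        avg_sub (by exact d₃') (by exact d₄'), avg_const_mul, avg_const_mul]
    rw [this]
    have e₁ : G (γ₁ t) = G 0 := by
      have := hGt 0 t (by simp) (by simp)
      simpa [γ₁] using this
    have e₂ : G (γ₂ t) = G Complex.I := by
      have := hGt Complex.I t (by simp) (by simp)
      rw [← this]; simp only [γ₂]; rw [add_comm]
    have e₃ : G (γ₃ t) = G (γ₄ t) := by
      have := hGt (γ₄ t) 1 (by simpa [γ₄] using ht.1) (by simpa [γ₄] using ht.2)
      rw [← this]; simp only [γ₃, γ₄]; rw [add_comm]; simp
    rw [e₁, e₂, e₃]; ring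
  rw [hz, intervalIntegral.integral_congr hav] at h
  simp only [intervalIntegral.integral_const, sub_zero, one_smul] at h
  have h' : G Complex.I = G 0 := by linear_combination h
  simpa [G] using h'

end Nice

/-! ### Exponentially weighted summability. -/

lemma summable_exp_neg_abs {c : ℝ} (hc : 0 < c) : Summable (fun k : ℤ => Real.exp (-c * |(k:ℝ)|)) := by
  have h : Summable (fun n : ℕ => Real.exp (-c * n)) := by
    have := Real.summable_exp_nat_mul_iff.2 (neg_lt_zero.2 hc)
    simpa [mul_comm] using this
  refine Summable.of_nat_of_neg ?_ ?_ <;> simpa using h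

lemma summable_exp_neg_l1 {c : ℝ} (hc : 0 < c) :
    Summable (fun m : Fin N → ℤ => Real.exp (-c * l1 m)) := by
  induction N with
  | zero => exact Summable.of_finite
  | succ N ih =>
    rw [← (Fin.consEquiv (fun _ : Fin (N + 1) => ℤ)).summable_iff]
    have := (summable_exp_neg_abs hc).mul_of_nonneg ih (fun _ => (Real.exp_pos _).le)
      (fun _ => (Real.exp_pos _).le)
    refine this.congr fun p => ?_
    rw [← Real.exp_add]
    simp [l1, Fin.sum_univ_succ, Fin.consEquiv]
    ring

/-- Absolute convergence of `∑ c_m e^{a|m|}`. -/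
def ExpSum (a : ℝ) (c : (Fin N → ℤ) → ℂ) : Prop := Summable (fun m => ‖c m‖ * Real.exp (a * l1 m))

lemma ExpSum.mono {a b : ℝ} {c : (Fin N → ℤ) → ℂ} (h : ExpSum b c) (hab : a ≤ b) : ExpSum a c := by
  refine Summable.of_nonneg_of_le (fun m => by positivity) (fun m => ?_) h
  have := l1_nonneg m
  gcongr

lemma ExpSum.summable_norm {a : ℝ} {c : (Fin N → ℤ) → ℂ} (h : ExpSum a c) (ha : 0 ≤ a) :
    Summable (fun m => ‖c m‖) := by
  simpa [ExpSum] using h.mono ha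

lemma ExpSum.of_le {a b M : ℝ} {c : (Fin N → ℤ) → ℂ} (hab : a < b)
    (h : ∀ m, ‖c m‖ ≤ M * Real.exp (-b * l1 m)) : ExpSum a c := by
  refine Summable.of_nonneg_of_le (fun m => by positivity) (fun m => ?_)
    ((summable_exp_neg_l1 (N := N) (sub_pos.2 hab)).mul_left M)
  calc ‖c m‖ * Real.exp (a * l1 m) ≤ (M * Real.exp (-b * l1 m)) * Real.exp (a * l1 m) := by
        gcongr; exact h m
    _ = M * Real.exp (-(b - a) * l1 m) := by
        rw [mul_assoc, ← Real.exp_add]; ring_nf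

/-- Since `t ≤ e^t`, the factor `|m|` of one derivative is paid for by the loss of strip width `b -
a`. -/
lemma ExpSum.l1_mul {a b : ℝ} {c : (Fin N → ℤ) → ℂ} (h : ExpSum b c) (hab : a < b) :
    Summable (fun m => ‖c m‖ * l1 m * Real.exp (a * l1 m)) := by
  have hd : 0 < b - a := sub_pos.2 hab
  refine Summable.of_nonneg_of_le (fun m => ?_) (fun m => ?_) (h.mul_left (b - a)⁻¹)
  · have := l1_nonneg m; positivity
  · have h1 : (b - a) * l1 m ≤ Real.exp ((b - a) * l1 m) :=
      (by linarith [Real.add_one_le_exp ((b - a) * l1 m)])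
    have h2 : l1 m ≤ (b - a)⁻¹ * Real.exp ((b - a) * l1 m) := by
      rw [← div_eq_inv_mul, le_div_iff₀ hd]; linarith
    calc ‖c m‖ * l1 m * Real.exp (a * l1 m)
        ≤ ‖c m‖ * ((b - a)⁻¹ * Real.exp ((b - a) * l1 m)) * Real.exp (a * l1 m) := by gcongr
      _ = (b - a)⁻¹ * (‖c m‖ * (Real.exp ((b - a) * l1 m) * Real.exp (a * l1 m))) := by ring
      _ = (b - a)⁻¹ * (‖c m‖ * Real.exp (b * l1 m)) := by rw [← Real.exp_add]; ring_nf

/-! ### Fourier expansion of periodic holomorphic functions. -/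

namespace Nice
variable {a : ℝ} {u v : CSpace N → ℂ}

lemma avgCoef_shift (hu : Nice a u) {η : Fin N → ℝ} (hη : ∀ j, |η j| < a) (m : Fin N → ℤ) :
    avgCoef (fun x => u (toC x + Complex.I • toC η)) m
      = TorusLinear.ex m (Complex.I • toC η) * cf u m := by
  have h := ((Nice.ex (a := a) (-m)).mul hu).avg_shift hη
  simp only [ex_add_right, mul_assoc, mul_left_comm _ (TorusLinear.ex (-m) (Complex.I • toC η)),
    avg_const_mul] at h
  rw [cf, avgCoef, avgCoef, ← h, ← mul_assoc, ← ex_add_left]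
  simp

lemma norm_cf_le_of_lt (hu : Nice a u) {a' M : ℝ} (ha' : 0 ≤ a') (haa : a' < a)
    (hM : ∀ ξ ∈ closedStrip N a', ‖u ξ‖ ≤ M) (m : Fin N → ℤ) :
    ‖cf u m‖ ≤ M * Real.exp (-a' * l1 m) := by
  -- The shift is directed against the signs of `m`, so that `e^{i m·ξ}` has modulus `e^{a'|m|}` on
  -- the shifted torus.
  let η : Fin N → ℝ := fun j => -(a' * SignType.sign (m j : ℝ))
  have hη' : ∀ j, |η j| ≤ a' := by
    intro j
    simp only [η, abs_neg, abs_mul, abs_of_nonneg ha']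
    refine mul_le_of_le_one_right ha' ?_
    rcases lt_trichotomy (m j : ℝ) 0 with h | h | h <;> simp [h]
  have h := hu.avgCoef_shift (fun j => (hη' j).trans_lt haa) m
  have h1 : ‖avgCoef (fun x => u (toC x + Complex.I • toC η)) m‖ ≤ M := by
    refine norm_avg_le fun x => ?_
    rw [norm_mul, norm_ex_toC, one_mul]
    refine hM _ fun j => ?_
    simpa [toC] using hη' j
  rw [h, norm_mul, norm_ex] at h1
  have h2 : -∑ j, (m j : ℝ) * ((Complex.I • toC η) j).im = a' * l1 m := by
    rw [l1, Finset.mul_sum, ← Finset.sum_neg_distrib]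
    refine Finset.sum_congr rfl fun j _ => ?_
    simp only [toC, Pi.smul_apply, smul_eq_mul, Complex.mul_im, Complex.I_re, Complex.I_im,
      Complex.ofReal_re, zero_mul, one_mul, zero_add, η]
    rw [← sign_mul_self]
    ring
  rw [h2] at h1
  rw [neg_mul, Real.exp_neg, ← div_eq_mul_inv, le_div_iff₀ (Real.exp_pos _), mul_comm]
  exact h1

/-- Limit `a' ↑ a` of the previous bound: the full width `a` is reached although `u` need not extend
to the boundary. -/
lemma norm_cf_le (hu : Nice a u) (ha : 0 < a) {M : ℝ}
    (hM : ∀ ξ ∈ openStrip N a, ‖u ξ‖ ≤ M) (m : Fin N → ℤ) :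
    ‖cf u m‖ ≤ M * Real.exp (-a * l1 m) := by
  have h1 : ∀ᶠ a' in nhdsWithin a (Iio a), ‖cf u m‖ ≤ M * Real.exp (-a' * l1 m) := by
    have h0 : ∀ᶠ a' in nhdsWithin a (Iio a), 0 < a' := mem_nhdsWithin_of_mem_nhds (Ioi_mem_nhds ha)
    filter_upwards [h0, self_mem_nhdsWithin] with a' h2 h3
    exact hu.norm_cf_le_of_lt h2.le h3 (fun ξ hξ => hM ξ (closedStrip_subset_openStrip h3 hξ)) m
  have h2 : Filter.Tendsto (fun a' => M * Real.exp (-a' * l1 m)) (nhdsWithin a (Iio a))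
      (nhds (M * Real.exp (-a * l1 m))) :=
    (Continuous.tendsto (by fun_prop) a).mono_left nhdsWithin_le_nhds
  exact ge_of_tendsto h2 h1

lemma bounded (hu : Nice a u) {a' : ℝ} (haa : a' < a) :
    ∃ M, ∀ ξ ∈ closedStrip N a', ‖u ξ‖ ≤ M := by
  let S : Set ((Fin N → ℝ) × (Fin N → ℝ)) := cell N ×ˢ Icc (fun _ => -a') (fun _ => a')
  have hS : IsCompact S := isCompact_cell.prod isCompact_Icc
  have hmem : ∀ (x η : Fin N → ℝ), η ∈ Icc (fun _ => -a') (fun _ => a') →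
      Complex.I • toC η ∈ openStrip N a ∧ toC x + Complex.I • toC η ∈ openStrip N a := by
    intro x η hη
    have : ∀ j, |η j| < a := fun j => (abs_le.2 ⟨hη.1 j, hη.2 j⟩).trans_lt haa
    exact ⟨fun j => by simpa [toC] using this j, fun j => by simpa [toC] using this j⟩
  have hc : ContinuousOn (fun p : (Fin N → ℝ) × (Fin N → ℝ) => u (toC p.1 + Complex.I • toC p.2)) S := by
    refine hu.hol.continuousOn.comp ?_ fun p hp => (hmem _ _ hp.2).2
    have := @continuous_toC N
    fun_prop
  obtain ⟨M, hM⟩ := hS.exists_bound_of_continuousOn hc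
  refine ⟨M, fun ξ hξ => ?_⟩
  let η : Fin N → ℝ := fun j => (ξ j).im
  let x : Fin N → ℝ := fun j => (ξ j).re
  have hη : η ∈ Icc (fun _ => -a') (fun _ => a') :=
    ⟨fun j => (abs_le.1 (hξ j)).1, fun j => (abs_le.1 (hξ j)).2⟩
  have hp : (0:ℝ) < 2 * Real.pi := by positivity
  let n : Fin N → ℤ := fun j => ⌊x j / (2 * Real.pi)⌋
  let y : Fin N → ℝ := fun j => x j - 2 * Real.pi * n j
  have hy : y ∈ cell N := by
    have h1 := fun j => Int.floor_le (x j / (2 * Real.pi))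
    have h2 := fun j => Int.lt_floor_add_one (x j / (2 * Real.pi))
    refine ⟨fun j => ?_, fun j => ?_⟩
    · have := (le_div_iff₀ hp).1 (h1 j)
      simp only [y, n]; linarith
    · have := (div_lt_iff₀ hp).1 (h2 j)
      simp only [y, n]; linarith
  have hper := (hu.isPer_shift (hmem 0 η hη).1).add_int n y
  have e : ξ = toC (y + fun j => 2 * Real.pi * (n j : ℝ)) + Complex.I • toC η := by
    ext j
    simp only [toC, Pi.add_apply, Pi.smul_apply, smul_eq_mul, y, η, x, sub_add_cancel]
    rw [mul_comm]
    exact (Complex.re_add_im _).symm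
  rw [e, hper]
  exact hM (y, η) ⟨hy, hη⟩

lemma expSum_cf (hu : Nice a u) (ha : 0 < a) {a' : ℝ} (haa : a' < a) : ExpSum a' (cf u) := by
  obtain ⟨b, hb, hba⟩ := exists_between (max_lt haa ha)
  obtain ⟨M, hM⟩ := hu.bounded hba
  exact ExpSum.of_le ((le_max_left _ _).trans_lt hb)
    (hu.norm_cf_le_of_lt ((le_max_right _ _).trans hb.le) hba hM)

/-- On the torus shifted by `i Im ξ` the function has coefficients `cf u m * ex m (i Im ξ)`, which
are absolutely summable; the expansion on the real torus then applies to the shifted function. -/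
lemma hasSum (hu : Nice a u) (ha : 0 < a) {ξ : CSpace N} (hξ : ξ ∈ openStrip N a) :
    HasSum (fun m => cf u m * TorusLinear.ex m ξ) (u ξ) := by
  let η : Fin N → ℝ := fun j => (ξ j).im
  let x : Fin N → ℝ := fun j => (ξ j).re
  have e : ξ = toC x + Complex.I • toC η := by
    ext j
    simp only [toC, Pi.add_apply, Pi.smul_apply, smul_eq_mul, η, x]
    rw [mul_comm]
    exact (Complex.re_add_im _).symm
  have hη : Complex.I • toC η ∈ openStrip N a := fun j => by simpa [toC, η] using hξ j
  have hco := hu.avgCoef_shift (η := η) hξ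
  obtain ⟨a', h0, h1, h2⟩ := exists_lt_mem_openStrip ha hη
  have hs : Summable (avgCoef (fun x => u (toC x + Complex.I • toC η))) := by
    refine Summable.of_norm_bounded (hu.expSum_cf ha h1) fun m => ?_
    rw [hco, norm_mul, mul_comm]
    gcongr
    exact norm_ex_le m (openStrip_subset_closedStrip _ h2)
  have h := hasSum_avgCoef (hu.isPer_shift hη) (hu.continuous_shift hη) hs x
  rw [← e] at h
  refine h.congr_fun fun m => ?_
  rw [hco, e, ex_add_right]
  ring

lemma eqOn_of_cf_eq (hu : Nice a u) (hv : Nice a v) (ha : 0 < a) (h : ∀ m, cf u m = cf v m) :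
    EqOn u v (openStrip N a) := fun ξ hξ =>
  (hu.hasSum ha hξ).unique (by simpa only [h] using hv.hasSum ha hξ)

end Nice

/-! ### Fourier series -/

/-- The sum of a Fourier series. -/
noncomputable def syn (c : (Fin N → ℤ) → ℂ) (ξ : CSpace N) : ℂ := ∑' m, c m * ex m ξ

lemma norm_term_le {a : ℝ} (c : (Fin N → ℤ) → ℂ) (m : Fin N → ℤ) {ξ : CSpace N}
    (hξ : ξ ∈ closedStrip N a) : ‖c m * ex m ξ‖ ≤ ‖c m‖ * Real.exp (a * l1 m) := by
  rw [norm_mul]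
  gcongr
  exact norm_ex_le m hξ

lemma syn_periodic (c : (Fin N → ℤ) → ℂ) (ξ : CSpace N) (j : Fin N) :
    syn c (ξ + Pi.single j ((2 * Real.pi : ℝ) : ℂ)) = syn c ξ := by
  simp only [syn, ex_periodic]

lemma ExpSum.continuousOn_syn {a : ℝ} {c : (Fin N → ℤ) → ℂ} (h : ExpSum a c) :
    ContinuousOn (syn c) (closedStrip N a) :=
  continuousOn_tsum (fun m => ((continuous_ex m).const_smul (c m)).continuousOn) h
    fun m _ hξ => norm_term_le c m hξ

lemma ExpSum.norm_syn_le {a : ℝ} {c : (Fin N → ℤ) → ℂ} (h : ExpSum a c) {ξ : CSpace N}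
    (hξ : ξ ∈ closedStrip N a) : ‖syn c ξ‖ ≤ ∑' m, ‖c m‖ * Real.exp (a * l1 m) :=
  tsum_of_norm_bounded h.hasSum fun m => norm_term_le c m hξ

/-- The derivative of `e^{i m·ξ}`. -/
noncomputable def dex (m : Fin N → ℤ) : CSpace N →L[ℂ] ℂ :=
  ∑ j, (Complex.I * (m j : ℂ)) • ContinuousLinearMap.proj j

lemma norm_dex_le (m : Fin N → ℤ) : ‖dex m‖ ≤ l1 m := by
  refine ContinuousLinearMap.opNorm_le_bound _ (l1_nonneg m) fun ξ => ?_
  simp only [dex, sum_apply, smul_apply,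
    ContinuousLinearMap.proj_apply, smul_eq_mul]
  rw [l1, Finset.sum_mul]
  refine norm_sum_le_of_le _ fun j _ => ?_
  rw [norm_mul, norm_mul, Complex.norm_I, one_mul, Complex.norm_intCast]
  gcongr
  exact norm_le_pi_norm ξ j

lemma dex_single (m : Fin N → ℤ) (j : Fin N) : dex m (Pi.single j 1) = Complex.I * m j := by
  simp [dex, Pi.single_apply]

lemma hasFDerivAt_ex (m : Fin N → ℤ) (ξ : CSpace N) : HasFDerivAt (ex m) (ex m ξ • dex m) ξ := by
  have h : HasFDerivAt (fun ξ : CSpace N => Complex.I * ∑ j, (m j : ℂ) * ξ j) (dex m) ξ := by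
    have : (fun ξ : CSpace N => Complex.I * ∑ j, (m j : ℂ) * ξ j) = dex m := by
      ext ξ
      simp [dex, Finset.mul_sum, mul_assoc]
    rw [this]
    exact (dex m).hasFDerivAt
  exact h.cexp

lemma hasFDerivAt_syn {a : ℝ} (ha : 0 < a) {c : (Fin N → ℤ) → ℂ} (h : ∀ a' < a, ExpSum a' c)
    {ξ : CSpace N} (hξ : ξ ∈ openStrip N a) :
    HasFDerivAt (syn c) (∑' m, (c m * ex m ξ) • dex m) ξ ∧ Summable (fun m => (c m * ex m ξ) • dex m) := by
  obtain ⟨a', h0, h1, h2⟩ := exists_lt_mem_openStrip ha hξ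
  -- The series is differentiated termwise on the strip of half-width `a'` around `ξ`; the room
  -- between `a'` and `b` dominates the factor `|m|`.
  obtain ⟨b, hb, hba⟩ := exists_between h1
  have hu := (h b hba).l1_mul hb
  have hbd : ∀ m, ∀ ζ ∈ openStrip N a', ‖(c m * ex m ζ) • dex m‖
      ≤ ‖c m‖ * l1 m * Real.exp (a' * l1 m) := by
    intro m ζ hζ
    rw [norm_smul]
    calc _ ≤ (‖c m‖ * Real.exp (a' * l1 m)) * l1 m := by
          gcongr
          · exact norm_term_le c m (openStrip_subset_closedStrip _ hζ)
          · exact norm_dex_le m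
      _ = _ := by ring
  refine ⟨hasFDerivAt_tsum_of_isPreconnected (x₀ := ξ) hu (isOpen_openStrip a')
    (convex_openStrip a').isPreconnected (fun m ζ _ => ?_) hbd h2 ?_ h2,
    Summable.of_norm_bounded hu fun m => hbd m ξ h2⟩
  · have := (hasFDerivAt_ex m ζ).const_mul (c m)
    rwa [smul_smul] at this
  · exact Summable.of_norm_bounded (h a' h1) fun m =>
      norm_term_le c m (openStrip_subset_closedStrip _ h2)

lemma nice_syn {a : ℝ} (ha : 0 < a) {c : (Fin N → ℤ) → ℂ} (h : ∀ a' < a, ExpSum a' c) :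
    Nice a (syn c) :=
  ⟨fun ξ _ j => syn_periodic c ξ j,
    fun _ hξ => (hasFDerivAt_syn ha h hξ).1.differentiableAt.differentiableWithinAt⟩

lemma pderiv_syn {a : ℝ} (ha : 0 < a) {c : (Fin N → ℤ) → ℂ} (h : ∀ a' < a, ExpSum a' c) (j : Fin N) :
    EqOn (pderiv j (syn c)) (syn (fun m => Complex.I * m j * c m)) (openStrip N a) := by
  intro ξ hξ
  obtain ⟨h1, h2⟩ := hasFDerivAt_syn ha h hξ
  have h3 := (ContinuousLinearMap.apply ℂ ℂ (Pi.single j 1 : CSpace N)).map_tsum h2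
  rw [ContinuousLinearMap.apply_apply] at h3
  rw [pderiv, h1.fderiv, h3, syn]
  refine tsum_congr fun m => ?_
  simp [dex_single]
  ring

lemma expSum_deriv {a : ℝ} {c : (Fin N → ℤ) → ℂ} (h : ∀ a' < a, ExpSum a' c) (j : Fin N) :
    ∀ a' < a, ExpSum a' (fun m => Complex.I * m j * c m) := by
  intro a' ha'
  obtain ⟨b, hb, hba⟩ := exists_between ha'
  refine Summable.of_nonneg_of_le (fun m => by positivity) (fun m => ?_) ((h b hba).l1_mul hb)
  rw [norm_mul, norm_mul, Complex.norm_I, one_mul, Complex.norm_intCast, mul_comm |(m j : ℝ)|]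
  gcongr
  exact Finset.single_le_sum (f := fun j => |(m j : ℝ)|) (fun _ _ => abs_nonneg _) (Finset.mem_univ j)

/-! ### Orthogonality of exponentials and Fourier coefficients of products. -/

lemma avg_ex (m : Fin N → ℤ) : avg (fun x => ex m (toC x)) = if m = 0 then 1 else 0 := by
  split_ifs with h
  · subst h
    have := volume_cell (N := N)
    simp only [ex_zero_left, avg, setIntegral_const, Measure.real, this]
    rw [Complex.real_smul, mul_one, ← Complex.ofReal_mul, inv_mul_cancel₀ (by positivity)]
    simp
  · obtain ⟨j, hj⟩ := Function.ne_iff.1 h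
    have hn : Nice (N := N) 1 (ex m) := Nice.ex m
    -- Translation by `π/m_j` in a coordinate with `m_j ≠ 0` changes the sign of the exponential, so
    -- its mean equals its own negative.
    have h1 := avg_translate (hn.isPer_real one_pos) (hn.continuous_real one_pos)
      (Pi.single j (Real.pi / m j))
    have h2 : ∀ x : Fin N → ℝ, ex m (toC (x + Pi.single j (Real.pi / m j)))
        = (-1) * ex m (toC x) := by
      intro x
      have e : toC (x + Pi.single j (Real.pi / m j)) =
          toC x + (Pi.single j ((Real.pi / m j : ℝ) : ℂ) : CSpace N) := by
        ext i
        by_cases hi : i = j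
        · subst hi; simp [toC]
        · simp [toC, hi]
      rw [e, ex_add_right, mul_comm]
      congr 1
      have hj' : (m j : ℂ) ≠ 0 := by exact_mod_cast hj
      simp only [ex, Pi.single_apply, mul_ite, mul_zero, Finset.sum_ite_eq', Finset.mem_univ, if_true]
      push_cast
      rw [mul_div_cancel₀ _ hj', mul_comm, Complex.exp_pi_mul_I]
    simp only [h2, avg_const_mul] at h1
    linear_combination (-1/2 : ℂ) * h1

/-- Convolution of sequences. -/
noncomputable def conv (a c : (Fin N → ℤ) → ℂ) (m : Fin N → ℤ) : ℂ := ∑' k, a k * c (m - k)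

/-- Only one factor needs an absolutely convergent series: it is expanded and integrated termwise
against the other. With `v = 1` this identifies the coefficients of a Fourier series, and in general
it gives the convolution rule. -/
lemma cf_series_mul {c : (Fin N → ℤ) → ℂ} (hc : Summable (fun m => ‖c m‖)) {u v : CSpace N → ℂ}
    (hu : ∀ x, u (toC x) = syn c (toC x)) (hv : Continuous (fun x => v (toC x)))
    {M : ℝ} (hM : ∀ x, ‖v (toC x)‖ ≤ M) (m : Fin N → ℤ) :
    cf (fun ξ => u ξ * v ξ) m = conv c (cf v) m := by
  rw [cf, avgCoef]
  have h1 : (fun x => ex (-m) (toC x) * (u (toC x) * v (toC x))) =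
      fun x => ∑' k, (c k * (ex (-(m - k)) (toC x) * v (toC x))) := by
    ext x
    rw [hu, syn, ← tsum_mul_right, ← tsum_mul_left]
    refine tsum_congr fun k => ?_
    rw [neg_sub, sub_eq_neg_add, ex_add_left]
    ring
  rw [h1, avg_tsum (u := fun k => ‖c k‖ * M)]
  · refine tsum_congr fun k => ?_
    rw [avg_const_mul]
    rfl
  · intro k
    have := (continuous_ex (-(m - k))).comp (@continuous_toC N)
    exact (this.mul hv).const_smul (c k)
  · exact hc.mul_right M
  · intro k x
    rw [norm_mul, norm_mul, norm_ex_toC, one_mul]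
    gcongr
    exact hM x

lemma cf_one (m : Fin N → ℤ) : cf (fun _ : CSpace N => 1) m = if m = 0 then 1 else 0 := by
  rw [cf, avgCoef]
  simp only [mul_one, avg_ex, neg_eq_zero]

lemma cf_syn {c : (Fin N → ℤ) → ℂ} (hc : Summable (fun m => ‖c m‖)) : cf (syn c) = c := by
  ext m
  have h := cf_series_mul hc (u := syn c) (v := fun _ => 1) (fun _ => rfl) continuous_const
    (M := 1) (by simp) m
  simp only [mul_one] at h
  rw [h, conv, tsum_eq_single m]
  · simp [cf_one]
  · intro k hk
    rw [cf_one, if_neg (sub_ne_zero.2 hk.symm), mul_zero]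

namespace Nice
variable {a : ℝ} {u v : CSpace N → ℂ}

lemma eqOn_syn (hu : Nice a u) (ha : 0 < a) : EqOn u (syn (cf u)) (openStrip N a) :=
  fun _ hξ => (hu.hasSum ha hξ).tsum_eq.symm

lemma cf_mul (hu : Nice a u) (hv : Nice a v) (ha : 0 < a) (m : Fin N → ℤ) :
    cf (fun ξ => u ξ * v ξ) m = conv (cf u) (cf v) m := by
  obtain ⟨M, hM⟩ := hv.bounded ha
  refine cf_series_mul ((hu.expSum_cf ha ha).summable_norm le_rfl)
    (fun x => hu.eqOn_syn ha (toC_mem_openStrip ha x)) (hv.continuous_real ha)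
    (M := M) (fun x => hM _ fun j => by simp [toC]) m

lemma pderiv_eqOn (hu : Nice a u) (ha : 0 < a) (j : Fin N) :
    EqOn (pderiv j u) (syn (fun m => Complex.I * m j * cf u m)) (openStrip N a) := by
  intro ξ hξ
  rw [← pderiv_syn ha (fun a' h => hu.expSum_cf ha h) j hξ, TorusLinear.pderiv, TorusLinear.pderiv,
    Filter.EventuallyEq.fderiv_eq ((hu.eqOn_syn ha).eventuallyEq_of_mem
      ((isOpen_openStrip a).mem_nhds hξ))]

lemma pderiv (hu : Nice a u) (ha : 0 < a) (j : Fin N) : Nice a (pderiv j u) :=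
  (nice_syn ha (expSum_deriv (fun _ h => hu.expSum_cf ha h) j)).congr (hu.pderiv_eqOn ha j)

lemma cf_congr (ha : 0 < a) (h : EqOn u v (openStrip N a)) : cf u = cf v := by
  ext m
  simp only [cf, avgCoef, h (toC_mem_openStrip ha _)]

lemma cf_pderiv (hu : Nice a u) (ha : 0 < a) (j : Fin N) (m : Fin N → ℤ) :
    cf (TorusLinear.pderiv j u) m = Complex.I * m j * cf u m := by
  rw [cf_congr ha (hu.pderiv_eqOn ha j), cf_syn]
  exact (expSum_deriv (fun _ h => hu.expSum_cf ha h) j 0 ha).summable_norm le_rfl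

lemma cf_add (hu : Nice a u) (hv : Nice a v) (ha : 0 < a) (m : Fin N → ℤ) :
    cf (fun ξ => u ξ + v ξ) m = cf u m + cf v m := by
  simp only [cf, avgCoef, mul_add]
  have h1 := ((Nice.ex (a := a) (-m)).mul hu).continuous_real ha
  have h2 := ((Nice.ex (a := a) (-m)).mul hv).continuous_real ha
  exact avg_add h1 h2

lemma cf_sum {ι : Type*} (s : Finset ι) {u : ι → CSpace N → ℂ} (hu : ∀ i ∈ s, Nice a (u i))
    (ha : 0 < a) (m : Fin N → ℤ) : cf (fun ξ => ∑ i ∈ s, u i ξ) m = ∑ i ∈ s, cf (u i) m := by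
  classical
  induction s using Finset.induction_on with
  | empty => simp [cf, avgCoef, avg]
  | insert i s hi ih =>
    simp only [Finset.sum_insert hi]
    rw [cf_add (hu i (Finset.mem_insert_self _ _))
      (Nice.sum fun k hk => hu k (Finset.mem_insert_of_mem hk)) ha,
      ih fun k hk => hu k (Finset.mem_insert_of_mem hk)]

end Nice

lemma cf_const_mul (c : ℂ) (u : CSpace N → ℂ) (m : Fin N → ℤ) :
    cf (fun ξ => c * u ξ) m = c * cf u m := by
  simp only [cf, avgCoef, mul_left_comm _ c, avg_const_mul]

/-! ### Weighted square summable sequences -/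

/-- `c` has norm at most `B` in the `ℓ²`-space with weight `w`. -/
def Bd (w : (Fin N → ℤ) → ℝ) (c : (Fin N → ℤ) → ℂ) (B : ℝ) : Prop :=
  0 ≤ B ∧ ∀ F : Finset (Fin N → ℤ), ∑ m ∈ F, (w m * ‖c m‖) ^ 2 ≤ B ^ 2

namespace Bd
variable {w w' : (Fin N → ℤ) → ℝ} {c d : (Fin N → ℤ) → ℂ} {A B : ℝ}

lemma nonneg (h : Bd w c B) : 0 ≤ B := h.1

lemma apply (h : Bd w c B) (m : Fin N → ℤ) : w m * ‖c m‖ ≤ B := by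
  have := h.2 {m}
  rw [Finset.sum_singleton] at this
  exact (abs_le_of_sq_le_sq' this h.1).2

lemma mono (h : Bd w c B) (hA : B ≤ A) : Bd w c A :=
  ⟨h.1.trans hA, fun F => (h.2 F).trans (pow_le_pow_left₀ h.1 hA 2)⟩

lemma zero : Bd w 0 0 := ⟨le_rfl, fun F => by simp⟩

lemma of_le {K : ℝ} (hK : 0 ≤ K) (hw : ∀ m, 0 ≤ w' m)
    (hle : ∀ m, w' m * ‖d m‖ ≤ K * (w m * ‖c m‖)) (h : Bd w c B) : Bd w' d (K * B) := by
  refine ⟨mul_nonneg hK h.1, fun F => ?_⟩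
  calc ∑ m ∈ F, (w' m * ‖d m‖) ^ 2 ≤ ∑ m ∈ F, K ^ 2 * (w m * ‖c m‖) ^ 2 := by
        refine Finset.sum_le_sum fun m _ => ?_
        rw [← mul_pow]
        exact pow_le_pow_left₀ (mul_nonneg (hw m) (norm_nonneg _)) (hle m) 2
    _ ≤ (K * B) ^ 2 := by
        rw [← Finset.mul_sum, mul_pow]
        exact mul_le_mul_of_nonneg_left (h.2 F) (sq_nonneg K)

lemma add (hw : ∀ m, 0 ≤ w m) (hc : Bd w c A) (hd : Bd w d B) :
    Bd w (fun m => c m + d m) (A + B) := by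
  refine ⟨add_nonneg hc.1 hd.1, fun F => ?_⟩
  have h1 := hc.2 F
  have h2 := hd.2 F
  have hcs := Finset.sum_mul_sq_le_sq_mul_sq F (fun m => w m * ‖c m‖) (fun m => w m * ‖d m‖)
  have h3 : ∑ m ∈ F, (w m * ‖c m‖) * (w m * ‖d m‖) ≤ A * B := by
    refine (abs_le_of_sq_le_sq' ?_ (mul_nonneg hc.1 hd.1)).2
    refine hcs.trans ?_
    rw [mul_pow]
    exact mul_le_mul h1 h2 (Finset.sum_nonneg fun _ _ => sq_nonneg _) (sq_nonneg _)
  calc ∑ m ∈ F, (w m * ‖c m + d m‖) ^ 2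
      ≤ ∑ m ∈ F, (w m * ‖c m‖ + w m * ‖d m‖) ^ 2 := by
        refine Finset.sum_le_sum fun m _ => pow_le_pow_left₀ (mul_nonneg (hw m) (norm_nonneg _)) ?_ 2
        rw [← mul_add]
        exact mul_le_mul_of_nonneg_left (norm_add_le _ _) (hw m)
    _ = ∑ m ∈ F, (w m * ‖c m‖) ^ 2 + 2 * ∑ m ∈ F, (w m * ‖c m‖) * (w m * ‖d m‖)
        + ∑ m ∈ F, (w m * ‖d m‖) ^ 2 := by
        rw [Finset.mul_sum, ← Finset.sum_add_distrib, ← Finset.sum_add_distrib]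
        exact Finset.sum_congr rfl fun m _ => by ring
    _ ≤ (A + B) ^ 2 := by nlinarith

lemma smul (hw : ∀ m, 0 ≤ w m) (z : ℂ) (h : Bd w c B) : Bd w (fun m => z * c m) (‖z‖ * B) :=
  h.of_le (norm_nonneg z) hw fun m => by rw [norm_mul]; apply le_of_eq; ring

lemma neg (h : Bd w c B) : Bd w (fun m => -c m) B := by simpa only [Bd, norm_neg] using h

lemma sub (hw : ∀ m, 0 ≤ w m) (hc : Bd w c A) (hd : Bd w d B) :
    Bd w (fun m => c m - d m) (A + B) := by
  simpa only [sub_eq_add_neg] using hc.add hw hd.neg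

lemma sum (hw : ∀ m, 0 ≤ w m) {ι : Type*} (s : Finset ι) {c : ι → (Fin N → ℤ) → ℂ} {B : ι → ℝ}
    (h : ∀ i ∈ s, Bd w (c i) (B i)) : Bd w (fun m => ∑ i ∈ s, c i m) (∑ i ∈ s, B i) := by
  classical
  induction s using Finset.induction_on with
  | empty => simpa using! zero
  | insert i s hi ih =>
    simp only [Finset.sum_insert hi]
    exact (h i (Finset.mem_insert_self _ _)).add hw
      (ih fun k hk => h k (Finset.mem_insert_of_mem hk))

lemma of_summable {e : (Fin N → ℤ) → ℝ} (he : Summable e) {M : ℝ} (hM : 0 ≤ M)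
    (hw : ∀ m, 0 ≤ w m) (h : ∀ m, w m * ‖c m‖ ≤ M * e m) (he0 : ∀ m, 0 ≤ e m) :
    Bd w c (M * ∑' m, e m) := by
  refine ⟨mul_nonneg hM (tsum_nonneg he0), fun F => ?_⟩
  have h1 : ∑ m ∈ F, w m * ‖c m‖ ≤ M * ∑' m, e m := by
    refine (Finset.sum_le_sum fun m _ => h m).trans ?_
    rw [← Finset.mul_sum]
    exact mul_le_mul_of_nonneg_left (he.sum_le_tsum F fun m _ => he0 m) hM
  refine (Finset.sum_sq_le_sq_sum_of_nonneg fun m _ => mul_nonneg (hw m) (norm_nonneg _)).trans ?_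
  exact pow_le_pow_left₀ (Finset.sum_nonneg fun m _ => mul_nonneg (hw m) (norm_nonneg _)) h1 2

lemma congr (h : Bd w c B) (hcd : ∀ m, c m = d m) : Bd w d B := by
  rwa [← funext hcd]

/-- The bound of a sequence from bounds of its off-diagonal and its mean part. -/
lemma of_ne_zero {K : ℝ} (hK : 0 ≤ K) (hw : ∀ m, 0 ≤ w' m) (hw0 : w' 0 = 1)
    (hle : ∀ m, m ≠ 0 → w' m * ‖d m‖ ≤ K * (w m * ‖c m‖)) (hw1 : ∀ m, 0 ≤ w m) (h : Bd w c B) :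
    Bd w' d (K * B + ‖d 0‖) := by
  classical
  have h1 : Bd w' (fun m => if m = 0 then 0 else d m) (K * B) := by
    refine h.of_le hK hw fun m => ?_
    split_ifs with hm
    · simpa using mul_nonneg hK (mul_nonneg (hw1 m) (norm_nonneg _))
    · exact hle m hm
  have h2 : Bd w' (fun m => if m = 0 then d 0 else 0) ‖d 0‖ := by
    refine ⟨norm_nonneg _, fun F => ?_⟩
    have : ∀ m, (w' m * ‖if m = 0 then d 0 else 0‖) ^ 2 = if m = 0 then ‖d 0‖ ^ 2 else 0 := by
      intro m
      split_ifs with hm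
      · subst hm; simp [hw0]
      · simp
    simp only [this, Finset.sum_ite_eq']
    split_ifs
    · exact le_rfl
    · positivity
  refine (h1.add hw h2).congr fun m => ?_
  split_ifs with hm
  · simp [hm]
  · simp

end Bd

/-! ### Weights and Peetre's inequality. -/

lemma sqLen_nonneg (m : Fin N → ℤ) : 0 ≤ sqLen m := Finset.sum_nonneg fun _ _ => sq_nonneg _

@[simp] lemma sqLen_zero : sqLen (0 : Fin N → ℤ) = 0 := by simp [sqLen]
@[simp] lemma l1_zero : l1 (0 : Fin N → ℤ) = 0 := by simp [l1]
@[simp] lemma sqLen_neg (m : Fin N → ℤ) : sqLen (-m) = sqLen m := by simp [sqLen]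

lemma sqLen_le_l1_sq (m : Fin N → ℤ) : sqLen m ≤ l1 m ^ 2 := by
  have := Finset.sum_sq_le_sq_sum_of_nonneg (s := Finset.univ) (f := fun j => |(m j : ℝ)|)
    (fun _ _ => abs_nonneg _)
  simpa [sqLen, l1] using this

lemma one_add_sqLen_le (m k : Fin N → ℤ) :
    1 + sqLen m ≤ 2 * (1 + sqLen k) * (1 + sqLen (m - k)) := by
  have h : sqLen m ≤ 2 * sqLen k + 2 * sqLen (m - k) := by
    simp only [sqLen, Finset.mul_sum, ← Finset.sum_add_distrib]
    refine Finset.sum_le_sum fun j _ => ?_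
    push_cast [Pi.sub_apply]
    nlinarith [sq_nonneg (2 * (k j : ℝ) - m j)]
  nlinarith [mul_nonneg (sqLen_nonneg k) (sqLen_nonneg (m - k)), sqLen_nonneg k, sqLen_nonneg (m - k)]

/-- The weight `(1 + |m|²)^{r/2} e^{a|m|}`. -/
noncomputable def wt (r a : ℝ) (m : Fin N → ℤ) : ℝ := (1 + sqLen m) ^ (r / 2) * Real.exp (a * l1 m)

lemma one_add_sqLen_pos (m : Fin N → ℤ) : 0 < 1 + sqLen m := by linarith [sqLen_nonneg m]

lemma wt_pos (r a : ℝ) (m : Fin N → ℤ) : 0 < wt r a m :=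
  mul_pos (Real.rpow_pos_of_pos (one_add_sqLen_pos m) _) (Real.exp_pos _)

@[simp] lemma wt_at_zero (r a : ℝ) : wt r a (0 : Fin N → ℤ) = 1 := by simp [wt]

lemma wt_mono {r r' : ℝ} (h : r ≤ r') (a : ℝ) (m : Fin N → ℤ) : wt r a m ≤ wt r' a m := by
  unfold wt
  have := sqLen_nonneg m
  gcongr
  linarith

lemma wt_add (r q a : ℝ) (m : Fin N → ℤ) : wt (r + q) a m = wt r a m * (1 + sqLen m) ^ (q / 2) := by
  simp only [wt, add_div, Real.rpow_add (one_add_sqLen_pos m)]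
  ring

/-- The factor in Peetre's inequality. -/
noncomputable def peetre (r a : ℝ) (k : Fin N → ℤ) : ℝ :=
  (2 * (1 + sqLen k)) ^ (|r| / 2) * Real.exp (a * l1 k)

lemma peetre_pos (r a : ℝ) (k : Fin N → ℤ) : 0 < peetre r a k :=
  mul_pos (Real.rpow_pos_of_pos (by linarith [sqLen_nonneg k]) _) (Real.exp_pos _)

lemma wt_le_peetre_mul (r : ℝ) {a : ℝ} (ha : 0 ≤ a) (m k : Fin N → ℤ) :
    wt r a m ≤ peetre r a k * wt r a (m - k) := by
  have e1 : Real.exp (a * l1 m) ≤ Real.exp (a * l1 k) * Real.exp (a * l1 (m - k)) := by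
    rw [← Real.exp_add, ← mul_add]
    have := l1_add_le k (m - k)
    rw [add_sub_cancel] at this
    gcongr
  have hm := one_add_sqLen_pos m
  have hk := one_add_sqLen_pos k
  have hmk := one_add_sqLen_pos (m - k)
  have e2 : (1 + sqLen m) ^ (r / 2) ≤ (2 * (1 + sqLen k)) ^ (|r| / 2) * (1 + sqLen (m - k)) ^ (r / 2) := by
    rcases le_total 0 r with hr | hr
    · rw [abs_of_nonneg hr, ← Real.mul_rpow (by positivity) hmk.le]
      exact Real.rpow_le_rpow hm.le (one_add_sqLen_le m k) (by positivity)
    · rw [abs_of_nonpos hr]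
      -- For negative order the roles of `m` and `m - k` are exchanged, and reciprocals are taken.
      have h := one_add_sqLen_le (m - k) (-k)
      rw [sqLen_neg, sub_neg_eq_add, sub_add_cancel] at h
      have h' := Real.rpow_le_rpow hmk.le h (show 0 ≤ -r / 2 by linarith)
      rw [Real.mul_rpow (by positivity) hm.le] at h'
      have e3 : ∀ x : ℝ, 0 < x → x ^ (r / 2) = (x ^ (-r / 2))⁻¹ := fun x hx => by
        rw [← Real.rpow_neg hx.le]; congr 1; ring
      rw [e3 _ hm, e3 _ hmk, ← div_eq_mul_inv, le_div_iff₀ (Real.rpow_pos_of_pos hmk _),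
        inv_mul_le_iff₀ (Real.rpow_pos_of_pos hm _), mul_comm]
      exact h'
  calc wt r a m ≤ ((2 * (1 + sqLen k)) ^ (|r| / 2) * (1 + sqLen (m - k)) ^ (r / 2)) *
        (Real.exp (a * l1 k) * Real.exp (a * l1 (m - k))) := by
        unfold wt; gcongr
    _ = _ := by unfold peetre wt; ring

lemma poly_le_exp (q : ℝ) {ε : ℝ} (hε : 0 < ε) :
    ∃ C, 0 < C ∧ ∀ t : ℝ, 0 ≤ t → (1 + t) ^ q ≤ C * Real.exp (ε * t) := by
  obtain ⟨n, hn⟩ := exists_nat_ge q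
  -- The constant comes from `x^n / n! ≤ e^x` at `x = ε (1 + t)`.
  refine ⟨n.factorial * Real.exp ε / ε ^ n, by positivity, fun t ht => ?_⟩
  have h1 : (1 + t) ^ q ≤ (1 + t) ^ n := by
    rw [← Real.rpow_natCast]
    exact Real.rpow_le_rpow_of_exponent_le (by linarith) hn
  have h2 := Real.pow_div_factorial_le_exp (ε * (1 + t)) (by positivity) n
  rw [div_le_iff₀ (by positivity), mul_pow, mul_add, mul_one, Real.exp_add] at h2
  refine h1.trans ?_
  rw [div_mul_eq_mul_div, le_div_iff₀ (by positivity)]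
  linarith

/-- The decay of the coefficients of the linear problem. -/
noncomputable def env (b : ℝ) (k : Fin N → ℤ) : ℝ := (1 + l1 k) * Real.exp (-b * l1 k)

lemma env_pos (b : ℝ) (k : Fin N → ℤ) : 0 < env b k :=
  mul_pos (by linarith [l1_nonneg k]) (Real.exp_pos _)

/-- Half of the gap `b - a` pays for the polynomial factors `(1+|k|)^{|r|+1}`, the other half for
convergence. -/
lemma summable_peetre_env (r : ℝ) {a b : ℝ} (hab : a < b) :
    Summable (fun k : Fin N → ℤ => peetre r a k * env b k) := by
  have hε : 0 < (b - a) / 2 := by linarith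
  obtain ⟨C, hC, h⟩ := poly_le_exp (|r| + 1) hε
  refine Summable.of_nonneg_of_le (fun k => (mul_pos (peetre_pos r a k) (env_pos b k)).le) (fun k => ?_)
    (((summable_exp_neg_l1 (N := N) hε).mul_left (2 ^ (|r| / 2) * C)))
  have hl := l1_nonneg k
  have h0 := sqLen_nonneg k
  have h1 : (2 * (1 + sqLen k)) ^ (|r| / 2) ≤ 2 ^ (|r| / 2) * (1 + l1 k) ^ |r| := by
    rw [Real.mul_rpow (by norm_num) (by positivity)]
    gcongr
    have : (1 + l1 k) ^ |r| = ((1 + l1 k) ^ (2:ℝ)) ^ (|r| / 2) := by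
      rw [← Real.rpow_mul (by positivity)]; congr 1; ring
    rw [this]
    refine Real.rpow_le_rpow (by positivity) ?_ (by positivity)
    rw [Real.rpow_two]
    nlinarith [sqLen_le_l1_sq k]
  have h2 := h (l1 k) hl
  rw [Real.rpow_add (by positivity), Real.rpow_one] at h2
  calc peetre r a k * env b k
      ≤ (2 ^ (|r| / 2) * (1 + l1 k) ^ |r| * Real.exp (a * l1 k)) * ((1 + l1 k) * Real.exp (-b * l1 k)) := by
        unfold peetre env; gcongr
    _ = 2 ^ (|r| / 2) * ((1 + l1 k) ^ |r| * (1 + l1 k)) * (Real.exp (a * l1 k) * Real.exp (-b * l1 k)) := by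
        ring
    _ ≤ 2 ^ (|r| / 2) * (C * Real.exp ((b - a) / 2 * l1 k)) *
        (Real.exp (a * l1 k) * Real.exp (-b * l1 k)) := by gcongr
    _ = 2 ^ (|r| / 2) * C * Real.exp (-((b - a) / 2) * l1 k) := by
        rw [mul_assoc, mul_assoc, mul_assoc, ← Real.exp_add, ← Real.exp_add]; ring_nf

lemma wt_le_peetre (r : ℝ) {a : ℝ} (ha : 0 ≤ a) (m : Fin N → ℤ) : wt r a m ≤ peetre r a m := by
  simpa using wt_le_peetre_mul r ha m m

/-- The constant in the bound for multiplication by a coefficient. -/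
noncomputable def kc (N : ℕ) (r a b : ℝ) : ℝ := ∑' k : Fin N → ℤ, peetre r a k * env b k

lemma kc_nonneg (r a b : ℝ) : 0 ≤ kc N r a b :=
  tsum_nonneg fun k => (mul_pos (peetre_pos r a k) (env_pos b k)).le

lemma Bd.of_env (r : ℝ) {a b δ : ℝ} (ha : 0 ≤ a) (hab : a < b) (hδ : 0 ≤ δ)
    {c : (Fin N → ℤ) → ℂ} (hc : ∀ k, ‖c k‖ ≤ δ * env b k) : Bd (wt r a) c (δ * kc N r a b) := by
  refine Bd.of_summable (summable_peetre_env r hab) hδ (fun m => (wt_pos r a m).le) (fun m => ?_)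
    fun k => (mul_pos (peetre_pos r a k) (env_pos b k)).le
  calc wt r a m * ‖c m‖ ≤ peetre r a m * (δ * env b m) :=
        mul_le_mul (wt_le_peetre r ha m) (hc m) (norm_nonneg _) (peetre_pos r a m).le
    _ = _ := by ring

/-! ### Multiplication by a coefficient in weighted sequence spaces. -/

section conv
variable {r a b δ B : ℝ} {α c : (Fin N → ℤ) → ℂ}

lemma norm_conv_term_le (ha : 0 ≤ a) (hα : ∀ k, ‖α k‖ ≤ δ * env b k) (hc : Bd (wt r a) c B)
    (m k : Fin N → ℤ) :
    ‖α k * c (m - k)‖ ≤ (B / wt r a m * δ) * (peetre r a k * env b k) := by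
  have hδ : 0 ≤ δ * env b k := (norm_nonneg _).trans (hα k)
  have h1 : ‖c (m - k)‖ ≤ peetre r a k * (B / wt r a m) := by
    rw [← mul_div_assoc, le_div_iff₀ (wt_pos r a m)]
    calc ‖c (m - k)‖ * wt r a m ≤ ‖c (m - k)‖ * (peetre r a k * wt r a (m - k)) := by
          gcongr; exact wt_le_peetre_mul r ha m k
      _ = peetre r a k * (wt r a (m - k) * ‖c (m - k)‖) := by ring
      _ ≤ peetre r a k * B := mul_le_mul_of_nonneg_left (hc.apply _) (peetre_pos r a k).le
  rw [norm_mul]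
  calc ‖α k‖ * ‖c (m - k)‖ ≤ (δ * env b k) * (peetre r a k * (B / wt r a m)) := by
        gcongr; exact hα k
    _ = _ := by ring

lemma summable_conv (ha : 0 ≤ a) (hab : a < b) (hα : ∀ k, ‖α k‖ ≤ δ * env b k)
    (hc : Bd (wt r a) c B) (m : Fin N → ℤ) : Summable (fun k => α k * c (m - k)) :=
  Summable.of_norm_bounded ((summable_peetre_env r hab).mul_left _)
    fun k => norm_conv_term_le ha hα hc m k

/-- A convolution is a superposition of shifts; by Peetre's inequality the shift by `k` has norm at
most `peetre r a k`, and these norms are summable against the decay of `α`. The bound holds for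
orders `r` of either sign and loses no derivatives. -/
lemma Bd.conv (ha : 0 ≤ a) (hab : a < b) (hδ : 0 ≤ δ) (hα : ∀ k, ‖α k‖ ≤ δ * env b k)
    (hc : Bd (wt r a) c B) : Bd (wt r a) (conv α c) (δ * kc N r a b * B) := by
  have hw : ∀ m : Fin N → ℤ, 0 ≤ wt r a m := fun m => (wt_pos r a m).le
  have hshift : ∀ k, Bd (wt r a) (fun m => α k * c (m - k)) (δ * (peetre r a k * env b k) * B) := by
    intro k
    have h1 : Bd (fun m => wt r a (m - k)) (fun m => c (m - k)) B := by
      refine ⟨hc.1, fun F => ?_⟩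
      have := hc.2 (F.map (Equiv.subRight k).toEmbedding)
      simpa [Finset.sum_map] using this
    refine h1.of_le (K := δ * (peetre r a k * env b k))
      (mul_nonneg hδ (mul_pos (peetre_pos r a k) (env_pos b k)).le) hw fun m => ?_
    rw [norm_mul]
    calc wt r a m * (‖α k‖ * ‖c (m - k)‖)
        ≤ (peetre r a k * wt r a (m - k)) * ((δ * env b k) * ‖c (m - k)‖) := by
          have := (peetre_pos r a k).le
          have := (wt_pos r a (m - k)).le
          gcongr
          · exact wt_le_peetre_mul r ha m k
          · exact hα k
      _ = _ := by ring
  refine ⟨mul_nonneg (mul_nonneg hδ (kc_nonneg r a b)) hc.1, fun F => ?_⟩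
  -- The triangle inequality is available for finitely many shifts, so the bound is passed to the
  -- limit over finite sets `G` of shifts with `F` fixed.
  have ht : Filter.Tendsto (fun G : Finset (Fin N → ℤ) =>
      ∑ m ∈ F, (wt r a m * ‖∑ k ∈ G, α k * c (m - k)‖) ^ 2) Filter.atTop
      (nhds (∑ m ∈ F, (wt r a m * ‖TorusLinear.conv α c m‖) ^ 2)) := by
    refine tendsto_finsetSum _ fun m _ => ?_
    exact (((summable_conv ha hab hα hc m).hasSum.norm).const_mul _).pow 2
  refine le_of_tendsto' ht fun G => ?_
  refine ((Bd.sum hw G fun k _ => hshift k).mono ?_).2 F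
  rw [← Finset.sum_mul, ← Finset.mul_sum]
  gcongr
  · exact hc.1
  · exact (summable_peetre_env r hab).sum_le_tsum G
      fun k _ => (mul_pos (peetre_pos r a k) (env_pos b k)).le

end conv

/-! ### The linear problem for Fourier coefficients -/

/-- Fourier coefficients of the perturbations of the coefficients of the linear problem. -/
structure SeqCoeffs (N : ℕ) where
  w : (Fin N → ℤ) → ℂ
  W : Fin 2 → Fin 2 → (Fin N → ℤ) → ℂ
  S : Fin N → Fin N → (Fin N → ℤ) → ℂ
  T : Fin 2 → Fin N → (Fin N → ℤ) → ℂ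
  U : Fin N → Fin N → (Fin N → ℤ) → ℂ

/-- Fourier coefficients of a partial derivative. -/
def dcoef (j : Fin N) (c : (Fin N → ℤ) → ℂ) (m : Fin N → ℤ) : ℂ := Complex.I * m j * c m

/-- All perturbations are of size `δ`. -/
structure SeqCoeffs.Small (D : SeqCoeffs N) (b δ : ℝ) : Prop where
  w : ∀ m, ‖D.w m‖ ≤ δ * env b m
  dw : ∀ j m, ‖dcoef j D.w m‖ ≤ δ * env b m
  W : ∀ i j m, ‖D.W i j m‖ ≤ δ * env b m
  S : ∀ i j m, ‖D.S i j m‖ ≤ δ * env b m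
  T : ∀ i j m, ‖D.T i j m‖ ≤ δ * env b m
  U : ∀ i j m, ‖D.U i j m‖ ≤ δ * env b m

/-- The frequency `ω·m`. -/
def freq (ω : Fin N → ℝ) (m : Fin N → ℤ) : ℝ := ∑ j, ω j * (m j : ℝ)

/-- Fourier coefficients of `Tμ + p Wᵀe₁`. -/
noncomputable def force (T₀ : Matrix (Fin 2) (Fin N) ℝ) (D : SeqCoeffs N)
    (μ : Fin N → (Fin N → ℤ) → ℂ) (p : ℂ) (i : Fin 2) (m : Fin N → ℤ) : ℂ :=
  ∑ j, ((T₀ i j : ℂ) * μ j m + conv (D.T i j) (μ j) m)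
    + p * ((if i = 0 ∧ m = 0 then 1 else 0) + D.W 0 i m)

/-- Fourier coefficients of `Sμ + Tᵀλ`. -/
noncomputable def source (S₀ : Matrix (Fin N) (Fin N) ℝ) (T₀ : Matrix (Fin 2) (Fin N) ℝ)
    (D : SeqCoeffs N) (μ : Fin N → (Fin N → ℤ) → ℂ) (lam : Fin 2 → (Fin N → ℤ) → ℂ)
    (j : Fin N) (m : Fin N → ℤ) : ℂ :=
  ∑ l, ((S₀ j l : ℂ) * μ l m + conv (D.S j l) (μ l) m)
    + ∑ i, ((T₀ i j : ℂ) * lam i m + conv (D.T i j) (lam i) m)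

/-- The linear problem for the sequences of Fourier coefficients. -/
structure SeqSol (ω : Fin N → ℝ) (S₀ : Matrix (Fin N) (Fin N) ℝ) (T₀ : Matrix (Fin 2) (Fin N) ℝ)
    (k : ℝ) (D : SeqCoeffs N) (g : (Fin N → ℤ) → ℂ) (g₂ : Fin 2 → (Fin N → ℤ) → ℂ) (γ : ℂ)
    (μ : Fin N → (Fin N → ℤ) → ℂ) (lam : Fin 2 → (Fin N → ℤ) → ℂ)
    (χ : Fin N → (Fin N → ℤ) → ℂ) (p : ℂ) : Prop where
  eq_μ : ∀ j m, Complex.I * freq ω m * μ j m = -(Complex.I * m j * (p * D.w m + g m))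
  eq_lam₀ : ∀ m, Complex.I * freq ω m * lam 1 m - k * lam 0 m + force T₀ D μ p 0 m = g₂ 0 m
  eq_lam₁ : ∀ m, -(Complex.I * freq ω m * lam 0 m) + lam 1 m + force T₀ D μ p 1 m = g₂ 1 m
  eq_χ : ∀ j m, -(Complex.I * freq ω m * χ j m) + source S₀ T₀ D μ lam j m = 0
  eq_γ : lam 0 0 + ∑ i, conv (D.W 0 i) (lam i) 0 + ∑ j, conv (dcoef j D.w) (χ j) 0 = γ
  eq_V : ∀ j, χ j 0 + ∑ i, conv (D.U i j) (χ i) 0 = 0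

/-! ### Small divisors. -/

lemma Diophantine.freq_ne_zero {n : ℕ} {c₀ : ℝ} {ω : Fin N → ℝ} (hω : Diophantine n c₀ ω)
    {m : Fin N → ℤ} (hm : m ≠ 0) : freq ω m ≠ 0 := by
  intro h
  have := hω m hm
  rw [freq] at h
  rw [h] at this
  simp at this
  linarith

lemma Diophantine.inv_freq_le {n : ℕ} {c₀ : ℝ} {ω : Fin N → ℝ} (hω : Diophantine n c₀ ω)
    {m : Fin N → ℤ} (hm : m ≠ 0) : |freq ω m|⁻¹ ≤ |c₀| * (1 + sqLen m) ^ ((n : ℝ) / 2) := by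
  have h := hω m hm
  have hf : 0 < |freq ω m| := abs_pos.2 (hω.freq_ne_zero hm)
  rw [inv_le_iff_one_le_mul₀ hf]
  refine h.trans ?_
  change c₀ * √(sqLen m) ^ n * |freq ω m| ≤ _
  have h2 : √(sqLen m) ^ n ≤ (1 + sqLen m) ^ ((n : ℝ) / 2) := by
    have h0 := sqLen_nonneg m
    rw [Real.sqrt_eq_rpow, ← Real.rpow_natCast, ← Real.rpow_mul h0]
    have : (1:ℝ) / 2 * n = n / 2 := by ring
    rw [this]
    exact Real.rpow_le_rpow h0 (by linarith) (by positivity)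
  have h3 : c₀ ≤ |c₀| := le_abs_self _
  have h4 : 0 ≤ √(sqLen m) ^ n := by positivity
  gcongr

lemma abs_coord_le (m : Fin N → ℤ) (j : Fin N) : |(m j : ℝ)| ≤ (1 + sqLen m) ^ ((1:ℝ) / 2) := by
  rw [← Real.sqrt_eq_rpow]
  refine Real.abs_le_sqrt ?_
  have := Finset.single_le_sum (f := fun j => (m j : ℝ) ^ 2) (fun _ _ => sq_nonneg _)
    (Finset.mem_univ j)
  simp only [sqLen]
  linarith

lemma wt_nonneg (r a : ℝ) (m : Fin N → ℤ) : 0 ≤ wt r a m := (wt_pos r a m).le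

lemma Bd.wt_mono {r r' a B : ℝ} {c : (Fin N → ℤ) → ℂ} (h : Bd (wt r' a) c B) (hr : r ≤ r') :
    Bd (wt r a) c B := by
  have := h.of_le (w' := wt r a) (d := c) zero_le_one (wt_nonneg r a) fun m => by
    rw [one_mul]
    exact mul_le_mul_of_nonneg_right (TorusLinear.wt_mono hr a m) (norm_nonneg _)
  simpa using this

lemma Bd.norm_zero_le {r a B : ℝ} {c : (Fin N → ℤ) → ℂ} (h : Bd (wt r a) c B) : ‖c 0‖ ≤ B := by
  simpa using h.apply 0

/-- Division by small divisors, with a loss of `q` derivatives. -/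
lemma Bd.of_mul_le {r q a K B : ℝ} {c d : (Fin N → ℤ) → ℂ} (hK : 0 ≤ K) (h : Bd (wt r a) c B)
    (hle : ∀ m, m ≠ 0 → ‖d m‖ ≤ K * (1 + sqLen m) ^ (q / 2) * ‖c m‖) :
    Bd (wt (r - q) a) d (K * B + ‖d 0‖) := by
  refine h.of_ne_zero hK (wt_nonneg _ _) (wt_at_zero _ _) (fun m hm => ?_) (wt_nonneg _ _)
  have e : wt r a m = wt (r - q) a m * (1 + sqLen m) ^ (q / 2) := by
    rw [← wt_add, sub_add_cancel]
  rw [e]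
  calc wt (r - q) a m * ‖d m‖ ≤ wt (r - q) a m * (K * (1 + sqLen m) ^ (q / 2) * ‖c m‖) :=
        mul_le_mul_of_nonneg_left (hle m hm) (wt_nonneg _ _ m)
    _ = _ := by ring

section solve
variable {n : ℕ} {c₀ : ℝ} {ω : Fin N → ℝ} (hω : Diophantine n c₀ ω) {r a : ℝ}
include hω

/-- The multiplier `m_j / (ω·m)` costs `n` derivatives for the divisor and one for the gradient. The
equation is void at `m = 0`, hence the separate term `‖d 0‖`. -/
lemma Bd.solve_grad {c d : (Fin N → ℤ) → ℂ} {B : ℝ} (j : Fin N) (h : Bd (wt r a) c B)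
    (heq : ∀ m, Complex.I * freq ω m * d m = -(Complex.I * m j * c m)) :
    Bd (wt (r - (n + 1)) a) d (|c₀| * B + ‖d 0‖) := by
  refine h.of_mul_le (abs_nonneg _) fun m hm => ?_
  have hf : 0 < |freq ω m| := abs_pos.2 (hω.freq_ne_zero hm)
  have h1 : |freq ω m| * ‖d m‖ = |(m j : ℝ)| * ‖c m‖ := by
    have := congrArg norm (heq m)
    simpa using this
  have h2 : ‖d m‖ = |freq ω m|⁻¹ * (|(m j : ℝ)| * ‖c m‖) := by
    rw [← h1, inv_mul_cancel_left₀ hf.ne']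
  rw [h2, add_div, Real.rpow_add (one_add_sqLen_pos m)]
  have hs := one_add_sqLen_pos m
  calc _ ≤ (|c₀| * (1 + sqLen m) ^ ((n : ℝ) / 2)) * ((1 + sqLen m) ^ ((1:ℝ) / 2) * ‖c m‖) := by
        gcongr
        · exact hω.inv_freq_le hm
        · exact abs_coord_le m j
    _ = _ := by ring

lemma Bd.solve_freq {c d : (Fin N → ℤ) → ℂ} {B : ℝ} (h : Bd (wt r a) c B)
    (heq : ∀ m, Complex.I * freq ω m * d m = c m) :
    Bd (wt (r - n) a) d (|c₀| * B + ‖d 0‖) := by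
  refine h.of_mul_le (abs_nonneg _) fun m hm => ?_
  have hf : 0 < |freq ω m| := abs_pos.2 (hω.freq_ne_zero hm)
  have h1 : |freq ω m| * ‖d m‖ = ‖c m‖ := by
    have := congrArg norm (heq m)
    simpa using this
  have h2 : ‖d m‖ = |freq ω m|⁻¹ * ‖c m‖ := by
    rw [← h1, inv_mul_cancel_left₀ hf.ne']
  rw [h2]
  gcongr
  exact hω.inv_freq_le hm

/-- Eliminating one unknown leaves the factor `(ω·m)² + k`, and `k ≥ 0` makes it at least `(ω·m)²`.
This is why the constant does not depend on `k`, and why `k = 0` is allowed. -/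
lemma Bd.solve_hyperbolic {k : ℝ} (hk : 0 ≤ k) {h₀ h₁ x y : (Fin N → ℤ) → ℂ} {B₀ B₁ : ℝ}
    (hb₀ : Bd (wt r a) h₀ B₀) (hb₁ : Bd (wt r a) h₁ B₁)
    (e₀ : ∀ m, Complex.I * freq ω m * y m - k * x m = h₀ m)
    (e₁ : ∀ m, -(Complex.I * freq ω m * x m) + y m = h₁ m) :
    Bd (wt (r - 2 * n) a) x ((1 + |c₀|) ^ 2 * (B₀ + B₁) + ‖x 0‖) ∧
    Bd (wt (r - 2 * n) a) y ((1 + |c₀|) ^ 2 * (B₀ + B₁) + ‖y 0‖) := by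
  -- The sequence `‖h₀ m‖ + ‖h₁ m‖` serves as a single majorant for both components.
  have hb : Bd (wt r a) (fun m => ((‖h₀ m‖ : ℝ) : ℂ) + ((‖h₁ m‖ : ℝ) : ℂ)) (B₀ + B₁) := by
    refine Bd.add (wt_nonneg _ _) ?_ ?_
    · simpa only [Bd, Complex.norm_real, norm_norm] using hb₀
    · simpa only [Bd, Complex.norm_real, norm_norm] using hb₁
  have hnorm : ∀ m, ‖((‖h₀ m‖ : ℝ) : ℂ) + ((‖h₁ m‖ : ℝ) : ℂ)‖ = ‖h₀ m‖ + ‖h₁ m‖ := by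
    intro m
    rw [← Complex.ofReal_add, Complex.norm_real, Real.norm_of_nonneg (by positivity)]
  have key : ∀ m, m ≠ 0 → ∃ u, 0 < u ∧ 1 ≤ (1 + |c₀|) * u ∧ |freq ω m|⁻¹ ≤ (1 + |c₀|) * u ∧
      (1 + sqLen m) ^ ((2 * n : ℝ) / 2) = u ^ 2 ∧ 1 ≤ u := by
    intro m hm
    have hs := one_add_sqLen_pos m
    have hu1 : 1 ≤ (1 + sqLen m) ^ ((n : ℝ) / 2) :=
      Real.one_le_rpow (by linarith [sqLen_nonneg m]) (by positivity)
    have hc := abs_nonneg c₀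
    refine ⟨(1 + sqLen m) ^ ((n : ℝ) / 2), Real.rpow_pos_of_pos hs _, ?_, ?_, ?_, hu1⟩
    · nlinarith
    · refine (hω.inv_freq_le hm).trans ?_
      gcongr
      linarith
    · rw [← Real.rpow_natCast, ← Real.rpow_mul hs.le]; congr 1; push_cast; ring
  have hK : (0:ℝ) ≤ (1 + |c₀|) ^ 2 := by positivity
  constructor
  · refine hb.of_mul_le hK fun m hm => ?_
    obtain ⟨u, hu, h1, h2, h3, h4⟩ := key m hm
    have hf : 0 < |freq ω m| := abs_pos.2 (hω.freq_ne_zero hm)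
    rw [h3, hnorm]
    have hx : ((freq ω m ^ 2 + k : ℝ) : ℂ) * x m = -(h₀ m - Complex.I * freq ω m * h₁ m) := by
      rw [← e₀, ← e₁]
      push_cast
      linear_combination ((freq ω m : ℂ) ^ 2 * x m) * Complex.I_sq
    have hx2 := congrArg norm hx
    rw [norm_mul, Complex.norm_real, norm_neg, Real.norm_of_nonneg (by positivity)] at hx2
    have hx3 : |freq ω m| ^ 2 * ‖x m‖ ≤ ‖h₀ m‖ + |freq ω m| * ‖h₁ m‖ := by
      rw [sq_abs]
      have := norm_sub_le (h₀ m) (Complex.I * freq ω m * h₁ m)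
      rw [norm_mul, norm_mul, Complex.norm_I, one_mul, Complex.norm_real, Real.norm_eq_abs] at this
      nlinarith [mul_nonneg hk (norm_nonneg (x m))]
    have hx4 : ‖x m‖ ≤ |freq ω m|⁻¹ ^ 2 * ‖h₀ m‖ + |freq ω m|⁻¹ * ‖h₁ m‖ := by
      have := mul_le_mul_of_nonneg_left hx3 (show 0 ≤ |freq ω m|⁻¹ ^ 2 by positivity)
      refine le_trans (le_of_eq ?_) (this.trans (le_of_eq ?_))
      · field_simp
      · field_simp
    have h5 : |freq ω m|⁻¹ ^ 2 ≤ ((1 + |c₀|) * u) ^ 2 := pow_le_pow_left₀ (by positivity) h2 2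
    have h6 : |freq ω m|⁻¹ ≤ ((1 + |c₀|) * u) ^ 2 := by nlinarith
    calc ‖x m‖ ≤ ((1 + |c₀|) * u) ^ 2 * ‖h₀ m‖ + ((1 + |c₀|) * u) ^ 2 * ‖h₁ m‖ :=
          hx4.trans (by gcongr)
      _ = _ := by ring
  · refine hb.of_mul_le hK fun m hm => ?_
    obtain ⟨u, hu, h1, h2, h3, h4⟩ := key m hm
    have hf : 0 < |freq ω m| := abs_pos.2 (hω.freq_ne_zero hm)
    rw [h3, hnorm]
    have hx : ((freq ω m ^ 2 + k : ℝ) : ℂ) * y m = k * h₁ m - Complex.I * freq ω m * h₀ m := by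
      rw [← e₀, ← e₁]
      push_cast
      linear_combination ((freq ω m : ℂ) ^ 2 * y m) * Complex.I_sq
    have hx2 := congrArg norm hx
    rw [norm_mul, Complex.norm_real, Real.norm_of_nonneg (by positivity)] at hx2
    have hx3 : (freq ω m ^ 2 + k) * ‖y m‖ ≤ k * ‖h₁ m‖ + |freq ω m| * ‖h₀ m‖ := by
      have := norm_sub_le (k * h₁ m) (Complex.I * freq ω m * h₀ m)
      rw [norm_mul, norm_mul, norm_mul, Complex.norm_I, one_mul, Complex.norm_real,
        Real.norm_eq_abs, Complex.norm_real, Real.norm_eq_abs, abs_of_nonneg hk] at this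
      linarith
    have hpos : 0 < freq ω m ^ 2 + k := by rw [← sq_abs]; positivity
    -- Here `k / ((ω·m)² + k) ≤ 1`, so no upper bound of `k` enters.
    have hx4 : ‖y m‖ ≤ ‖h₁ m‖ + |freq ω m|⁻¹ * ‖h₀ m‖ := by
      refine le_of_mul_le_mul_left (hx3.trans ?_) hpos
      have e5 : (freq ω m ^ 2 + k) * (|freq ω m|⁻¹ * ‖h₀ m‖) =
          |freq ω m| * ‖h₀ m‖ + k * |freq ω m|⁻¹ * ‖h₀ m‖ := by
        rw [← sq_abs]; field_simp
      rw [mul_add, e5]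
      have : 0 ≤ k * |freq ω m|⁻¹ * ‖h₀ m‖ := by positivity
      nlinarith [mul_nonneg (sq_nonneg (freq ω m)) (norm_nonneg (h₁ m))]
    have h5 : 1 ≤ ((1 + |c₀|) * u) ^ 2 := one_le_pow₀ h1
    have h6 : |freq ω m|⁻¹ ≤ ((1 + |c₀|) * u) ^ 2 := by nlinarith
    calc ‖y m‖ ≤ ((1 + |c₀|) * u) ^ 2 * ‖h₁ m‖ + ((1 + |c₀|) * u) ^ 2 * ‖h₀ m‖ := by
          refine hx4.trans ?_
          gcongr
          exact le_mul_of_one_le_left (norm_nonneg _) h5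
      _ = _ := by ring

end solve

/-! ### The a priori estimate -/

/-- The size of the mean values which parametrize the solutions. -/
noncomputable def paramNorm (μ : Fin N → (Fin N → ℤ) → ℂ) (lam : Fin 2 → (Fin N → ℤ) → ℂ)
    (χ : Fin N → (Fin N → ℤ) → ℂ) (p : ℂ) : ℝ :=
  ∑ j, ‖μ j 0‖ + ‖lam 0 0‖ + ‖p‖ + ∑ j, ‖χ j 0‖

/-- The sum of the moduli of the entries of a matrix. -/
noncomputable def entrySum {ι κ : Type*} [Fintype ι] [Fintype κ] (A : Matrix ι κ ℝ) : ℝ :=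
  ∑ i, ∑ j, |A i j|

lemma entrySum_nonneg {ι κ : Type*} [Fintype ι] [Fintype κ] (A : Matrix ι κ ℝ) : 0 ≤ entrySum A :=
  Finset.sum_nonneg fun _ _ => Finset.sum_nonneg fun _ _ => abs_nonneg _

lemma row_le_entrySum {ι κ : Type*} [Fintype ι] [Fintype κ] (A : Matrix ι κ ℝ) (i : ι) :
    ∑ j, |A i j| ≤ entrySum A :=
  Finset.single_le_sum (f := fun i => ∑ j, |A i j|)
    (fun _ _ => Finset.sum_nonneg fun _ _ => abs_nonneg _) (Finset.mem_univ i)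

lemma col_le_entrySum {ι κ : Type*} [Fintype ι] [Fintype κ] (A : Matrix ι κ ℝ) (j : κ) :
    ∑ i, |A i j| ≤ entrySum A :=
  Finset.sum_le_sum fun i _ => Finset.single_le_sum (f := fun j => |A i j|)
    (fun _ _ => abs_nonneg _) (Finset.mem_univ j)

/-- Multiplication by a constant matrix plus a small perturbation. -/
lemma Bd.matrix_mul {ι : Type*} [Fintype ι] {r a b δ B : ℝ} (ha : 0 ≤ a) (hab : a < b) (hδ : 0 ≤ δ)
    (A : ι → ℝ) {P : ι → (Fin N → ℤ) → ℂ} (hP : ∀ i m, ‖P i m‖ ≤ δ * env b m)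
    {u : ι → (Fin N → ℤ) → ℂ} (hu : ∀ i, Bd (wt r a) (u i) B) :
    Bd (wt r a) (fun m => ∑ i, ((A i : ℂ) * u i m + TorusLinear.conv (P i) (u i) m))
      ((∑ i, |A i| + Fintype.card ι * (δ * kc N r a b)) * B) := by
  have h := Bd.sum (wt_nonneg r a) Finset.univ fun i _ =>
    ((hu i).smul (wt_nonneg r a) (A i : ℂ)).add (wt_nonneg r a) ((hu i).conv ha hab hδ (hP i))
  refine h.mono (le_of_eq ?_)
  rw [Finset.sum_add_distrib, add_mul, Finset.sum_mul]
  simp [mul_assoc]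

lemma norm_sum_conv_le {ι : Type*} [Fintype ι] {r a b δ B : ℝ} (ha : 0 ≤ a) (hab : a < b)
    (hδ : 0 ≤ δ) {P : ι → (Fin N → ℤ) → ℂ} (hP : ∀ i m, ‖P i m‖ ≤ δ * env b m)
    {u : ι → (Fin N → ℤ) → ℂ} (hu : ∀ i, Bd (wt r a) (u i) B) :
    ‖∑ i, conv (P i) (u i) 0‖ ≤ δ * (Fintype.card ι * kc N r a b * B) := by
  refine (norm_sum_le_of_le _ fun i _ => ((hu i).conv ha hab hδ (hP i)).norm_zero_le).trans
    (le_of_eq ?_)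
  simp only [Finset.sum_const, Finset.card_univ, nsmul_eq_mul]
  ring

section apriori
variable {n : ℕ} {c₀ : ℝ} {ω : Fin N → ℝ} (hω : Diophantine n c₀ ω)
  (S₀ : Matrix (Fin N) (Fin N) ℝ) (T₀ : Matrix (Fin 2) (Fin N) ℝ)
include hω

/-- Bounds of a solution in terms of the data and its mean values. -/
lemma exists_bound_of_paramNorm (r : ℝ) {a b : ℝ} (ha : 0 ≤ a) (hab : a < b) :
    ∃ K, 0 ≤ K ∧ ∀ δ k : ℝ, 0 ≤ δ → δ ≤ 1 → 0 ≤ k → ∀ D : SeqCoeffs N, D.Small b δ →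
      ∀ g g₂ γ μ lam χ p, SeqSol ω S₀ T₀ k D g g₂ γ μ lam χ p →
      ∀ (G₁ : ℝ) (G₂ : Fin 2 → ℝ), Bd (wt (r + 4 * n + 6) a) g G₁ →
      (∀ i, Bd (wt (r + 4 * n + 6) a) (g₂ i) (G₂ i)) →
      (∀ j, Bd (wt r a) (μ j) (K * (paramNorm μ lam χ p + G₁ + ∑ i, G₂ i))) ∧
      (∀ i, Bd (wt r a) (lam i) (K * (paramNorm μ lam χ p + G₁ + ∑ i, G₂ i))) ∧
      (∀ j, Bd (wt r a) (χ j) (K * (paramNorm μ lam χ p + G₁ + ∑ i, G₂ i))) := by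
  -- One multiplication constant for each order in the chain: that of the data, that of `μ` after a
  -- loss of `n+1`, that of `λ` after a further `2n`. The last loss `n`, for `χ`, ends at order `r +
  -- 5`.
  obtain ⟨κ₀, hκ₀⟩ : ∃ x, x = kc N (r + 4 * n + 6) a b := ⟨_, rfl⟩
  obtain ⟨κ₁, hκ₁⟩ : ∃ x, x = kc N (r + 4 * n + 6 - (n + 1)) a b := ⟨_, rfl⟩
  obtain ⟨κ₂, hκ₂⟩ : ∃ x, x = kc N (r + 4 * n + 6 - (n + 1) - 2 * n) a b := ⟨_, rfl⟩
  have hκ₀' : 0 ≤ κ₀ := hκ₀ ▸ kc_nonneg _ _ _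
  have hκ₁' : 0 ≤ κ₁ := hκ₁ ▸ kc_nonneg _ _ _
  have hκ₂' : 0 ≤ κ₂ := hκ₂ ▸ kc_nonneg _ _ _
  have hT := entrySum_nonneg T₀
  have hS := entrySum_nonneg S₀
  have hc := abs_nonneg c₀
  -- `K₁` bounds `μ`, `K₂` the right hand side of the `λ`-equation, `K₃` bounds `λ`, and `K₄` the
  -- source of `χ`.
  obtain ⟨K₁, hK₁⟩ : ∃ x, x = |c₀| * (κ₀ + 1) + 1 := ⟨_, rfl⟩
  obtain ⟨K₂, hK₂⟩ : ∃ x, x = 1 + ((entrySum T₀ + N * κ₁) * K₁ + (1 + κ₁)) := ⟨_, rfl⟩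
  obtain ⟨K₃, hK₃⟩ : ∃ x, x = (1 + |c₀|) ^ 2 * (K₂ + K₂) + K₂ := ⟨_, rfl⟩
  obtain ⟨K₄, hK₄⟩ : ∃ x, x = (entrySum S₀ + N * κ₂) * K₁ + (entrySum T₀ + 2 * κ₂) * K₃ := ⟨_, rfl⟩
  have h1 : 0 ≤ K₁ := by rw [hK₁]; positivity
  have h2 : 1 ≤ K₂ := by
    have : 0 ≤ (entrySum T₀ + N * κ₁) * K₁ + (1 + κ₁) := by positivity
    linarith
  have h2' : 0 ≤ K₂ := zero_le_one.trans h2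
  have h3 : 0 ≤ K₃ := by rw [hK₃]; positivity
  have h4 : 0 ≤ K₄ := by rw [hK₄]; positivity
  have h5 : 0 ≤ |c₀| * K₄ + 1 := by positivity
  refine ⟨K₁ + K₃ + (|c₀| * K₄ + 1), by positivity, ?_⟩
  intro δ k hδ hδ1 hk D hD g g₂ γ μ lam χ p hsol G₁ G₂ hg hg₂
  obtain ⟨Q, hQ⟩ : ∃ x, x = paramNorm μ lam χ p + G₁ + ∑ i, G₂ i := ⟨_, rfl⟩
  rw [← hQ]
  have hG₂ : ∀ i, G₂ i ≤ ∑ i, G₂ i := fun i =>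
    Finset.single_le_sum (fun i _ => (hg₂ i).nonneg) (Finset.mem_univ i)
  have hG₂' : 0 ≤ ∑ i, G₂ i := Finset.sum_nonneg fun i _ => (hg₂ i).nonneg
  have hG₁ := hg.nonneg
  have hXs : 0 ≤ ∑ j, ‖μ j 0‖ := Finset.sum_nonneg fun _ _ => norm_nonneg _
  have hZs : 0 ≤ ∑ j, ‖χ j 0‖ := Finset.sum_nonneg fun _ _ => norm_nonneg _
  have hX : ∀ j, ‖μ j 0‖ ≤ ∑ j, ‖μ j 0‖ := fun j =>
    Finset.single_le_sum (f := fun j => ‖μ j 0‖) (fun i _ => norm_nonneg _) (Finset.mem_univ j)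
  have hZ : ∀ j, ‖χ j 0‖ ≤ ∑ j, ‖χ j 0‖ := fun j =>
    Finset.single_le_sum (f := fun j => ‖χ j 0‖) (fun i _ => norm_nonneg _) (Finset.mem_univ j)
  have hp0 := norm_nonneg p
  have hy0 := norm_nonneg (lam 0 0)
  have hQX : ∀ j, ‖μ j 0‖ ≤ Q := fun j => by have := hX j; simp only [hQ, paramNorm]; linarith
  have hQZ : ∀ j, ‖χ j 0‖ ≤ Q := fun j => by have := hZ j; simp only [hQ, paramNorm]; linarith
  have hQy : ‖lam 0 0‖ ≤ Q := by simp only [hQ, paramNorm]; linarith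
  have hQp : ‖p‖ ≤ Q := by simp only [hQ, paramNorm]; linarith
  have hQG₁ : ‖p‖ + G₁ ≤ Q := by simp only [hQ, paramNorm]; linarith
  have hQG₂ : ∀ i, G₂ i ≤ Q := fun i => by have := hG₂ i; simp only [hQ, paramNorm]; linarith
  have hQ0 : 0 ≤ Q := hy0.trans hQy
  -- No decay of the solution is assumed: each equation produces the decay of its unknown from that
  -- of the preceding ones.
  have hμ : ∀ j, Bd (wt (r + 4 * n + 6 - (n + 1)) a) (μ j) (K₁ * Q) := by
    intro j
    have hw := (Bd.of_env (r + 4 * n + 6) ha hab hδ hD.w).smul (wt_nonneg _ _) p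
    rw [← hκ₀] at hw
    refine (Bd.solve_grad hω j (hw.add (wt_nonneg _ _) hg) (hsol.eq_μ j)).mono ?_
    have e1 : ‖p‖ * (δ * κ₀) + G₁ ≤ (κ₀ + 1) * Q := by
      have : ‖p‖ * (δ * κ₀) ≤ Q * (1 * κ₀) := by gcongr
      nlinarith
    calc _ ≤ |c₀| * ((κ₀ + 1) * Q) + Q := by gcongr; exact hQX j
      _ = _ := by rw [hK₁]; ring
  have hforce : ∀ i, Bd (wt (r + 4 * n + 6 - (n + 1)) a) (force T₀ D μ p i)
      (((entrySum T₀ + N * κ₁) * K₁ + (1 + κ₁)) * Q) := by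
    intro i
    have hA := Bd.matrix_mul ha hab hδ (T₀ i) (hD.T i) hμ
    have hone : Bd (wt (r + 4 * n + 6 - (n + 1)) a)
        (fun m : Fin N → ℤ => if i = 0 ∧ m = 0 then (1:ℂ) else 0) 1 := by
      have := (Bd.zero (w := wt (r + 4 * n + 6 - (n + 1)) a)).of_ne_zero
        (w' := wt (r + 4 * n + 6 - (n + 1)) a) (d := fun m : Fin N → ℤ => if i = 0 ∧ m = 0 then (1:ℂ) else 0) le_rfl (wt_nonneg _ _)
        (wt_at_zero _ _) (fun m hm => by simp [hm]) (wt_nonneg _ _)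
      refine this.mono ?_
      by_cases hi : i = 0 <;> simp [hi]
    have hB := (hone.add (wt_nonneg _ _)
      (Bd.of_env (r + 4 * n + 6 - (n + 1)) ha hab hδ (hD.W 0 i))).smul (wt_nonneg _ _) p
    refine (hA.add (wt_nonneg _ _) hB).mono ?_
    have hrow := row_le_entrySum T₀ i
    simp only [Fintype.card_fin, ← hκ₁]
    have e1 : δ * κ₁ ≤ κ₁ := mul_le_of_le_one_left hκ₁' hδ1
    calc _ ≤ (entrySum T₀ + N * κ₁) * (K₁ * Q) + Q * (1 + κ₁) := by gcongr
      _ = _ := by ring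
  have hh : ∀ i, Bd (wt (r + 4 * n + 6 - (n + 1)) a) (fun m => g₂ i m - force T₀ D μ p i m) (K₂ * Q) := by
    intro i
    refine (((hg₂ i).wt_mono (by have : (0:ℝ) ≤ n := n.cast_nonneg; linarith)).sub
      (wt_nonneg _ _) (hforce i)).mono ?_
    have := hQG₂ i
    rw [hK₂, add_mul 1, one_mul]
    linarith
  -- The mean of the second component of `λ` is not a parameter; the second equation at `m = 0`
  -- determines it.
  have hl1 : ‖lam 1 0‖ ≤ K₂ * Q := by
    have e : lam 1 0 = g₂ 1 0 - force T₀ D μ p 1 0 := by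
      have := hsol.eq_lam₁ 0
      simp only [freq, Pi.zero_apply, Int.cast_zero, mul_zero, Finset.sum_const_zero,
        Complex.ofReal_zero, zero_mul, neg_zero, zero_add] at this
      linear_combination this
    rw [e]
    exact (hh 1).norm_zero_le
  have hlam : ∀ i, Bd (wt (r + 4 * n + 6 - (n + 1) - 2 * n) a) (lam i) (K₃ * Q) := by
    obtain ⟨hx, hy⟩ := Bd.solve_hyperbolic hω hk (hh 0) (hh 1) (x := lam 0) (y := lam 1)
      (fun m => by linear_combination hsol.eq_lam₀ m) (fun m => by linear_combination hsol.eq_lam₁ m)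
    have e3 : (1 + |c₀|) ^ 2 * (K₂ * Q + K₂ * Q) + K₂ * Q = K₃ * Q := by rw [hK₃]; ring
    intro i
    fin_cases i
    · refine hx.mono ?_
      rw [← e3]
      gcongr
      exact hQy.trans (le_mul_of_one_le_left hQ0 h2)
    · refine hy.mono ?_
      rw [← e3]
      gcongr
  have hsource : ∀ j, Bd (wt (r + 4 * n + 6 - (n + 1) - 2 * n) a) (source S₀ T₀ D μ lam j) (K₄ * Q) := by
    intro j
    have hA := Bd.matrix_mul ha hab hδ (S₀ j) (hD.S j) fun l =>
      (hμ l).wt_mono (show r + 4 * n + 6 - (n + 1) - 2 * n ≤ _ by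
        have : (0:ℝ) ≤ n := n.cast_nonneg
        linarith)
    have hB := Bd.matrix_mul ha hab hδ (fun i => T₀ i j) (fun i => hD.T i j) hlam
    refine (hA.add (wt_nonneg _ _) hB).mono ?_
    have hrow := row_le_entrySum S₀ j
    have hcol := col_le_entrySum T₀ j
    simp only [Fintype.card_fin, Nat.cast_ofNat, ← hκ₂]
    have e1 : δ * κ₂ ≤ κ₂ := mul_le_of_le_one_left hκ₂' hδ1
    calc _ ≤ (entrySum S₀ + N * κ₂) * (K₁ * Q) + (entrySum T₀ + 2 * κ₂) * (K₃ * Q) := by gcongr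
      _ = _ := by rw [hK₄]; ring
  have hχ : ∀ j, Bd (wt (r + 4 * n + 6 - (n + 1) - 2 * n - n) a) (χ j) ((|c₀| * K₄ + 1) * Q) := by
    intro j
    refine (Bd.solve_freq hω (hsource j) fun m => by linear_combination -(hsol.eq_χ j m)).mono ?_
    rw [add_mul, one_mul, mul_assoc]
    have := hQZ j
    linarith
  have hn : (0:ℝ) ≤ n := n.cast_nonneg
  refine ⟨fun j => ((hμ j).wt_mono (by linarith)).mono ?_, fun i => ((hlam i).wt_mono (by linarith)).mono ?_,
    fun j => ((hχ j).wt_mono (by linarith)).mono ?_⟩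
  all_goals
    refine mul_le_mul_of_nonneg_right ?_ hQ0
    linarith

end apriori

/-! ### The equations for the mean values. -/

@[simp] lemma freq_zero (ω : Fin N → ℝ) : freq ω 0 = 0 := by simp [freq]

lemma env_at_zero (b : ℝ) : env b (0 : Fin N → ℤ) = 1 := by simp [env]

lemma norm_sum_le_of_matrix_eq {A : Matrix (Fin N) (Fin N) ℝ} (hA : A.det ≠ 0) {x v : Fin N → ℂ}
    (h : ∀ j, ∑ l, (A j l : ℂ) * x l = v j) : ∑ i, ‖x i‖ ≤ entrySum A⁻¹ * ∑ j, ‖v j‖ := by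
  have hx : ∀ i, x i = ∑ j, (A⁻¹ i j : ℂ) * v j := by
    intro i
    have h1 : ∀ l, ∑ j, (A⁻¹ i j : ℂ) * (A j l : ℂ) = if i = l then 1 else 0 := by
      intro l
      have h2 := congrFun (congrFun (Matrix.nonsing_inv_mul A (isUnit_iff_ne_zero.2 hA)) i) l
      rw [Matrix.mul_apply, Matrix.one_apply] at h2
      have h3 := congrArg (fun t : ℝ => (t : ℂ)) h2
      simp only [Complex.ofReal_sum, Complex.ofReal_mul] at h3
      rw [h3]
      split_ifs <;> simp
    calc x i = ∑ l, (if i = l then 1 else 0) * x l := by simp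
      _ = ∑ l, (∑ j, (A⁻¹ i j : ℂ) * (A j l : ℂ)) * x l := by simp only [h1]
      _ = ∑ j, ∑ l, (A⁻¹ i j : ℂ) * (A j l : ℂ) * x l := by
          simp only [Finset.sum_mul]; rw [Finset.sum_comm]
      _ = _ := by
          refine Finset.sum_congr rfl fun j _ => ?_
          rw [← h j, Finset.mul_sum]
          exact Finset.sum_congr rfl fun l _ => by ring
  have h4 : ∀ i, ‖x i‖ ≤ (∑ j, |A⁻¹ i j|) * ∑ j, ‖v j‖ := by
    intro i
    rw [hx i, Finset.sum_mul]
    refine norm_sum_le_of_le _ fun j _ => ?_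
    rw [norm_mul, Complex.norm_real, Real.norm_eq_abs]
    exact mul_le_mul_of_nonneg_left
      (Finset.single_le_sum (f := fun j => ‖v j‖) (fun _ _ => norm_nonneg _) (Finset.mem_univ j))
      (abs_nonneg _)
  refine (Finset.sum_le_sum fun i _ => h4 i).trans (le_of_eq ?_)
  rw [← Finset.sum_mul, entrySum]

section apriori
variable {n : ℕ} {c₀ : ℝ} {ω : Fin N → ℝ} (hω : Diophantine n c₀ ω)
  (S₀ : Matrix (Fin N) (Fin N) ℝ) (T₀ : Matrix (Fin 2) (Fin N) ℝ)
include hω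

/-- The mean values of a solution are controlled by the data up to small terms. -/
lemma exists_paramNorm_le (hT₀ : ∀ j, T₀ 0 j = 0)
    (hdet : (S₀ - Matrix.vecMulVec (T₀ 1) (T₀ 1)).det ≠ 0) (r : ℝ) {a b : ℝ} (ha : 0 ≤ a)
    (hab : a < b) :
    ∃ M, 0 ≤ M ∧ ∀ δ k : ℝ, 0 ≤ δ → δ ≤ 1 → 0 ≤ k → k ≤ 1 → ∀ D : SeqCoeffs N, D.Small b δ →
      ∀ g g₂ γ μ lam χ p, SeqSol ω S₀ T₀ k D g g₂ γ μ lam χ p →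
      ∀ (G₁ : ℝ) (G₂ : Fin 2 → ℝ), Bd (wt (r + 4 * n + 6) a) g G₁ →
      (∀ i, Bd (wt (r + 4 * n + 6) a) (g₂ i) (G₂ i)) →
      ∑ j, ‖μ j 0‖ ≤ M * ∑ i, ‖g₂ i 0‖ + δ * (M * (paramNorm μ lam χ p + G₁ + ∑ i, G₂ i)) ∧
      paramNorm μ lam χ p ≤ M * (∑ i, ‖g₂ i 0‖ + ‖γ‖) +
        δ * (M * (paramNorm μ lam χ p + G₁ + ∑ i, G₂ i)) := by
  obtain ⟨K, hK, hbd⟩ := exists_bound_of_paramNorm hω S₀ T₀ r ha hab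
  obtain ⟨κ, hκ⟩ : ∃ x, x = kc N r a b := ⟨_, rfl⟩
  have hκ' : 0 ≤ κ := hκ ▸ kc_nonneg _ _ _
  obtain ⟨ι, hι⟩ : ∃ x, x = entrySum (S₀ - Matrix.vecMulVec (T₀ 1) (T₀ 1))⁻¹ := ⟨_, rfl⟩
  have hι' : 0 ≤ ι := hι ▸ entrySum_nonneg _
  obtain ⟨τ, hτ⟩ : ∃ x, x = entrySum T₀ := ⟨_, rfl⟩
  have hτ' : 0 ≤ τ := hτ ▸ entrySum_nonneg _
  -- Each perturbation below has at most `N + 2` convolutions, each bounded by `δ κ K Q`, and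
  -- possibly a term `p * D.W`, bounded by `δ Q`; so `e = δ L Q` dominates all of them.
  obtain ⟨L, hL⟩ : ∃ x, x = (N + 2) * κ * K + 1 := ⟨_, rfl⟩
  have hL0 : 0 ≤ L := by rw [hL]; positivity
  -- All constants are added up: `2` and `3L` arise because the bound of `p` contains that of `λ̄₁`,
  -- which is itself one of the parameters.
  refine ⟨ι * τ + 2 + ι * (τ + N) * L + 3 * L + N * L, by positivity, ?_⟩
  intro δ k hδ hδ1 hk hk1 D hD g g₂ γ μ lam χ p hsol G₁ G₂ hg hg₂
  obtain ⟨hμ, hlam, hχ⟩ := hbd δ k hδ hδ1 hk D hD g g₂ γ μ lam χ p hsol G₁ G₂ hg hg₂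
  have hG₂' : 0 ≤ ∑ i, G₂ i := Finset.sum_nonneg fun i _ => (hg₂ i).nonneg
  have hG₁ := hg.nonneg
  obtain ⟨X, hX⟩ : ∃ x, x = ∑ j, ‖μ j 0‖ := ⟨_, rfl⟩
  obtain ⟨Z, hZ⟩ : ∃ x, x = ∑ j, ‖χ j 0‖ := ⟨_, rfl⟩
  obtain ⟨Q, hQ⟩ : ∃ x, x = paramNorm μ lam χ p + G₁ + ∑ i, G₂ i := ⟨_, rfl⟩
  have hP : paramNorm μ lam χ p = X + ‖lam 0 0‖ + ‖p‖ + Z := by rw [hX, hZ, paramNorm]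
  have hX0 : 0 ≤ X := hX ▸ Finset.sum_nonneg fun _ _ => norm_nonneg _
  have hZ0 : 0 ≤ Z := hZ ▸ Finset.sum_nonneg fun _ _ => norm_nonneg _
  have hp0 := norm_nonneg p
  have hy0 := norm_nonneg (lam 0 0)
  have hpQ : ‖p‖ ≤ Q := by rw [hQ, hP]; linarith
  have hQ0 : 0 ≤ Q := hp0.trans hpQ
  rw [← hQ] at hμ hlam hχ ⊢
  obtain ⟨e, he⟩ : ∃ x, x = δ * (L * Q) := ⟨_, rfl⟩
  have he0 : 0 ≤ e := by rw [he]; positivity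
  -- small terms
  have hE : ∀ i, ‖∑ j, conv (D.T i j) (μ j) 0 + p * D.W 0 i 0‖ ≤ e := by
    intro i
    have h1 := norm_sum_conv_le ha hab hδ (hD.T i) hμ
    have h2 : ‖p * D.W 0 i 0‖ ≤ δ * Q := by
      rw [norm_mul, mul_comm]
      have := hD.W 0 i 0
      rw [env_at_zero, mul_one] at this
      exact mul_le_mul this hpQ hp0 hδ
    refine (norm_add_le _ _).trans ((add_le_add h1 h2).trans ?_)
    rw [he, ← mul_add]
    refine mul_le_mul_of_nonneg_left ?_ hδ
    rw [Fintype.card_fin, ← hκ, hL]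
    have : 0 ≤ κ * K * Q := by positivity
    nlinarith
  have hF : ∀ j, ‖∑ l, conv (D.S j l) (μ l) 0 + ∑ i, conv (D.T i j) (lam i) 0‖ ≤ e := by
    intro j
    have h1 := norm_sum_conv_le ha hab hδ (hD.S j) hμ
    have h2 := norm_sum_conv_le ha hab hδ (fun i => hD.T i j) hlam
    refine (norm_add_le _ _).trans ((add_le_add h1 h2).trans ?_)
    rw [he, ← mul_add]
    refine mul_le_mul_of_nonneg_left ?_ hδ
    simp only [Fintype.card_fin, ← hκ, hL, Nat.cast_ofNat]
    nlinarith
  have hC : ‖∑ i, conv (D.W 0 i) (lam i) 0 + ∑ j, conv (dcoef j D.w) (χ j) 0‖ ≤ e := by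
    have h1 := norm_sum_conv_le ha hab hδ (hD.W 0) hlam
    have h2 := norm_sum_conv_le ha hab hδ hD.dw hχ
    refine (norm_add_le _ _).trans ((add_le_add h1 h2).trans ?_)
    rw [he, ← mul_add]
    refine mul_le_mul_of_nonneg_left ?_ hδ
    simp only [Fintype.card_fin, ← hκ, hL, Nat.cast_ofNat]
    nlinarith
  have hV : ∀ j, ‖∑ i, conv (D.U i j) (χ i) 0‖ ≤ e := by
    intro j
    refine (norm_sum_conv_le ha hab hδ (fun i => hD.U i j) hχ).trans ?_
    rw [he]
    refine mul_le_mul_of_nonneg_left ?_ hδ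
    rw [Fintype.card_fin, ← hκ, hL]
    have : 0 ≤ κ * K * Q := by positivity
    nlinarith
  -- the equations for the mean values
  have eqZ : Z ≤ N * e := by
    rw [hZ]
    refine (Finset.sum_le_sum fun j _ => (?_ : ‖χ j 0‖ ≤ e)).trans (by simp)
    rw [eq_neg_of_add_eq_zero_left (hsol.eq_V j), norm_neg]
    exact hV j
  have eqY : ‖lam 0 0‖ ≤ ‖γ‖ + e := by
    have h1 : lam 0 0 = γ - (∑ i, conv (D.W 0 i) (lam i) 0 + ∑ j, conv (dcoef j D.w) (χ j) 0) := by
      linear_combination hsol.eq_γ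
    rw [h1]
    exact (norm_sub_le _ _).trans (by linarith)
  -- The vanishing first row of `T₀` removes `μ̄` from the first `λ`-equation at `m = 0`, which
  -- becomes `p = k λ̄₁ + ḡ₂₁` up to small terms.
  have eqp : ‖p‖ ≤ ‖lam 0 0‖ + ‖g₂ 0 0‖ + e := by
    have h0 := hsol.eq_lam₀ 0
    simp only [force, hT₀, Complex.ofReal_zero, zero_mul, zero_add, and_self, if_true, freq_zero,
      mul_zero, zero_sub] at h0
    have h1 : p = k * lam 0 0 + g₂ 0 0 - (∑ j, conv (D.T 0 j) (μ j) 0 + p * D.W 0 0 0) := by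
      linear_combination h0
    have h2 : ‖(k : ℂ) * lam 0 0‖ ≤ ‖lam 0 0‖ := by
      rw [norm_mul, Complex.norm_real, Real.norm_of_nonneg hk]
      exact mul_le_of_le_one_left hy0 hk1
    have h3 := norm_sub_le (k * lam 0 0 + g₂ 0 0) (∑ j, conv (D.T 0 j) (μ j) 0 + p * D.W 0 0 0)
    rw [← h1] at h3
    have h4 := norm_add_le (k * lam 0 0) (g₂ 0 0)
    have := hE 0
    linarith
  -- The second `λ`-equation gives `λ̄₂ = ḡ₂₂ - t₀·μ̄` up to small terms; in the mean of the
  -- `χ`-equation this turns `S₀` into `S₀ - t₀⊗t₀`. Only `ḡ₂₂` enters outside the small terms,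
  -- which is the source of the refined bound of `μ̄`.
  have eqX : X ≤ ι * (τ * (‖g₂ 1 0‖ + e) + N * e) := by
    have hl := hsol.eq_lam₁ 0
    simp only [force, one_ne_zero, false_and, if_false, zero_add, freq_zero, mul_zero,
      Complex.ofReal_zero, zero_mul, neg_zero] at hl
    rw [Finset.sum_add_distrib] at hl
    let v : Fin N → ℂ := fun j =>
      -(T₀ 1 j : ℂ) * (g₂ 1 0 - (∑ l, conv (D.T 1 l) (μ l) 0 + p * D.W 0 1 0))
        - (∑ l, conv (D.S j l) (μ l) 0 + ∑ i, conv (D.T i j) (lam i) 0)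
    have hv : ∀ j, ‖v j‖ ≤ |T₀ 1 j| * (‖g₂ 1 0‖ + e) + e := by
      intro j
      refine (norm_sub_le _ _).trans (add_le_add ?_ (hF j))
      rw [norm_mul, norm_neg, Complex.norm_real, Real.norm_eq_abs]
      refine mul_le_mul_of_nonneg_left ((norm_sub_le _ _).trans ?_) (abs_nonneg _)
      linarith [hE 1]
    have hlin : ∀ j, ∑ l, (((S₀ - Matrix.vecMulVec (T₀ 1) (T₀ 1)) j l : ℝ) : ℂ) * μ l 0 = v j := by
      intro j
      have hs := hsol.eq_χ j 0
      simp only [source, freq_zero, Complex.ofReal_zero, mul_zero, zero_mul, neg_zero, zero_add,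
        Finset.sum_add_distrib, Fin.sum_univ_two, hT₀] at hs
      simp only [Matrix.sub_apply, Matrix.vecMulVec_apply, Complex.ofReal_sub, Complex.ofReal_mul,
        sub_mul, Finset.sum_sub_distrib, mul_assoc, ← Finset.mul_sum, v, Fin.sum_univ_two]
      linear_combination hs - (T₀ 1 j : ℂ) * hl
    have := norm_sum_le_of_matrix_eq hdet hlin
    rw [← hX, ← hι] at this
    refine this.trans (mul_le_mul_of_nonneg_left ?_ hι')
    refine (Finset.sum_le_sum fun j _ => hv j).trans ?_
    rw [Finset.sum_add_distrib, ← Finset.sum_mul]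
    have h5 := row_le_entrySum T₀ 1
    rw [← hτ] at h5
    have h6 : 0 ≤ ‖g₂ 1 0‖ + e := by positivity
    have := mul_le_mul_of_nonneg_right h5 h6
    simp only [Finset.sum_const, Finset.card_univ, Fintype.card_fin, nsmul_eq_mul]
    linarith
  have hg0 := norm_nonneg (g₂ 0 0)
  have hg1 := norm_nonneg (g₂ 1 0)
  have hγ0 := norm_nonneg γ
  rw [hP, ← hX, Fin.sum_univ_two]
  have hιτ : 0 ≤ ι * τ := by positivity
  have hιL : 0 ≤ ι * (τ + N) * L := by positivity
  have hNL : 0 ≤ N * L := by positivity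
  have eqX' : X ≤ ι * τ * ‖g₂ 1 0‖ + ι * (τ + N) * e := by linarith
  have hδQ : 0 ≤ δ * Q := by positivity
  have e1 : ι * (τ + N) * e = ι * (τ + N) * L * (δ * Q) := by rw [he]; ring
  have e2 : N * e = N * L * (δ * Q) := by rw [he]; ring
  have e3 : e = L * (δ * Q) := by rw [he]; ring
  have s1 := mul_nonneg hιτ hg0
  have s2 := mul_nonneg hιτ hγ0
  have s3 := mul_nonneg hιL hg0
  have s4 := mul_nonneg hιL hg1
  have s5 := mul_nonneg hιL hγ0
  have s6 := mul_nonneg hL0 hg0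
  have s7 := mul_nonneg hL0 hg1
  have s8 := mul_nonneg hL0 hγ0
  have s9 := mul_nonneg hNL hg0
  have s10 := mul_nonneg hNL hg1
  have s11 := mul_nonneg hNL hγ0
  have s12 := mul_nonneg hL0 hδQ
  have s13 := mul_nonneg hNL hδQ
  have s14 := mul_nonneg hιτ hδQ
  constructor
  · calc X ≤ ι * τ * ‖g₂ 1 0‖ + ι * (τ + N) * L * (δ * Q) := by rw [← e1]; exact eqX'
      _ ≤ _ := by linarith
  · calc X + ‖lam 0 0‖ + ‖p‖ + Z
        ≤ ι * τ * ‖g₂ 1 0‖ + 2 * ‖γ‖ + ‖g₂ 0 0‖ + (ι * (τ + N) * L * (δ * Q) + 3 * (L * (δ * Q))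
          + N * L * (δ * Q)) := by linarith
      _ ≤ _ := by linarith

/-- The a priori estimate for the linear problem. -/
theorem exists_apriori (hT₀ : ∀ j, T₀ 0 j = 0)
    (hdet : (S₀ - Matrix.vecMulVec (T₀ 1) (T₀ 1)).det ≠ 0) (r : ℝ) {a b : ℝ} (ha : 0 ≤ a)
    (hab : a < b) :
    ∃ A, 0 < A ∧ ∃ δ₁, 0 < δ₁ ∧ ∀ δ k : ℝ, 0 ≤ δ → δ ≤ δ₁ → 0 ≤ k → k ≤ 1 →
      ∀ D : SeqCoeffs N, D.Small b δ →
      ∀ g g₂ γ μ lam χ p, SeqSol ω S₀ T₀ k D g g₂ γ μ lam χ p →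
      ∀ (G₁ : ℝ) (G₂ : Fin 2 → ℝ), Bd (wt (r + 4 * n + 6) a) g G₁ →
      (∀ i, Bd (wt (r + 4 * n + 6) a) (g₂ i) (G₂ i)) →
      (∀ j, Bd (wt r a) (μ j) (A * (G₁ + ∑ i, G₂ i + ‖γ‖))) ∧
      (∀ i, Bd (wt r a) (lam i) (A * (G₁ + ∑ i, G₂ i + ‖γ‖))) ∧
      (∀ j, Bd (wt r a) (χ j) (A * (G₁ + ∑ i, G₂ i + ‖γ‖))) ∧
      ‖p‖ ≤ A * (G₁ + ∑ i, G₂ i + ‖γ‖) ∧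
      ∑ j, ‖μ j 0‖ ≤ A * ∑ i, ‖g₂ i 0‖ + δ * (A * (G₁ + ∑ i, G₂ i + ‖γ‖)) := by
  obtain ⟨K, hK, hbd⟩ := exists_bound_of_paramNorm hω S₀ T₀ r ha hab
  obtain ⟨M, hM, hpar⟩ := exists_paramNorm_le hω S₀ T₀ hT₀ hdet r ha hab
  -- The threshold gives `δ M ≤ 1/2`, so half of `P + G₁ + G` is absorbed on the left, leaving the
  -- factor `2M + 2`; it also gives `δ ≤ 1`.
  refine ⟨(K + M + 1) * (2 * M + 2) + M, by positivity, (2 * (M + 1))⁻¹, by positivity, ?_⟩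
  intro δ k hδ hδ1 hk hk1 D hD g g₂ γ μ lam χ p hsol G₁ G₂ hg hg₂
  have hδM : δ * M ≤ 1 / 2 := by
    have h1 : δ * (2 * (M + 1)) ≤ 1 := (le_inv_mul_iff₀ (by positivity)).1 (by simpa using hδ1) |>.trans_eq' (mul_comm _ _)
    nlinarith
  have hδ1' : δ ≤ 1 := by
    refine hδ1.trans (inv_le_one_of_one_le₀ ?_)
    linarith
  obtain ⟨hμ, hlam, hχ⟩ := hbd δ k hδ hδ1' hk D hD g g₂ γ μ lam χ p hsol G₁ G₂ hg hg₂
  obtain ⟨hX, hP⟩ := hpar δ k hδ hδ1' hk hk1 D hD g g₂ γ μ lam χ p hsol G₁ G₂ hg hg₂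
  have hG₂' : 0 ≤ ∑ i, G₂ i := Finset.sum_nonneg fun i _ => (hg₂ i).nonneg
  have hG₁ := hg.nonneg
  have hγ := norm_nonneg γ
  have hgm : ∑ i, ‖g₂ i 0‖ ≤ ∑ i, G₂ i := Finset.sum_le_sum fun i _ => (hg₂ i).norm_zero_le
  have hgm0 : 0 ≤ ∑ i, ‖g₂ i 0‖ := Finset.sum_nonneg fun _ _ => norm_nonneg _
  have hpn : ‖p‖ ≤ paramNorm μ lam χ p := by
    have h1 : 0 ≤ ∑ j, ‖μ j 0‖ := Finset.sum_nonneg fun _ _ => norm_nonneg _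
    have h2 : 0 ≤ ∑ j, ‖χ j 0‖ := Finset.sum_nonneg fun _ _ => norm_nonneg _
    have h3 := norm_nonneg (lam 0 0)
    rw [paramNorm]; linarith
  generalize paramNorm μ lam χ p = P at *
  generalize ∑ i, G₂ i = G at *
  generalize ∑ i, ‖g₂ i 0‖ = gm at *
  have hP0 : 0 ≤ P := (norm_nonneg p).trans hpn
  have hQ0 : 0 ≤ P + G₁ + G := by positivity
  have hQ : P + G₁ + G ≤ (2 * M + 2) * (G₁ + G + ‖γ‖) := by
    have h1 : δ * (M * (P + G₁ + G)) ≤ 1 / 2 * (P + G₁ + G) := by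
      rw [← mul_assoc]; exact mul_le_mul_of_nonneg_right hδM hQ0
    have h2 : M * (gm + ‖γ‖) ≤ M * (G₁ + G + ‖γ‖) := by gcongr; linarith
    nlinarith
  have hD0 : 0 ≤ G₁ + G + ‖γ‖ := by positivity
  have hbig : ∀ c, 0 ≤ c → c ≤ K + M + 1 →
      c * (P + G₁ + G) ≤ ((K + M + 1) * (2 * M + 2) + M) * (G₁ + G + ‖γ‖) := by
    intro c h0 hc
    calc c * (P + G₁ + G) ≤ (K + M + 1) * ((2 * M + 2) * (G₁ + G + ‖γ‖)) := by gcongr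
      _ ≤ _ := by
          have := mul_nonneg hM hD0
          nlinarith
  refine ⟨fun j => (hμ j).mono (hbig K hK (by linarith)), fun i => (hlam i).mono (hbig K hK (by linarith)),
    fun j => (hχ j).mono (hbig K hK (by linarith)), ?_, ?_⟩
  · refine le_trans ?_ (hbig 1 zero_le_one (by linarith))
    linarith
  · refine hX.trans (add_le_add ?_ ?_)
    · refine mul_le_mul_of_nonneg_right ?_ hgm0
      have : 0 ≤ (K + M + 1) * (2 * M + 2) := by positivity
      linarith
    · exact mul_le_mul_of_nonneg_left (hbig M hM (by linarith)) hδ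

end apriori

/-! ### Rapidly decreasing sequences -/

/-- Sequences which decay faster than every power. -/
def Rapid (N : ℕ) : Submodule ℂ ((Fin N → ℤ) → ℂ) where
  carrier := {c | ∀ r, ∃ B, Bd (wt r 0) c B}
  add_mem' := by
    intro c d hc hd r
    obtain ⟨A, hA⟩ := hc r
    obtain ⟨B, hB⟩ := hd r
    exact ⟨_, hA.add (wt_nonneg r 0) hB⟩
  zero_mem' := fun r => ⟨0, Bd.zero⟩
  smul_mem' := by
    intro z c hc r
    obtain ⟨A, hA⟩ := hc r
    exact ⟨_, hA.smul (wt_nonneg r 0) z⟩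

lemma rapid_of_env {b δ : ℝ} (hb : 0 < b) (hδ : 0 ≤ δ) {α : (Fin N → ℤ) → ℂ}
    (hα : ∀ k, ‖α k‖ ≤ δ * env b k) : α ∈ Rapid N :=
  fun r => ⟨_, Bd.of_env r le_rfl hb hδ hα⟩

lemma conv_mem_rapid {b δ : ℝ} (hb : 0 < b) (hδ : 0 ≤ δ) {α c : (Fin N → ℤ) → ℂ}
    (hα : ∀ k, ‖α k‖ ≤ δ * env b k) (hc : c ∈ Rapid N) : conv α c ∈ Rapid N := by
  intro r
  obtain ⟨B, hB⟩ := hc r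
  exact ⟨_, hB.conv le_rfl hb hδ hα⟩

lemma summable_conv_of_rapid {b δ : ℝ} (hb : 0 < b) {α c : (Fin N → ℤ) → ℂ}
    (hα : ∀ k, ‖α k‖ ≤ δ * env b k) (hc : c ∈ Rapid N) (m : Fin N → ℤ) :
    Summable (fun k => α k * c (m - k)) := by
  obtain ⟨B, hB⟩ := hc 0
  exact summable_conv le_rfl hb hα hB m

/-- Decay beyond every power absorbs any polynomial loss, so division by small divisors maps the
space into itself. The value `f 0` is unrestricted. -/
lemma mul_mem_rapid {K q : ℝ} (hK : 0 ≤ K) {f c : (Fin N → ℤ) → ℂ}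
    (hf : ∀ m, m ≠ 0 → ‖f m‖ ≤ K * (1 + sqLen m) ^ (q / 2)) (hc : c ∈ Rapid N) :
    (fun m => f m * c m) ∈ Rapid N := by
  intro r
  obtain ⟨B, hB⟩ := hc (r + q)
  have := hB.of_mul_le (d := fun m => f m * c m) (q := q) hK fun m hm => by
    rw [norm_mul]
    exact mul_le_mul_of_nonneg_right (hf m hm) (norm_nonneg _)
  rw [add_sub_cancel_right] at this
  exact ⟨_, this⟩

lemma delta_mem_rapid (z : ℂ) : (fun m : Fin N → ℤ => if m = 0 then z else 0) ∈ Rapid N := by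
  intro r
  exact ⟨_, (Bd.zero (w := wt r 0)).of_ne_zero (w' := wt r 0)
    (d := fun m : Fin N → ℤ => if m = 0 then z else 0) le_rfl (wt_nonneg _ _)
    (wt_at_zero _ _) (fun m hm => by simp [hm]) (wt_nonneg _ _)⟩

section conv_linear
variable {b δ : ℝ} (hb : 0 < b) {α : (Fin N → ℤ) → ℂ} (hα : ∀ k, ‖α k‖ ≤ δ * env b k)
include hb hα

lemma conv_add {c d : (Fin N → ℤ) → ℂ} (hc : c ∈ Rapid N) (hd : d ∈ Rapid N) :
    conv α (c + d) = conv α c + conv α d := by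
  ext m
  simp only [conv, Pi.add_apply, mul_add]
  exact (summable_conv_of_rapid hb hα hc m).tsum_add (summable_conv_of_rapid hb hα hd m)

omit hb hα in
lemma conv_smul (z : ℂ) (c : (Fin N → ℤ) → ℂ) : conv α (z • c) = z • conv α c := by
  ext m
  simp only [conv, Pi.smul_apply, smul_eq_mul, ← tsum_mul_left]
  exact tsum_congr fun k => by ring

lemma conv_sub {c d : (Fin N → ℤ) → ℂ} (hc : c ∈ Rapid N) (hd : d ∈ Rapid N) (m : Fin N → ℤ) :
    conv α (fun m => c m - d m) m = conv α c m - conv α d m := by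
  simp only [conv, mul_sub]
  exact (summable_conv_of_rapid hb hα hc m).tsum_sub (summable_conv_of_rapid hb hα hd m)

/-- Convolution as a linear map. -/
lemma exists_convL (hδ : 0 ≤ δ) : ∃ L : Rapid N →ₗ[ℂ] Rapid N, ∀ c m,
    (L c : (Fin N → ℤ) → ℂ) m = conv α c m :=
  ⟨{ toFun := fun c => ⟨conv α c, conv_mem_rapid hb hδ hα c.2⟩
     map_add' := fun c d => Subtype.ext (conv_add hb hα c.2 d.2)
     map_smul' := fun z c => Subtype.ext (conv_smul z (c : (Fin N → ℤ) → ℂ)) }, fun _ _ => rfl⟩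

end conv_linear

/-- A Fourier multiplier as a linear map. -/
lemma exists_mulL {K q : ℝ} (hK : 0 ≤ K) {f : (Fin N → ℤ) → ℂ}
    (hf : ∀ m, m ≠ 0 → ‖f m‖ ≤ K * (1 + sqLen m) ^ (q / 2)) :
    ∃ L : Rapid N →ₗ[ℂ] Rapid N, ∀ c m, (L c : (Fin N → ℤ) → ℂ) m = f m * (c : (Fin N → ℤ) → ℂ) m :=
  ⟨{ toFun := fun c => ⟨fun m => f m * (c : (Fin N → ℤ) → ℂ) m, mul_mem_rapid hK hf c.2⟩
     map_add' := fun _ _ => Subtype.ext (funext fun _ => mul_add _ _ _)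
     map_smul' := fun _ _ => Subtype.ext (funext fun _ => mul_left_comm _ _ _) }, fun _ _ => rfl⟩

/-- The sequence supported at the origin, as a linear map. -/
noncomputable def deltaL (N : ℕ) : ℂ →ₗ[ℂ] Rapid N where
  toFun z := ⟨fun m => if m = 0 then z else 0, delta_mem_rapid z⟩
  map_add' x y := Subtype.ext (funext fun m => by by_cases h : m = 0 <;> simp [h])
  map_smul' z x := Subtype.ext (funext fun m => by by_cases h : m = 0 <;> simp [h])

/-- The mean value as a linear map. -/
def evL (N : ℕ) : Rapid N →ₗ[ℂ] ℂ where
  toFun c := (c : (Fin N → ℤ) → ℂ) 0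
  map_add' _ _ := rfl
  map_smul' _ _ := rfl

lemma coe_sum_rapid {ι : Type*} (s : Finset ι) (c : ι → Rapid N) (m : Fin N → ℤ) :
    ((∑ i ∈ s, c i : Rapid N) : (Fin N → ℤ) → ℂ) m = ∑ i ∈ s, (c i : (Fin N → ℤ) → ℂ) m := by
  rw [Submodule.coe_sum, Finset.sum_apply]

/-! ### Existence -/

/-- The mean values `(μ̄, λ̄₁, p, χ̄)` which parametrize the solutions. -/
abbrev ParamSpace (N : ℕ) : Type := (Fin N → ℂ) × ℂ × ℂ × (Fin N → ℂ)

/-- Mean values and right hand sides. -/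
abbrev InputSpace (N : ℕ) : Type := ParamSpace N × Rapid N × (Fin 2 → Rapid N)

section existence
variable {n : ℕ} {c₀ : ℝ} {ω : Fin N → ℝ} (hω : Diophantine n c₀ ω)
include hω

lemma norm_inv_freq_le {m : Fin N → ℤ} (hm : m ≠ 0) :
    ‖(freq ω m : ℂ)⁻¹‖ ≤ |c₀| * (1 + sqLen m) ^ ((n : ℝ) / 2) := by
  rw [norm_inv, Complex.norm_real, Real.norm_eq_abs]
  exact hω.inv_freq_le hm

/-- Up to sign, these are the entries of the inverse of the 2×2 block of the `λ`-equation at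
frequency `m`. -/
lemma norm_hyperbolic_le {k : ℝ} (hk : 0 ≤ k) {m : Fin N → ℤ} (hm : m ≠ 0) :
    ‖((freq ω m ^ 2 + k : ℝ) : ℂ)⁻¹‖ ≤ |c₀| ^ 2 * (1 + sqLen m) ^ ((2 * n : ℝ) / 2) ∧
    ‖Complex.I * freq ω m * ((freq ω m ^ 2 + k : ℝ) : ℂ)⁻¹‖ ≤ |c₀| * (1 + sqLen m) ^ ((n : ℝ) / 2) ∧
    ‖k * ((freq ω m ^ 2 + k : ℝ) : ℂ)⁻¹‖ ≤ 1 * (1 + sqLen m) ^ ((0 : ℝ) / 2) := by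
  have hf : 0 < |freq ω m| := abs_pos.2 (hω.freq_ne_zero hm)
  have hpos : 0 < freq ω m ^ 2 + k := by rw [← sq_abs]; positivity
  have hs := one_add_sqLen_pos m
  have h1 : (freq ω m ^ 2 + k)⁻¹ ≤ |freq ω m|⁻¹ ^ 2 := by
    rw [inv_pow, sq_abs]
    exact inv_anti₀ (by rw [← sq_abs]; positivity) (by linarith)
  have h2 := hω.inv_freq_le hm
  have e : (1 + sqLen m) ^ ((2 * n : ℝ) / 2) = ((1 + sqLen m) ^ ((n : ℝ) / 2)) ^ 2 := by
    rw [← Real.rpow_natCast, ← Real.rpow_mul hs.le]; congr 1; push_cast; ring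
  refine ⟨?_, ?_, ?_⟩
  · rw [norm_inv, Complex.norm_real, Real.norm_of_nonneg hpos.le, e, ← mul_pow]
    exact h1.trans (pow_le_pow_left₀ (by positivity) h2 2)
  · rw [norm_mul, norm_mul, norm_inv, Complex.norm_I, one_mul, Complex.norm_real, Complex.norm_real,
      Real.norm_of_nonneg hpos.le, Real.norm_eq_abs]
    refine le_trans ?_ h2
    calc |freq ω m| * (freq ω m ^ 2 + k)⁻¹ ≤ |freq ω m| * |freq ω m|⁻¹ ^ 2 := by gcongr
      _ = _ := by field_simp
  · rw [norm_mul, norm_inv, Complex.norm_real, Complex.norm_real, Real.norm_of_nonneg hpos.le,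
      Real.norm_of_nonneg hk, zero_div, Real.rpow_zero, mul_one, ← div_eq_mul_inv, div_le_one hpos]
    nlinarith [sq_nonneg (freq ω m)]

/-- The problem is solvable as soon as it is uniquely solvable. -/
theorem exists_seqSol (S₀ : Matrix (Fin N) (Fin N) ℝ) (T₀ : Matrix (Fin 2) (Fin N) ℝ) {b δ k : ℝ}
    (hb : 0 < b) (hδ : 0 ≤ δ) (hk : 0 ≤ k) {D : SeqCoeffs N} (hD : D.Small b δ)
    (huniq : ∀ μ lam χ p, SeqSol ω S₀ T₀ k D 0 0 0 μ lam χ p →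
      (∀ j, μ j = 0) ∧ (∀ i, lam i = 0) ∧ (∀ j, χ j = 0) ∧ p = 0)
    {g : (Fin N → ℤ) → ℂ} (hg : g ∈ Rapid N) {g₂ : Fin 2 → (Fin N → ℤ) → ℂ}
    (hg₂ : ∀ i, g₂ i ∈ Rapid N) (γ : ℂ) :
    ∃ μ lam χ p, SeqSol ω S₀ T₀ k D g g₂ γ μ lam χ p ∧
      (∀ j, μ j ∈ Rapid N) ∧ (∀ i, lam i ∈ Rapid N) ∧ (∀ j, χ j ∈ Rapid N) := by
  classical
  choose TL hTL using fun i j => exists_convL hb (hD.T i j) hδ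
  choose SL hSL using fun i j => exists_convL hb (hD.S i j) hδ
  choose UL hUL using fun i j => exists_convL hb (hD.U i j) hδ
  choose WL hWL using fun i j => exists_convL hb (hD.W i j) hδ
  choose dL hdL using fun j => exists_convL hb (hD.dw j) hδ
  -- Coordinates on the input space: the parameters `μ̄`, `λ̄₁`, `p`, `χ̄` and the right hand sides.
  -- The solution is built as a linear function of all of them.
  let xL : Fin N → InputSpace N →ₗ[ℂ] ℂ := fun j => LinearMap.proj j ∘ₗ LinearMap.fst ℂ _ _ ∘ₗ LinearMap.fst ℂ _ _
  let yL : InputSpace N →ₗ[ℂ] ℂ := LinearMap.fst ℂ _ _ ∘ₗ LinearMap.snd ℂ _ _ ∘ₗ LinearMap.fst ℂ _ _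
  let pL : InputSpace N →ₗ[ℂ] ℂ :=
    LinearMap.fst ℂ _ _ ∘ₗ LinearMap.snd ℂ _ _ ∘ₗ LinearMap.snd ℂ _ _ ∘ₗ LinearMap.fst ℂ _ _
  let zL : Fin N → InputSpace N →ₗ[ℂ] ℂ := fun j => LinearMap.proj j ∘ₗ
    LinearMap.snd ℂ _ _ ∘ₗ LinearMap.snd ℂ _ _ ∘ₗ LinearMap.snd ℂ _ _ ∘ₗ LinearMap.fst ℂ _ _
  let gL : InputSpace N →ₗ[ℂ] Rapid N := LinearMap.fst ℂ _ _ ∘ₗ LinearMap.snd ℂ _ _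
  let g₂L : Fin 2 → InputSpace N →ₗ[ℂ] Rapid N := fun i =>
    LinearMap.proj i ∘ₗ LinearMap.snd ℂ _ _ ∘ₗ LinearMap.snd ℂ _ _
  let wS : Rapid N := ⟨D.w, rapid_of_env hb hδ hD.w⟩
  let eS : Fin 2 → Rapid N := fun i =>
    (if i = 0 then deltaL N 1 else 0) + ⟨D.W 0 i, rapid_of_env hb hδ (hD.W 0 i)⟩
  have heS : ∀ i m, (eS i : (Fin N → ℤ) → ℂ) m = (if i = 0 ∧ m = 0 then 1 else 0) + D.W 0 i m := by
    intro i m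
    by_cases hi : i = 0
    · simp [eS, hi, deltaL]
    · simp [eS, hi]
  -- the components of the solution
  obtain ⟨μL, hμL⟩ : ∃ L : Fin N → InputSpace N →ₗ[ℂ] Rapid N, ∀ j P m, (L j P : (Fin N → ℤ) → ℂ) m =
      (if m = 0 then xL j P else 0) + -(m j * (freq ω m : ℂ)⁻¹) *
        (pL P * D.w m + (gL P : (Fin N → ℤ) → ℂ) m) := by
    have hmul : ∀ j, ∃ L : Rapid N →ₗ[ℂ] Rapid N, ∀ c m, (L c : (Fin N → ℤ) → ℂ) m =
        -(m j * (freq ω m : ℂ)⁻¹) * (c : (Fin N → ℤ) → ℂ) m := fun j =>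
      exists_mulL (K := |c₀|) (q := 1 + n) (abs_nonneg _) fun m hm => by
        rw [norm_neg, norm_mul, Complex.norm_intCast, add_div, Real.rpow_add (one_add_sqLen_pos m),
          mul_left_comm]
        have := one_add_sqLen_pos m
        exact mul_le_mul (abs_coord_le m j) (norm_inv_freq_le hω hm) (norm_nonneg _) (by positivity)
    choose L hL using hmul
    refine ⟨fun j => deltaL N ∘ₗ xL j + L j ∘ₗ (LinearMap.toSpanSingleton ℂ _ wS ∘ₗ pL + gL),
      fun j P m => ?_⟩
    simp only [LinearMap.add_apply, LinearMap.comp_apply, Submodule.coe_add, Pi.add_apply, hL]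
    rfl
  obtain ⟨FL, hFL⟩ : ∃ L : Fin 2 → InputSpace N →ₗ[ℂ] Rapid N, ∀ i P m, (L i P : (Fin N → ℤ) → ℂ) m =
      force T₀ D (fun j => μL j P) (pL P) i m := by
    refine ⟨fun i => ∑ j, ((T₀ i j : ℂ) • μL j + TL i j ∘ₗ μL j)
      + LinearMap.toSpanSingleton ℂ _ (eS i) ∘ₗ pL, fun i P m => ?_⟩
    simp only [LinearMap.add_apply, LinearMap.comp_apply, Submodule.coe_add, Pi.add_apply,
      LinearMap.sum_apply, coe_sum_rapid, hTL, force, LinearMap.toSpanSingleton_apply,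
      LinearMap.smul_apply, Submodule.coe_smul, Pi.smul_apply, heS, smul_eq_mul]
  -- The inverse block is altered at `m = 0`. The first component has the free mean `yL P`, so the
  -- multiplier of the first equation is set to `0`. The second component must solve the second
  -- equation there, so its multiplier is `1`, also when `k = 0`.
  obtain ⟨lamL, hlam₀, hlam₁⟩ : ∃ L : Fin 2 → InputSpace N →ₗ[ℂ] Rapid N,
      (∀ P m, (L 0 P : (Fin N → ℤ) → ℂ) m = (if m = 0 then yL P else 0) +
        (-(if m = 0 then 0 else ((freq ω m ^ 2 + k : ℝ) : ℂ)⁻¹) *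
            ((g₂L 0 P : (Fin N → ℤ) → ℂ) m - (FL 0 P : (Fin N → ℤ) → ℂ) m)
          + Complex.I * freq ω m * ((freq ω m ^ 2 + k : ℝ) : ℂ)⁻¹ *
            ((g₂L 1 P : (Fin N → ℤ) → ℂ) m - (FL 1 P : (Fin N → ℤ) → ℂ) m))) ∧
      (∀ P m, (L 1 P : (Fin N → ℤ) → ℂ) m =
        -(Complex.I * freq ω m * ((freq ω m ^ 2 + k : ℝ) : ℂ)⁻¹) *
            ((g₂L 0 P : (Fin N → ℤ) → ℂ) m - (FL 0 P : (Fin N → ℤ) → ℂ) m)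
          + (if m = 0 then 1 else k * ((freq ω m ^ 2 + k : ℝ) : ℂ)⁻¹) *
            ((g₂L 1 P : (Fin N → ℤ) → ℂ) m - (FL 1 P : (Fin N → ℤ) → ℂ) m)) := by
    obtain ⟨A₀, hA₀⟩ := exists_mulL (N := N) (K := |c₀| ^ 2) (q := 2 * n) (by positivity)
      (f := fun m => -(if m = 0 then 0 else ((freq ω m ^ 2 + k : ℝ) : ℂ)⁻¹)) fun m hm => by
        rw [if_neg hm, norm_neg]; exact (norm_hyperbolic_le hω hk hm).1
    obtain ⟨A₁, hA₁⟩ := exists_mulL (N := N) (K := |c₀|) (q := n) (by positivity)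
      (f := fun m => Complex.I * freq ω m * ((freq ω m ^ 2 + k : ℝ) : ℂ)⁻¹) fun m hm =>
        (norm_hyperbolic_le hω hk hm).2.1
    obtain ⟨A₂, hA₂⟩ := exists_mulL (N := N) (K := 1) (q := 0) (by positivity)
      (f := fun m => if m = 0 then 1 else k * ((freq ω m ^ 2 + k : ℝ) : ℂ)⁻¹) fun m hm => by
        rw [if_neg hm]; exact (norm_hyperbolic_le hω hk hm).2.2
    refine ⟨![deltaL N ∘ₗ yL + (A₀ ∘ₗ (g₂L 0 - FL 0) + A₁ ∘ₗ (g₂L 1 - FL 1)),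
      -(A₁ ∘ₗ (g₂L 0 - FL 0)) + A₂ ∘ₗ (g₂L 1 - FL 1)], fun P m => ?_, fun P m => ?_⟩
    · simp only [Matrix.cons_val_zero, LinearMap.add_apply, LinearMap.comp_apply, Submodule.coe_add,
        Pi.add_apply, hA₀, hA₁, LinearMap.sub_apply, Submodule.coe_sub, Pi.sub_apply]
      rfl
    · simp only [Matrix.cons_val_one, Matrix.cons_val_fin_one, LinearMap.add_apply, LinearMap.neg_apply,
        LinearMap.comp_apply, Submodule.coe_add, Submodule.coe_neg, Pi.neg_apply,
        Pi.add_apply, hA₂, hA₁, LinearMap.sub_apply, Submodule.coe_sub, Pi.sub_apply]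
      ring
  obtain ⟨QL, hQL⟩ : ∃ L : Fin N → InputSpace N →ₗ[ℂ] Rapid N, ∀ j P m, (L j P : (Fin N → ℤ) → ℂ) m =
      source S₀ T₀ D (fun j => μL j P) (fun i => lamL i P) j m := by
    refine ⟨fun j => ∑ l, ((S₀ j l : ℂ) • μL l + SL j l ∘ₗ μL l)
      + ∑ i, ((T₀ i j : ℂ) • lamL i + TL i j ∘ₗ lamL i), fun j P m => ?_⟩
    simp only [LinearMap.add_apply, LinearMap.comp_apply, Submodule.coe_add, Pi.add_apply,
      LinearMap.sum_apply, coe_sum_rapid, hTL, hSL, source,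
      LinearMap.smul_apply, Submodule.coe_smul, Pi.smul_apply, smul_eq_mul]
  -- At `m = 0` the default value `0⁻¹ = 0` leaves only the free mean value, as it does in `μL`.
  obtain ⟨χL, hχL⟩ : ∃ L : Fin N → InputSpace N →ₗ[ℂ] Rapid N, ∀ j P m, (L j P : (Fin N → ℤ) → ℂ) m =
      (if m = 0 then zL j P else 0) +
        -Complex.I * (freq ω m : ℂ)⁻¹ * (QL j P : (Fin N → ℤ) → ℂ) m := by
    obtain ⟨A, hA⟩ := exists_mulL (N := N) (K := |c₀|) (q := n) (by positivity)
      (f := fun m => -Complex.I * (freq ω m : ℂ)⁻¹) fun m hm => by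
        rw [norm_mul, norm_neg, Complex.norm_I, one_mul]
        exact norm_inv_freq_le hω hm
    refine ⟨fun j => deltaL N ∘ₗ zL j + A ∘ₗ QL j, fun j P m => ?_⟩
    simp only [LinearMap.add_apply, LinearMap.comp_apply, Submodule.coe_add, Pi.add_apply, hA]
    rfl
  -- the finite dimensional system
  obtain ⟨RL, hRL⟩ : ∃ R : InputSpace N →ₗ[ℂ] ParamSpace N, ∀ P, R P =
      (fun j => (QL j P : (Fin N → ℤ) → ℂ) 0,
        -(k : ℂ) * yL P + (FL 0 P : (Fin N → ℤ) → ℂ) 0 - (g₂L 0 P : (Fin N → ℤ) → ℂ) 0,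
        (lamL 0 P : (Fin N → ℤ) → ℂ) 0 + ∑ i, conv (D.W 0 i) (lamL i P) 0
          + ∑ j, conv (dcoef j D.w) (χL j P) 0,
        fun j => (χL j P : (Fin N → ℤ) → ℂ) 0 + ∑ i, conv (D.U i j) (χL i P) 0) := by
    refine ⟨(LinearMap.pi fun j => evL N ∘ₗ QL j).prod
      ((-(k : ℂ) • yL + evL N ∘ₗ FL 0 - evL N ∘ₗ g₂L 0).prod
        ((evL N ∘ₗ (lamL 0 + ∑ i, WL 0 i ∘ₗ lamL i + ∑ j, dL j ∘ₗ χL j)).prod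
          (LinearMap.pi fun j => evL N ∘ₗ (χL j + ∑ i, UL i j ∘ₗ χL i)))), fun P => ?_⟩
    refine Prod.ext ?_ (Prod.ext ?_ (Prod.ext ?_ ?_))
    · rfl
    · rfl
    · change ((lamL 0 P + (∑ i, WL 0 i ∘ₗ lamL i) P + (∑ j, dL j ∘ₗ χL j) P : Rapid N) :
        (Fin N → ℤ) → ℂ) 0 = _
      simp only [LinearMap.comp_apply, LinearMap.sum_apply, Submodule.coe_add, Pi.add_apply,
        coe_sum_rapid, hWL, hdL]
    · funext j
      change ((χL j P + (∑ i, UL i j ∘ₗ χL i) P : Rapid N) : (Fin N → ℤ) → ℂ) 0 = _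
      simp only [LinearMap.comp_apply, LinearMap.sum_apply, Submodule.coe_add, Pi.add_apply,
        coe_sum_rapid, hUL]
  -- The equations at `m ≠ 0`, and at `m = 0` those for `μ` and the second component of `λ`, hold by
  -- construction; `RL` collects exactly the remaining ones.
  have hsol : ∀ P γ, RL P = (0, 0, γ, 0) → SeqSol ω S₀ T₀ k D (gL P) (fun i => g₂L i P) γ
      (fun j => μL j P) (fun i => lamL i P) (fun j => χL j P) (pL P) := by
    intro P γ hP
    rw [hRL] at hP
    simp only [Prod.mk.injEq] at hP
    obtain ⟨h1, h2, h3, h4⟩ := hP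
    refine ⟨fun j m => ?_, fun m => ?_, fun m => ?_, fun j m => ?_, h3, fun j => congrFun h4 j⟩
    · rw [hμL]
      by_cases hm : m = 0
      · simp [hm]
      · have hf : (freq ω m : ℂ) ≠ 0 := by exact_mod_cast hω.freq_ne_zero hm
        rw [if_neg hm]
        field_simp
        ring
    · rw [hlam₀, hlam₁, ← hFL]
      by_cases hm : m = 0
      · subst hm
        simp only [freq_zero, if_true, Complex.ofReal_zero, mul_zero, zero_mul, neg_zero, zero_add,
          add_zero]
        linear_combination h2
      · have hf := hω.freq_ne_zero hm
        have hpos : ((freq ω m ^ 2 + k : ℝ) : ℂ) ≠ 0 := by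
          have : 0 < freq ω m ^ 2 := by positivity
          exact_mod_cast (by linarith : freq ω m ^ 2 + k ≠ 0)
        simp only [if_neg hm]
        have hinv := mul_inv_cancel₀ hpos
        generalize ((freq ω m ^ 2 + k : ℝ) : ℂ)⁻¹ = q at *
        push_cast at hinv
        linear_combination ((g₂L 0 P : (Fin N → ℤ) → ℂ) m - (FL 0 P : (Fin N → ℤ) → ℂ) m) *
          (hinv - (freq ω m : ℂ) ^ 2 * q * Complex.I_sq)
    · rw [hlam₀, hlam₁, ← hFL]
      by_cases hm : m = 0
      · subst hm
        simp
      · have hf := hω.freq_ne_zero hm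
        have hpos : ((freq ω m ^ 2 + k : ℝ) : ℂ) ≠ 0 := by
          have : 0 < freq ω m ^ 2 := by positivity
          exact_mod_cast (by linarith : freq ω m ^ 2 + k ≠ 0)
        simp only [if_neg hm]
        have hinv := mul_inv_cancel₀ hpos
        generalize ((freq ω m ^ 2 + k : ℝ) : ℂ)⁻¹ = q at *
        push_cast at hinv
        linear_combination ((g₂L 1 P : (Fin N → ℤ) → ℂ) m - (FL 1 P : (Fin N → ℤ) → ℂ) m) *
          (hinv - (freq ω m : ℂ) ^ 2 * q * Complex.I_sq)
    · rw [← hQL, hχL]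
      by_cases hm : m = 0
      · subst hm
        simpa using congrFun h1 j
      · have hf : (freq ω m : ℂ) ≠ 0 := by exact_mod_cast hω.freq_ne_zero hm
        rw [if_neg hm]
        have hinv := mul_inv_cancel₀ hf
        linear_combination (QL j P : (Fin N → ℤ) → ℂ) m *
          ((freq ω m : ℂ) * (freq ω m : ℂ)⁻¹ * Complex.I_sq - hinv)
  -- Parameters annihilated with zero data give a solution of the homogeneous problem. It vanishes
  -- by uniqueness, and the parameters are its mean values together with `p`.
  have hinj : Function.Injective (RL ∘ₗ LinearMap.inl ℂ (ParamSpace N) (Rapid N × (Fin 2 → Rapid N))) := by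
    rw [← LinearMap.ker_eq_bot, LinearMap.ker_eq_bot']
    intro e he
    have h := hsol (e, 0) 0 he
    obtain ⟨h1, h2, h3, h4⟩ := huniq _ _ _ _ h
    refine Prod.ext (funext fun j => ?_) (Prod.ext ?_ (Prod.ext h4 (funext fun j => ?_)))
    · have := hμL j (e, 0) 0
      rw [congrFun (h1 j) 0] at this
      simpa [xL] using this.symm
    · have := hlam₀ (e, 0) 0
      rw [congrFun (h2 0) 0] at this
      simpa [yL] using this.symm
    · have := hχL j (e, 0) 0
      rw [congrFun (h3 j) 0] at this
      simpa [zL] using this.symm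
  have hsurj := LinearMap.injective_iff_surjective.1 hinj
  -- The data with zero parameters leave a residual, which surjectivity on the finite dimensional
  -- parameter space corrects.
  let P₀ : InputSpace N := (0, ⟨g, hg⟩, fun i => ⟨g₂ i, hg₂ i⟩)
  obtain ⟨e, he⟩ := hsurj ((0, 0, γ, 0) - RL P₀)
  have hfin : RL ((e, 0) + P₀) = (0, 0, γ, 0) := by
    have he' : RL (e, 0) = (0, 0, γ, 0) - RL P₀ := he
    rw [map_add, he', sub_add_cancel]
  have h := hsol _ γ hfin
  have eg : ((gL ((e, 0) + P₀) : Rapid N) : (Fin N → ℤ) → ℂ) = g := by simp [gL, P₀]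
  have eg₂ : (fun i => ((g₂L i ((e, 0) + P₀) : Rapid N) : (Fin N → ℤ) → ℂ)) = g₂ := by
    funext i; simp [g₂L, P₀]
  rw [eg, eg₂] at h
  exact ⟨_, _, _, _, h, fun j => (μL j _).2, fun i => (lamL i _).2, fun j => (χL j _).2⟩

end existence

/-! ### Uniqueness and symmetry -/

lemma Bd.eq_zero {r a : ℝ} {c : (Fin N → ℤ) → ℂ} (h : Bd (wt r a) c 0) : c = 0 := by
  ext m
  have h1 := h.apply m
  have h2 := wt_pos r a m
  have h3 := norm_nonneg (c m)
  have : ‖c m‖ ≤ 0 := by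
    by_contra hc
    push Not at hc
    nlinarith [mul_pos h2 hc]
  simpa using this

section sub
variable {ω : Fin N → ℝ} {S₀ : Matrix (Fin N) (Fin N) ℝ} {T₀ : Matrix (Fin 2) (Fin N) ℝ}
  {k b δ : ℝ} {D : SeqCoeffs N} {g : (Fin N → ℤ) → ℂ} {g₂ : Fin 2 → (Fin N → ℤ) → ℂ} {γ : ℂ}
  {μ μ' : Fin N → (Fin N → ℤ) → ℂ} {lam lam' : Fin 2 → (Fin N → ℤ) → ℂ}
  {χ χ' : Fin N → (Fin N → ℤ) → ℂ} {p p' : ℂ}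

/-- The difference of two solutions solves the homogeneous problem. -/
lemma SeqSol.sub (hb : 0 < b) (hD : D.Small b δ)
    (h : SeqSol ω S₀ T₀ k D g g₂ γ μ lam χ p) (h' : SeqSol ω S₀ T₀ k D g g₂ γ μ' lam' χ' p')
    (hμ : ∀ j, μ j ∈ Rapid N) (hlam : ∀ i, lam i ∈ Rapid N) (hχ : ∀ j, χ j ∈ Rapid N)
    (hμ' : ∀ j, μ' j ∈ Rapid N) (hlam' : ∀ i, lam' i ∈ Rapid N) (hχ' : ∀ j, χ' j ∈ Rapid N) :
    SeqSol ω S₀ T₀ k D 0 0 0 (fun j m => μ j m - μ' j m) (fun i m => lam i m - lam' i m)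
      (fun j m => χ j m - χ' j m) (p - p') := by
  have hforce : ∀ i m, force T₀ D (fun j m => μ j m - μ' j m) (p - p') i m =
      force T₀ D μ p i m - force T₀ D μ' p' i m := by
    intro i m
    have hc := fun j => conv_sub hb (hD.T i j) (hμ j) (hμ' j) m
    simp only [force, hc, mul_sub, Finset.sum_add_distrib, Finset.sum_sub_distrib]
    ring
  have hsource : ∀ j m, source S₀ T₀ D (fun j m => μ j m - μ' j m) (fun i m => lam i m - lam' i m) j m =
      source S₀ T₀ D μ lam j m - source S₀ T₀ D μ' lam' j m := by
    intro j m
    have hc := fun l => conv_sub hb (hD.S j l) (hμ l) (hμ' l) m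
    have hc' := fun i => conv_sub hb (hD.T i j) (hlam i) (hlam' i) m
    simp only [source, hc, hc', mul_sub, Finset.sum_add_distrib, Finset.sum_sub_distrib]
    ring
  refine ⟨fun j m => ?_, fun m => ?_, fun m => ?_, fun j m => ?_, ?_, fun j => ?_⟩
  · simp only [Pi.zero_apply]
    linear_combination h.eq_μ j m - h'.eq_μ j m
  · rw [hforce]
    simp only [Pi.zero_apply]
    linear_combination h.eq_lam₀ m - h'.eq_lam₀ m
  · rw [hforce]
    simp only [Pi.zero_apply]
    linear_combination h.eq_lam₁ m - h'.eq_lam₁ m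
  · rw [hsource]
    linear_combination h.eq_χ j m - h'.eq_χ j m
  · have hc := fun i => conv_sub hb (hD.W 0 i) (hlam i) (hlam' i) 0
    have hc' := fun j => conv_sub hb (hD.dw j) (hχ j) (hχ' j) 0
    simp only [hc, hc', Finset.sum_sub_distrib]
    linear_combination h.eq_γ - h'.eq_γ
  · have hc := fun i => conv_sub hb (hD.U i j) (hχ i) (hχ' i) 0
    simp only [hc, Finset.sum_sub_distrib]
    linear_combination h.eq_V j - h'.eq_V j

end sub

open ComplexConjugate in
/-- Fourier coefficients of the complex conjugate function. -/
noncomputable def rev (c : (Fin N → ℤ) → ℂ) (m : Fin N → ℤ) : ℂ := conj (c (-m))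

lemma rev_mem_rapid {c : (Fin N → ℤ) → ℂ} (hc : c ∈ Rapid N) : rev c ∈ Rapid N := by
  intro r
  obtain ⟨B, hB⟩ := hc r
  refine ⟨B, hB.1, fun F => ?_⟩
  have := hB.2 (F.map (Equiv.neg _).toEmbedding)
  simpa [Finset.sum_map, rev, wt] using this

open ComplexConjugate in
lemma conv_rev {α : (Fin N → ℤ) → ℂ} (hα : rev α = α) (c : (Fin N → ℤ) → ℂ) (m : Fin N → ℤ) :
    conv α (rev c) m = conj (conv α c (-m)) := by
  have hα' : ∀ k, conj (α k) = α (-k) := fun k => by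
    conv_rhs => rw [← hα]
    simp [rev]
  rw [conv, conv, Complex.conj_tsum, ← (Equiv.neg (Fin N → ℤ)).tsum_eq]
  refine tsum_congr fun k => ?_
  simp only [Equiv.neg_apply, rev, map_mul, hα']
  congr 3
  abel

/-- All perturbations are real functions. -/
structure SeqCoeffs.IsReal (D : SeqCoeffs N) : Prop where
  w : rev D.w = D.w
  W : ∀ i j, rev (D.W i j) = D.W i j
  S : ∀ i j, rev (D.S i j) = D.S i j
  T : ∀ i j, rev (D.T i j) = D.T i j
  U : ∀ i j, rev (D.U i j) = D.U i j

lemma freq_neg (ω : Fin N → ℝ) (m : Fin N → ℤ) : freq ω (-m) = -freq ω m := by simp [freq]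

section rev
open ComplexConjugate
variable {ω : Fin N → ℝ} {S₀ : Matrix (Fin N) (Fin N) ℝ} {T₀ : Matrix (Fin 2) (Fin N) ℝ}
  {k : ℝ} {D : SeqCoeffs N} {g : (Fin N → ℤ) → ℂ} {g₂ : Fin 2 → (Fin N → ℤ) → ℂ} {γ : ℂ}
  {μ : Fin N → (Fin N → ℤ) → ℂ} {lam : Fin 2 → (Fin N → ℤ) → ℂ}
  {χ : Fin N → (Fin N → ℤ) → ℂ} {p : ℂ}

lemma conj_eq_of_rev {c : (Fin N → ℤ) → ℂ} (h : rev c = c) (m : Fin N → ℤ) :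
    conj (c (-m)) = c m := congrFun h m

/-- Complex conjugation maps solutions of a real problem to solutions. -/
lemma SeqSol.rev (hD : D.IsReal) (hg : TorusLinear.rev g = g) (hg₂ : ∀ i, TorusLinear.rev (g₂ i) = g₂ i)
    (hγ : conj γ = γ) (h : SeqSol ω S₀ T₀ k D g g₂ γ μ lam χ p) :
    SeqSol ω S₀ T₀ k D g g₂ γ (fun j => TorusLinear.rev (μ j)) (fun i => TorusLinear.rev (lam i))
      (fun j => TorusLinear.rev (χ j)) (conj p) := by
  have hdw : ∀ j, TorusLinear.rev (dcoef j D.w) = dcoef j D.w := by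
    intro j
    ext m
    simp [TorusLinear.rev, dcoef, conj_eq_of_rev hD.w]
  have hforce : ∀ i m, force T₀ D (fun j => TorusLinear.rev (μ j)) (conj p) i m =
      conj (force T₀ D μ p i (-m)) := by
    intro i m
    simp only [force, map_add, map_sum, map_mul, Complex.conj_ofReal, conv_rev (hD.T i _),
      conj_eq_of_rev (hD.W 0 i), neg_eq_zero]
    congr 3
    split_ifs <;> simp
  have hsource : ∀ j m, source S₀ T₀ D (fun j => TorusLinear.rev (μ j))
      (fun i => TorusLinear.rev (lam i)) j m = conj (source S₀ T₀ D μ lam j (-m)) := by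
    intro j m
    simp only [source, map_add, map_sum, map_mul, Complex.conj_ofReal, conv_rev (hD.T _ j),
      conv_rev (hD.S j _)]
    rfl
  refine ⟨fun j m => ?_, fun m => ?_, fun m => ?_, fun j m => ?_, ?_, fun j => ?_⟩
  · have := congrArg conj (h.eq_μ j (-m))
    simp only [map_mul, map_neg, map_add, Complex.conj_I, Complex.conj_ofReal, freq_neg,
      Pi.neg_apply, Int.cast_neg, Complex.ofReal_neg, conj_eq_of_rev hD.w, conj_eq_of_rev hg,
      map_intCast] at this
    simp only [TorusLinear.rev]
    linear_combination this
  · have := congrArg conj (h.eq_lam₀ (-m))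
    simp only [map_mul, map_neg, map_sub, map_add, Complex.conj_I, Complex.conj_ofReal, freq_neg,
      Complex.ofReal_neg, conj_eq_of_rev (hg₂ 0), ← hforce] at this
    simp only [TorusLinear.rev]
    linear_combination this
  · have := congrArg conj (h.eq_lam₁ (-m))
    simp only [map_mul, map_neg, map_add, Complex.conj_I, Complex.conj_ofReal, freq_neg,
      Complex.ofReal_neg, conj_eq_of_rev (hg₂ 1), ← hforce] at this
    simp only [TorusLinear.rev]
    linear_combination this
  · have := congrArg conj (h.eq_χ j (-m))
    simp only [map_mul, map_neg, map_add, Complex.conj_I, Complex.conj_ofReal, freq_neg,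
      Complex.ofReal_neg, ← hsource, map_zero] at this
    simp only [TorusLinear.rev]
    linear_combination this
  · have := congrArg conj h.eq_γ
    simp only [map_add, map_sum, hγ] at this
    simpa only [conv_rev (hD.W 0 _), conv_rev (hdw _), neg_zero, TorusLinear.rev] using this
  · have := congrArg conj (h.eq_V j)
    simp only [map_add, map_sum, map_zero] at this
    simpa only [conv_rev (hD.U _ j), neg_zero, TorusLinear.rev] using this

end rev

/-! ### Function spaces and Fourier coefficients -/

section spaces
variable {ϱ σ : ℝ} {d : ℕ} {u : CSpace N → ℂ}

lemma MemA.nice (h : MemA ϱ σ d u) : Nice (σ * ϱ) u :=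
  ⟨fun ξ hξ j => h.periodic ξ (openStrip_subset_closedStrip _ hξ) j, h.holomorphic⟩

lemma mixedDeriv_zero (J : Fin 0 → Fin N) (u : CSpace N → ℂ) : mixedDeriv J u = u := by
  ext ξ; simp [mixedDeriv]

lemma MemA.norm_le_normA (h : MemA ϱ σ d u) {ξ : CSpace N} (hξ : ξ ∈ openStrip N (σ * ϱ)) :
    ‖u ξ‖ ≤ normA ϱ σ d u :=
  le_csSup h.finite_norm ⟨0, Nat.zero_le d, Fin.elim0, ξ, hξ, by rw [mixedDeriv_zero]⟩

lemma normA_nonneg : 0 ≤ normA ϱ σ d u := by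
  refine Real.sSup_nonneg ?_
  rintro r ⟨l, _, J, ξ, _, rfl⟩
  exact norm_nonneg _

lemma exp_le_env {b M : ℝ} (hM : 0 ≤ M) (m : Fin N → ℤ) : M * Real.exp (-b * l1 m) ≤ M * env b m := by
  refine mul_le_mul_of_nonneg_left ?_ hM
  exact le_mul_of_one_le_left (Real.exp_pos _).le (by linarith [l1_nonneg m])

lemma MemA.norm_cf_le (h : MemA ϱ σ d u) (ha : 0 < σ * ϱ) (m : Fin N → ℤ) :
    ‖cf u m‖ ≤ normA ϱ σ d u * Real.exp (-(σ * ϱ) * l1 m) :=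
  h.nice.norm_cf_le ha (fun _ hξ => h.norm_le_normA hξ) m

lemma MemA.norm_cf_le_env (h : MemA ϱ σ d u) (ha : 0 < σ * ϱ) (m : Fin N → ℤ) :
    ‖cf u m‖ ≤ normA ϱ σ d u * env (σ * ϱ) m :=
  (h.norm_cf_le ha m).trans (exp_le_env normA_nonneg m)

/-- The factor `1 + l1 m` in `env` is there for this: it absorbs the derivative in `∇w₁` without
narrowing the strip. -/
lemma MemA.norm_dcoef_cf_le (h : MemA ϱ σ d u) (ha : 0 < σ * ϱ) (j : Fin N) (m : Fin N → ℤ) :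
    ‖dcoef j (cf u) m‖ ≤ normA ϱ σ d u * env (σ * ϱ) m := by
  have h1 : |(m j : ℝ)| ≤ 1 + l1 m := by
    have := Finset.single_le_sum (f := fun j => |(m j : ℝ)|) (fun _ _ => abs_nonneg _) (Finset.mem_univ j)
    simp only [l1]; linarith
  have h2 := l1_nonneg m
  rw [dcoef, norm_mul, norm_mul, Complex.norm_I, one_mul, Complex.norm_intCast, env]
  calc |(m j : ℝ)| * ‖cf u m‖ ≤ (1 + l1 m) * (normA ϱ σ d u * Real.exp (-(σ * ϱ) * l1 m)) := by
        gcongr; exact h.norm_cf_le ha m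
    _ = _ := by ring

lemma MemA.cf_mem_rapid (h : MemA ϱ σ d u) (ha : 0 < σ * ϱ) : cf u ∈ Rapid N :=
  rapid_of_env ha normA_nonneg (h.norm_cf_le_env ha)

lemma closedStrip_subset_closure {a : ℝ} (ha : 0 < a) : closedStrip N a ⊆ closure (openStrip N a) := by
  intro ξ hξ
  have ht : Filter.Tendsto (fun t : ℝ => (t : ℂ) • ξ) (nhdsWithin 1 (Iio 1)) (nhds ξ) := by
    have h : Continuous (fun t : ℝ => (t : ℂ) • ξ) := by fun_prop
    have := (h.tendsto 1).mono_left (nhdsWithin_le_nhds (s := Iio 1))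
    simpa using this
  refine mem_closure_of_tendsto ht ?_
  have h0 : ∀ᶠ t : ℝ in nhdsWithin 1 (Iio 1), 0 < t :=
    mem_nhdsWithin_of_mem_nhds (Ioi_mem_nhds one_pos)
  filter_upwards [h0, self_mem_nhdsWithin] with t h1 h2 j
  have e : (((t : ℂ) • ξ) j).im = t * (ξ j).im := by simp
  rw [e, abs_mul, abs_of_pos h1]
  have := hξ j
  have h3 : t < 1 := h2
  nlinarith [abs_nonneg (ξ j).im]

/-- Fourier coefficients determine the function on the open strip, and continuity extends the
equality to the boundary. -/
lemma MemA.eqOn_closedStrip {v : CSpace N → ℂ} (hu : MemA ϱ σ d u) (hv : MemA ϱ σ d v)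
    (ha : 0 < σ * ϱ) (h : cf u = cf v) : EqOn u v (closedStrip N (σ * ϱ)) :=
  (hu.nice.eqOn_of_cf_eq hv.nice ha (congrFun h)).of_subset_closure hu.continuous hv.continuous
    (openStrip_subset_closedStrip _) (closedStrip_subset_closure ha)

lemma memA_syn {c : (Fin N → ℤ) → ℂ} (ha : 0 < σ * ϱ) (hc : ExpSum (σ * ϱ) c) :
    MemA ϱ σ 0 (syn c) ∧ normA ϱ σ 0 (syn c) ≤ ∑' m, ‖c m‖ * Real.exp (σ * ϱ * l1 m) := by
  have hval : ∀ r ∈ derivValues ϱ σ 0 (syn c), r ≤ ∑' m, ‖c m‖ * Real.exp (σ * ϱ * l1 m) := by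
    rintro r ⟨l, hl, J, ξ, hξ, rfl⟩
    obtain rfl : l = 0 := by omega
    rw [mixedDeriv_zero]
    exact hc.norm_syn_le (openStrip_subset_closedStrip _ hξ)
  refine ⟨⟨fun ξ _ j => syn_periodic c ξ j, (nice_syn ha fun a' h => hc.mono h.le).hol,
    hc.continuousOn_syn, fun l hl J => ?_, ⟨_, hval⟩⟩, ?_⟩
  · obtain rfl : l = 0 := by omega
    exact ⟨syn c, hc.continuousOn_syn, fun ξ _ => by rw [mixedDeriv_zero]⟩
  · exact Real.sSup_le hval (tsum_nonneg fun m => by positivity)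

/-- A weighted `ℓ²` bound controls each coefficient by `B e^{-a|m|}`; the gap `a - a'` makes the
series absolutely convergent on the smaller strip. -/
lemma Bd.expSum {a a' B : ℝ} {c : (Fin N → ℤ) → ℂ} (h : Bd (wt 0 a) c B) (haa : a' < a) :
    ExpSum a' c ∧ ∑' m, ‖c m‖ * Real.exp (a' * l1 m) ≤
      (∑' m : Fin N → ℤ, Real.exp (-(a - a') * l1 m)) * B := by
  have h1 : ∀ m, ‖c m‖ ≤ B * Real.exp (-a * l1 m) := by
    intro m
    have := h.apply m
    simp only [wt, zero_div, Real.rpow_zero, one_mul] at this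
    rw [neg_mul, Real.exp_neg, ← div_eq_mul_inv, le_div_iff₀ (Real.exp_pos _), mul_comm]
    exact this
  refine ⟨ExpSum.of_le haa h1, ?_⟩
  rw [mul_comm, ← tsum_mul_left]
  refine (ExpSum.of_le haa h1).tsum_le_tsum (fun m => ?_)
    ((summable_exp_neg_l1 (sub_pos.2 haa)).mul_left B)
  calc ‖c m‖ * Real.exp (a' * l1 m) ≤ (B * Real.exp (-a * l1 m)) * Real.exp (a' * l1 m) := by
        gcongr; exact h1 m
    _ = _ := by rw [mul_assoc, ← Real.exp_add]; ring_nf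

end spaces

/-! ### Sobolev norms -/

/-- The normalization `(2π)^{N/2}` of the Fourier coefficients. -/
noncomputable def nrm (N : ℕ) : ℝ := (2 * Real.pi) ^ ((N : ℝ) / 2)

lemma nrm_pos (N : ℕ) : 0 < nrm N := Real.rpow_pos_of_pos (by positivity) _

lemma fourier_eq (u : CSpace N → ℂ) (m : Fin N → ℤ) : fourier u m = nrm N * cf u m := by
  have h2 : (0:ℝ) < 2 * Real.pi := by positivity
  have e : (2 * Real.pi) ^ (-(N : ℝ) / 2) = nrm N * ((2 * Real.pi) ^ N)⁻¹ := by
    rw [nrm, ← Real.rpow_natCast, ← Real.rpow_neg h2.le, ← Real.rpow_add h2]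
    congr 1
    ring
  rw [fourier, cf, avgCoef, avg, e, Complex.ofReal_mul, mul_assoc]
  congr 3
  ext x
  simp [ex, toC]

lemma sobolev_term (s : ℝ) (u : CSpace N → ℂ) (m : Fin N → ℤ) :
    (1 + sqLen m) ^ s * ‖fourier u m‖ ^ 2 = nrm N ^ 2 * (wt s 0 m * ‖cf u m‖) ^ 2 := by
  have hs := one_add_sqLen_pos m
  have e : (1 + sqLen m) ^ s = ((1 + sqLen m) ^ (s / 2)) ^ 2 := by
    rw [← Real.rpow_natCast, ← Real.rpow_mul hs.le]; congr 1; push_cast; ring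
  rw [fourier_eq, norm_mul, Complex.norm_real, Real.norm_of_nonneg (nrm_pos N).le, e, wt]
  simp
  ring

lemma sobolev_le {s B : ℝ} {u : CSpace N → ℂ} (h : Bd (wt s 0) (cf u) B) :
    MemSobolev s u ∧ sobolev s u ≤ nrm N * B := by
  have h1 : ∀ F : Finset (Fin N → ℤ), ∑ m ∈ F, (1 + sqLen m) ^ s * ‖fourier u m‖ ^ 2
      ≤ (nrm N * B) ^ 2 := by
    intro F
    simp only [sobolev_term, ← Finset.mul_sum]
    rw [mul_pow]
    exact mul_le_mul_of_nonneg_left (h.2 F) (sq_nonneg _)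
  have h0 : ∀ m : Fin N → ℤ, 0 ≤ (1 + sqLen m) ^ s * ‖fourier u m‖ ^ 2 := fun m => by
    rw [sobolev_term]; positivity
  have hs := summable_of_sum_le h0 h1
  refine ⟨hs, Real.sqrt_le_iff.2 ⟨mul_nonneg (nrm_pos N).le h.1, ?_⟩⟩
  exact hs.tsum_le_of_sum_le h1

/-- Rapid decay guarantees convergence of the series in `sobolev`, whose value would otherwise
default to `0` and bound nothing. -/
lemma bd_sobolev {u : CSpace N → ℂ} (h : cf u ∈ Rapid N) (s : ℝ) :
    Bd (wt s 0) (cf u) ((nrm N)⁻¹ * sobolev s u) := by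
  obtain ⟨B, hB⟩ := h s
  have hs := (sobolev_le hB).1
  have hn := nrm_pos N
  refine ⟨mul_nonneg (inv_nonneg.2 hn.le) (Real.sqrt_nonneg _), fun F => ?_⟩
  have h0 : ∀ m : Fin N → ℤ, 0 ≤ (1 + sqLen m) ^ s * ‖fourier u m‖ ^ 2 := fun m => by
    rw [sobolev_term]; positivity
  have h1 := hs.sum_le_tsum F fun m _ => h0 m
  simp only [sobolev_term, ← Finset.mul_sum] at h1
  rw [mul_pow, sobolev, Real.sq_sqrt (tsum_nonneg h0), inv_pow, le_inv_mul_iff₀ (by positivity)]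
  simpa only [sobolev_term] using h1

/-! ### Real functions -/

section real
open ComplexConjugate

lemma conj_ex_toC (m : Fin N → ℤ) (x : Fin N → ℝ) : conj (ex m (toC x)) = ex (-m) (toC x) := by
  simp [ex, toC, ← Complex.exp_conj, map_sum]

lemma rev_cf_of_isRealFun {u : CSpace N → ℂ} (hu : IsRealFun u) : rev (cf u) = cf u := by
  ext m
  simp only [rev, cf, avgCoef, avg, map_mul, Complex.conj_ofReal, neg_neg]
  rw [← integral_conj]
  congr 2
  ext x
  rw [map_mul, conj_ex_toC, Complex.conj_eq_iff_im.2 (hu x)]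

lemma isRealFun_syn {c : (Fin N → ℤ) → ℂ} (hc : rev c = c) : IsRealFun (syn c) := by
  intro x
  rw [← Complex.conj_eq_iff_im, syn, Complex.conj_tsum, ← (Equiv.neg (Fin N → ℤ)).tsum_eq]
  refine tsum_congr fun m => ?_
  rw [map_mul, conj_ex_toC]
  simp only [Equiv.neg_apply, neg_neg]
  rw [conj_eq_of_rev hc]

end real

/-! ### From functions to Fourier coefficients -/

/-- `u` is periodic and holomorphic on the open strip of half-width `a`, with Fourier
coefficients `c`. -/
structure HasCf (a : ℝ) (u : CSpace N → ℂ) (c : (Fin N → ℤ) → ℂ) : Prop where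
  nice : Nice a u
  cf_eq : ∀ m, cf u m = c m

section hasCf
variable {a : ℝ} {u v : CSpace N → ℂ} {c d : (Fin N → ℤ) → ℂ}

lemma HasCf.congr (hu : HasCf a u c) (huv : ∀ ξ, u ξ = v ξ) (hcd : ∀ m, c m = d m) :
    HasCf a v d := by
  rwa [← funext huv, ← funext hcd]

lemma HasCf.add (hu : HasCf a u c) (hv : HasCf a v d) (ha : 0 < a) :
    HasCf a (fun ξ => u ξ + v ξ) (fun m => c m + d m) :=
  ⟨hu.nice.add hv.nice, fun m => by rw [hu.nice.cf_add hv.nice ha, hu.cf_eq, hv.cf_eq]⟩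

lemma HasCf.const_mul (hu : HasCf a u c) (z : ℂ) :
    HasCf a (fun ξ => z * u ξ) (fun m => z * c m) :=
  ⟨(Nice.const z).mul hu.nice, fun m => by rw [cf_const_mul, hu.cf_eq]⟩

lemma HasCf.neg (hu : HasCf a u c) : HasCf a (fun ξ => -u ξ) (fun m => -c m) := by
  simpa only [neg_one_mul] using hu.const_mul (-1)

lemma HasCf.sub (hu : HasCf a u c) (hv : HasCf a v d) (ha : 0 < a) :
    HasCf a (fun ξ => u ξ - v ξ) (fun m => c m - d m) := by
  simpa only [sub_eq_add_neg] using hu.add hv.neg ha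

lemma HasCf.sum {ι : Type*} [Fintype ι] {u : ι → CSpace N → ℂ} {c : ι → (Fin N → ℤ) → ℂ}
    (hu : ∀ i, HasCf a (u i) (c i)) (ha : 0 < a) :
    HasCf a (fun ξ => ∑ i, u i ξ) (fun m => ∑ i, c i m) :=
  ⟨Nice.sum fun i _ => (hu i).nice, fun m => by
    rw [Nice.cf_sum _ (fun i _ => (hu i).nice) ha]
    exact Finset.sum_congr rfl fun i _ => (hu i).cf_eq m⟩

lemma HasCf.mul (hu : HasCf a u c) (hv : HasCf a v d) (ha : 0 < a) :
    HasCf a (fun ξ => u ξ * v ξ) (fun m => conv c d m) :=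
  ⟨hu.nice.mul hv.nice, fun m => by
    rw [hu.nice.cf_mul hv.nice ha, funext hu.cf_eq, funext hv.cf_eq]⟩

lemma HasCf.pderiv (hu : HasCf a u c) (ha : 0 < a) (j : Fin N) :
    HasCf a (fun ξ => pderiv j u ξ) (fun m => dcoef j c m) :=
  ⟨hu.nice.pderiv ha j, fun m => by
    rw [hu.nice.cf_pderiv ha, hu.cf_eq, dcoef]⟩

lemma HasCf.mean_eq (hu : HasCf a u c) : mean u = c 0 := by rw [mean_eq_cf, hu.cf_eq]

/-- The dictionary entry: an identity of functions on the strip is an identity of their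
coefficients. -/
lemma HasCf.eqOn_iff (hu : HasCf a u c) (hv : HasCf a v d) (ha : 0 < a) :
    (∀ ξ ∈ openStrip N a, u ξ = v ξ) ↔ ∀ m, c m = d m := by
  constructor
  · intro h m
    rw [← hu.cf_eq, ← hv.cf_eq, Nice.cf_congr ha h]
  · intro h
    exact hu.nice.eqOn_of_cf_eq hv.nice ha fun m => by rw [hu.cf_eq, hv.cf_eq, h]

lemma HasCf.dOmega {r : ℕ} {u : CSpace N → Fin r → ℂ} {c : Fin r → (Fin N → ℤ) → ℂ} {i : Fin r}
    (hu : HasCf a (fun ξ => u ξ i) (c i)) (ha : 0 < a) (ω : Fin N → ℝ) :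
    HasCf a (fun ξ => dOmega ω u ξ i) (fun m => Complex.I * freq ω m * c i m) := by
  have h := HasCf.sum (fun j => (hu.pderiv ha j).const_mul (ω j : ℂ)) ha
  refine ⟨h.nice, fun m => (h.cf_eq m).trans ?_⟩
  simp only [dcoef, freq, Complex.ofReal_sum, Finset.mul_sum, Finset.sum_mul, Complex.ofReal_mul,
    Complex.ofReal_intCast]
  exact Finset.sum_congr rfl fun j _ => by ring

end hasCf

/-- Fourier coefficients of the perturbations of the coefficients. -/
noncomputable def Coeffs.seq (K : Coeffs N) (α : ℝ) (H₀ : (Fin N → ℝ) × ℝ → ℝ) : SeqCoeffs N where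
  w := cf (fun ξ => K.w₁ ξ - (α : ℂ))
  W i j := cf (fun ξ => (K.W ξ - 1) i j)
  S i j := cf (fun ξ => (K.S ξ - (hessS H₀).map Complex.ofReal) i j)
  T i j := cf (fun ξ => (K.T ξ - (matT H₀).map Complex.ofReal) i j)
  U i j := cf (fun ξ => ((K.V ξ)⁻¹ - 1) i j)

section translation
variable {ϱ σ : ℝ} {d : ℕ} {H₀ : (Fin N → ℝ) × ℝ → ℝ} {α δ : ℝ} {K : Coeffs N}

lemma normA_le_normAMat {r t : ℕ} (A : CSpace N → Matrix (Fin r) (Fin t) ℂ) (i : Fin r) (j : Fin t) :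
    normA ϱ σ d (fun ξ => A ξ i j) ≤ normAMat ϱ σ d A :=
  (Finset.single_le_sum (f := fun j => normA ϱ σ d (fun ξ => A ξ i j)) (fun _ _ => normA_nonneg)
    (Finset.mem_univ j)).trans
  (Finset.single_le_sum (f := fun i => ∑ j, normA ϱ σ d (fun ξ => A ξ i j))
    (fun _ _ => Finset.sum_nonneg fun _ _ => normA_nonneg) (Finset.mem_univ i))

lemma normAMat_nonneg {r t : ℕ} (A : CSpace N → Matrix (Fin r) (Fin t) ℂ) :
    0 ≤ normAMat ϱ σ d A :=
  Finset.sum_nonneg fun _ _ => Finset.sum_nonneg fun _ _ => normA_nonneg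

lemma Coeffs.Admissible.nonneg (h : K.Admissible ϱ σ d H₀ α δ) : 0 ≤ δ :=
  (add_nonneg (normAMat_nonneg _) (normAMat_nonneg _)).trans h.bound₂

lemma Coeffs.Admissible.small (h : K.Admissible ϱ σ d H₀ α δ) (ha : 0 < σ / 2 * ϱ) :
    (K.seq α H₀).Small (σ / 2 * ϱ) δ := by
  have key : ∀ {d : ℕ} {u : CSpace N → ℂ}, MemA ϱ (σ / 2) d u → normA ϱ (σ / 2) d u ≤ δ →
      ∀ m, ‖cf u m‖ ≤ δ * env (σ / 2 * ϱ) m := fun hu hd m =>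
    (hu.norm_cf_le_env ha m).trans (mul_le_mul_of_nonneg_right hd (env_pos _ _).le)
  have b₁ := h.bound₁
  have b₂ := h.bound₂
  have n₁ := normAMat_nonneg (ϱ := ϱ) (σ := σ / 2) (d := 0) (fun ξ => (K.V ξ)⁻¹ - 1)
  have n₂ := normA_nonneg (ϱ := ϱ) (σ := σ / 2) (d := d) (u := fun ξ => K.w₁ ξ - (α : ℂ))
  have n₃ := normAMat_nonneg (ϱ := ϱ) (σ := σ / 2) (d := d) (fun ξ => K.W ξ - 1)
  have n₄ := normAMat_nonneg (ϱ := ϱ) (σ := σ / 2) (d := d - 1)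
    (fun ξ => K.S ξ - (hessS H₀).map Complex.ofReal)
  have n₅ := normAMat_nonneg (ϱ := ϱ) (σ := σ / 2) (d := d - 1)
    (fun ξ => K.T ξ - (matT H₀).map Complex.ofReal)
  refine ⟨key h.mem_w₁ (by linarith), fun j m => ?_,
    fun i j => key (h.mem_W i j) ((normA_le_normAMat (fun ξ => K.W ξ - 1) i j).trans (by linarith)),
    fun i j => key (h.mem_S i j) ((normA_le_normAMat
      (fun ξ => K.S ξ - (hessS H₀).map Complex.ofReal) i j).trans (by linarith)),
    fun i j => key (h.mem_T i j) ((normA_le_normAMat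
      (fun ξ => K.T ξ - (matT H₀).map Complex.ofReal) i j).trans (by linarith)),
    fun i j => key (h.mem_V i j) ((normA_le_normAMat (fun ξ => (K.V ξ)⁻¹ - 1) i j).trans
      (by linarith))⟩
  exact (h.mem_w₁.norm_dcoef_cf_le ha j m).trans
    (mul_le_mul_of_nonneg_right (by linarith) (env_pos _ _).le)

/-- At real points transpose and conjugate transpose of `A` agree, and both commute with the matrix
inverse. -/
lemma isRealFun_inv {A : CSpace N → Matrix (Fin N) (Fin N) ℂ}
    (hA : ∀ i j, IsRealFun (fun ξ => A ξ i j)) (i j : Fin N) :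
    IsRealFun (fun ξ => (A ξ)⁻¹ i j) := by
  intro x
  have h : (A (toC x)).conjTranspose = (A (toC x)).transpose := by
    ext i j
    exact Complex.conj_eq_iff_im.2 (hA j i x)
  have h2 := Matrix.conjTranspose_nonsing_inv (A (toC x))
  rw [h, ← Matrix.transpose_nonsing_inv] at h2
  exact Complex.conj_eq_iff_im.1 (congrFun (congrFun h2 j) i)

lemma Coeffs.IsReal.seq (h : K.IsReal) : (K.seq α H₀).IsReal := by
  have hone : ∀ {M : ℕ} (i j : Fin M), ((1 : Matrix (Fin M) (Fin M) ℂ) i j).im = 0 := by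
    intro M i j
    by_cases hij : i = j <;> simp [Matrix.one_apply, hij]
  refine ⟨rev_cf_of_isRealFun fun x => ?_, fun i j => rev_cf_of_isRealFun fun x => ?_,
    fun i j => rev_cf_of_isRealFun fun x => ?_, fun i j => rev_cf_of_isRealFun fun x => ?_,
    fun i j => rev_cf_of_isRealFun fun x => ?_⟩
  · simpa using h.w₁ x
  · simpa [hone] using h.W i j x
  · simpa using h.S i j x
  · simpa using h.T i j x
  · simpa [hone] using isRealFun_inv h.V i j x

/-- All terms are periodic and holomorphic on the quarter strip, so each equation can be compared
coefficient by coefficient; products become convolutions, and mean values become coefficients at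
`0`. -/
lemma isSolution_iff {ω : Fin N → ℝ} {k : ℝ} {g₁ : CSpace N → ℂ} {g₂ : CSpace N → Fin 2 → ℂ}
    {γ : ℂ} {μ χ : CSpace N → Fin N → ℂ} {lam : CSpace N → Fin 2 → ℂ} {p : ℂ}
    (ha : 0 < σ * ϱ) (hK : K.Admissible ϱ σ d H₀ α δ)
    (hg₁ : MemA ϱ (σ / 2) 0 g₁) (hg₂ : MemAVec ϱ (σ / 2) 0 g₂)
    (hμ : MemAVec ϱ (σ / 4) 0 μ) (hlam : MemAVec ϱ (σ / 4) 0 lam) (hχ : MemAVec ϱ (σ / 4) 0 χ) :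
    IsSolution ϱ σ ω k K g₁ g₂ γ μ lam χ p ↔
    SeqSol ω (hessS H₀) (matT H₀) k (K.seq α H₀) (cf g₁) (fun i => cf fun ξ => g₂ ξ i) γ
      (fun j => cf fun ξ => μ ξ j) (fun i => cf fun ξ => lam ξ i) (fun j => cf fun ξ => χ ξ j) p := by
  have ha4 : 0 < σ / 4 * ϱ := by linarith
  have h42 : σ / 4 * ϱ ≤ σ / 2 * ϱ := by linarith
  have up : ∀ {d : ℕ} {u : CSpace N → ℂ}, MemA ϱ (σ / 2) d u → HasCf (σ / 4 * ϱ) u (cf u) :=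
    fun hu => ⟨hu.nice.mono h42, fun _ => rfl⟩
  have id4 : ∀ {u : CSpace N → ℂ}, MemA ϱ (σ / 4) 0 u → HasCf (σ / 4 * ϱ) u (cf u) :=
    fun hu => ⟨hu.nice, fun _ => rfl⟩
  -- The constant `α` disappears under the gradient; hence no estimate depends on it.
  have hw : ∀ j, HasCf (σ / 4 * ϱ) (fun ξ => pderiv j K.w₁ ξ) (fun m => dcoef j (K.seq α H₀).w m) := by
    intro j
    have h := (up hK.mem_w₁).pderiv ha4 j
    have e : (fun ξ => pderiv j (fun ξ => K.w₁ ξ - (α : ℂ)) ξ) = fun ξ => pderiv j K.w₁ ξ := by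
      ext ξ
      simp only [pderiv, fderiv_sub_const]
    rwa [e] at h
  -- entries of the matrices applied to a function
  have hmul : ∀ {A B u : CSpace N → ℂ} {z : ℂ} {c b : (Fin N → ℤ) → ℂ}, HasCf (σ / 4 * ϱ) B b →
      HasCf (σ / 4 * ϱ) u c → (∀ ξ, A ξ = z + B ξ) →
      HasCf (σ / 4 * ϱ) (fun ξ => A ξ * u ξ) (fun m => z * c m + conv b c m) := by
    intro A B u z c b hB hu hA
    have h := (hu.const_mul z).add (hB.mul hu ha4) ha4
    simpa only [hA, add_mul] using h
  have hT : ∀ i j {u : CSpace N → ℂ} {c : (Fin N → ℤ) → ℂ}, HasCf (σ / 4 * ϱ) u c →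
      HasCf (σ / 4 * ϱ) (fun ξ => K.T ξ i j * u ξ)
        (fun m => (matT H₀ i j : ℂ) * c m + conv ((K.seq α H₀).T i j) c m) := fun i j _ _ hu =>
    hmul (up (hK.mem_T i j)) hu fun ξ => by simp
  have hS : ∀ i j {u : CSpace N → ℂ} {c : (Fin N → ℤ) → ℂ}, HasCf (σ / 4 * ϱ) u c →
      HasCf (σ / 4 * ϱ) (fun ξ => K.S ξ i j * u ξ)
        (fun m => (hessS H₀ i j : ℂ) * c m + conv ((K.seq α H₀).S i j) c m) := fun i j _ _ hu =>
    hmul (up (hK.mem_S i j)) hu fun ξ => by simp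
  have hW : ∀ i j {u : CSpace N → ℂ} {c : (Fin N → ℤ) → ℂ}, HasCf (σ / 4 * ϱ) u c →
      HasCf (σ / 4 * ϱ) (fun ξ => K.W ξ i j * u ξ)
        (fun m => (1 : Matrix (Fin 2) (Fin 2) ℂ) i j * c m + conv ((K.seq α H₀).W i j) c m) :=
    fun i j _ _ hu => hmul (up (hK.mem_W i j)) hu fun ξ => by simp
  have hV : ∀ i j {u : CSpace N → ℂ} {c : (Fin N → ℤ) → ℂ}, HasCf (σ / 4 * ϱ) u c →
      HasCf (σ / 4 * ϱ) (fun ξ => (K.V ξ)⁻¹ i j * u ξ)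
        (fun m => (1 : Matrix (Fin N) (Fin N) ℂ) i j * c m + conv ((K.seq α H₀).U i j) c m) :=
    fun i j _ _ hu => hmul (up (hK.mem_V i j)) hu fun ξ => by simp
  have hforce : ∀ i, HasCf (σ / 4 * ϱ) (fun ξ => ∑ j, K.T ξ i j * μ ξ j + p * K.W ξ 0 i)
      (force (matT H₀) (K.seq α H₀) (fun j => cf fun ξ => μ ξ j) p i) := by
    intro i
    have h1 : HasCf (σ / 4 * ϱ) (fun _ : CSpace N => (1 : ℂ)) (fun m => if m = 0 then 1 else 0) :=
      ⟨Nice.const 1, cf_one⟩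
    refine ((HasCf.sum (fun j => hT i j (id4 (hμ j))) ha4).add
      (((h1.const_mul (if i = 0 then 1 else 0)).add (up (hK.mem_W 0 i)) ha4).const_mul p)
      ha4).congr (fun ξ => ?_) (fun m => ?_)
    · by_cases hi : i = 0 <;> simp [hi, eq_comm]
    · by_cases hi : i = 0 <;> by_cases hm : m = 0 <;> simp [force, hi, hm, Coeffs.seq]
  have hsource : ∀ j, HasCf (σ / 4 * ϱ) (fun ξ => ∑ l, K.S ξ j l * μ ξ l + ∑ i, K.T ξ i j * lam ξ i)
      (source (hessS H₀) (matT H₀) (K.seq α H₀) (fun j => cf fun ξ => μ ξ j)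
        (fun i => cf fun ξ => lam ξ i) j) := fun j =>
    (HasCf.sum (fun l => hS j l (id4 (hμ l))) ha4).add
      (HasCf.sum (fun i => hT i j (id4 (hlam i))) ha4) ha4
  have e_μ : (∀ ξ ∈ openStrip N (σ / 4 * ϱ), dOmega ω μ ξ = -(p • grad K.w₁ ξ) - grad g₁ ξ) ↔
      ∀ j m, Complex.I * freq ω m * cf (fun ξ => μ ξ j) m =
        -(Complex.I * m j * (p * (K.seq α H₀).w m + cf g₁ m)) := by
    have h := fun j => ((id4 (hμ j)).dOmega (c := fun j => cf fun ξ => μ ξ j) ha4 ω).eqOn_iff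
      (((hw j).const_mul p).neg.sub ((up hg₁).pderiv ha4 j) ha4) ha4
    simp only [funext_iff, grad, Pi.sub_apply, Pi.neg_apply, Pi.smul_apply, smul_eq_mul]
    refine ⟨fun H j m => ((h j).1 (fun ξ hξ => H ξ hξ j) m).trans ?_,
      fun H ξ hξ j => (h j).2 (fun m => (H j m).trans ?_) ξ hξ⟩ <;> simp only [dcoef] <;> ring
  have e_lam : (∀ ξ ∈ openStrip N (σ / 4 * ϱ), matJ.mulVec (dOmega ω lam ξ) +
      (matOmega k).mulVec (lam ξ) + (K.T ξ).mulVec (μ ξ) + p • ((K.W ξ).transpose.mulVec e1) = g₂ ξ) ↔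
      (∀ m, Complex.I * freq ω m * cf (fun ξ => lam ξ 1) m - k * cf (fun ξ => lam ξ 0) m +
        force (matT H₀) (K.seq α H₀) (fun j => cf fun ξ => μ ξ j) p 0 m = cf (fun ξ => g₂ ξ 0) m) ∧
      (∀ m, -(Complex.I * freq ω m * cf (fun ξ => lam ξ 0) m) + cf (fun ξ => lam ξ 1) m +
        force (matT H₀) (K.seq α H₀) (fun j => cf fun ξ => μ ξ j) p 1 m = cf (fun ξ => g₂ ξ 1) m) := by
    have hd := fun i => (id4 (hlam i)).dOmega (c := fun j => cf fun ξ => lam ξ j) ha4 ω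
    rw [← (((hd 1).sub ((id4 (hlam 0)).const_mul k) ha4).add (hforce 0) ha4).eqOn_iff
        (up (hg₂ 0)) ha4,
      ← (((hd 0).neg.add (id4 (hlam 1)) ha4).add (hforce 1) ha4).eqOn_iff (up (hg₂ 1)) ha4,
      ← forall₂_and]
    refine forall₂_congr fun ξ _ => ?_
    rw [funext_iff, Fin.forall_fin_two]
    simp [matJ, matOmega, e1, Matrix.mulVec, dotProduct, Fin.sum_univ_two, add_assoc,
      sub_eq_add_neg, Matrix.vecHead, Matrix.vecTail]
  have e_χ : (∀ ξ ∈ openStrip N (σ / 4 * ϱ), -dOmega ω χ ξ + (K.S ξ).mulVec (μ ξ) +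
      (K.T ξ).transpose.mulVec (lam ξ) = 0) ↔
      ∀ j m, -(Complex.I * freq ω m * cf (fun ξ => χ ξ j) m) +
        source (hessS H₀) (matT H₀) (K.seq α H₀) (fun j => cf fun ξ => μ ξ j)
        (fun i => cf fun ξ => lam ξ i) j m = 0 := by
    have h0 : HasCf (σ / 4 * ϱ) (fun _ : CSpace N => (0 : ℂ)) (fun _ => 0) :=
      ⟨Nice.const 0, fun m => by simpa using cf_const_mul (N := N) 0 (fun _ => 0) m⟩
    have h := fun j => (((id4 (hχ j)).dOmega (c := fun j => cf fun ξ => χ ξ j) ha4 ω).neg.add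
      (hsource j) ha4).eqOn_iff h0 ha4
    simp only [← h, funext_iff]
    refine ⟨fun H j ξ hξ => ?_, fun H ξ hξ j => ?_⟩
    · simpa [Matrix.mulVec, dotProduct, add_assoc] using H ξ hξ j
    · simpa [Matrix.mulVec, dotProduct, add_assoc] using H j ξ hξ
  have e_γ : mean (fun ξ => dotProduct ((K.W ξ).mulVec (lam ξ)) e1) +
      mean (fun ξ => dotProduct (χ ξ) (grad K.w₁ ξ)) =
      cf (fun ξ => lam ξ 0) 0 + ∑ i, conv ((K.seq α H₀).W 0 i) (cf fun ξ => lam ξ i) 0 +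
        ∑ j, conv (dcoef j (K.seq α H₀).w) (cf fun ξ => χ ξ j) 0 := by
    have h1 := (HasCf.sum (fun i => hW 0 i (id4 (hlam i))) ha4).mean_eq
    have h2 := (HasCf.sum (fun j => (hw j).mul (id4 (hχ j)) ha4) ha4).mean_eq
    have h3 : (fun ξ => dotProduct ((K.W ξ).mulVec (lam ξ)) e1) =
        fun ξ => ∑ i, K.W ξ 0 i * lam ξ i := by
      ext ξ; simp [e1, Matrix.mulVec, dotProduct, Fin.sum_univ_two]
    have h4 : (fun ξ => dotProduct (χ ξ) (grad K.w₁ ξ)) =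
        fun ξ => ∑ j, pderiv j K.w₁ ξ * χ ξ j := by
      ext ξ; simp only [dotProduct, grad, mul_comm]
    rw [h3, h4, h1, h2, Finset.sum_add_distrib]
    simp [Matrix.one_apply]
  have e_V : meanVec (fun ξ => ((K.V ξ)⁻¹).transpose.mulVec (χ ξ)) = 0 ↔
      ∀ j, cf (fun ξ => χ ξ j) 0 + ∑ i, conv ((K.seq α H₀).U i j) (cf fun ξ => χ ξ i) 0 = 0 := by
    rw [funext_iff]
    refine forall_congr' fun j => ?_
    have h1 := (HasCf.sum (fun i => hV i j (id4 (hχ i))) ha4).mean_eq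
    have h3 : (fun ξ => ((K.V ξ)⁻¹).transpose.mulVec (χ ξ) j) =
        fun ξ => ∑ i, (K.V ξ)⁻¹ i j * χ ξ i := by
      ext ξ; simp [Matrix.mulVec, dotProduct]
    rw [meanVec, h3, h1, Finset.sum_add_distrib]
    simp [Matrix.one_apply]
  constructor
  · intro h
    exact ⟨e_μ.1 h.eq_μ, (e_lam.1 h.eq_lam).1, (e_lam.1 h.eq_lam).2, e_χ.1 h.eq_χ,
      e_γ.symm.trans h.mean_γ, e_V.1 h.mean_χ⟩
  · intro h
    exact ⟨hμ, hlam, hχ, e_μ.2 h.eq_μ, e_lam.2 ⟨h.eq_lam₀, h.eq_lam₁⟩, e_χ.2 h.eq_χ,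
      e_γ.trans h.eq_γ, e_V.2 h.eq_V⟩

end translation

/-! ### Solution of the linear problem -/

/-- The a priori estimate for the sequences of Fourier coefficients, with loss of `q - r`
derivatives. -/
def AprioriBound (ω : Fin N → ℝ) (S₀ : Matrix (Fin N) (Fin N) ℝ) (T₀ : Matrix (Fin 2) (Fin N) ℝ)
    (k : ℝ) (D : SeqCoeffs N) (δ q r a A : ℝ) : Prop :=
  ∀ g g₂ γ μ lam χ p, SeqSol ω S₀ T₀ k D g g₂ γ μ lam χ p →
    ∀ (G₁ : ℝ) (G₂ : Fin 2 → ℝ), Bd (wt q a) g G₁ → (∀ i, Bd (wt q a) (g₂ i) (G₂ i)) →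
    (∀ j, Bd (wt r a) (μ j) (A * (G₁ + ∑ i, G₂ i + ‖γ‖))) ∧
    (∀ i, Bd (wt r a) (lam i) (A * (G₁ + ∑ i, G₂ i + ‖γ‖))) ∧
    (∀ j, Bd (wt r a) (χ j) (A * (G₁ + ∑ i, G₂ i + ‖γ‖))) ∧
    ‖p‖ ≤ A * (G₁ + ∑ i, G₂ i + ‖γ‖) ∧
    ∑ j, ‖μ j 0‖ ≤ A * ∑ i, ‖g₂ i 0‖ + δ * (A * (G₁ + ∑ i, G₂ i + ‖γ‖))

lemma AprioriBound.eq_zero {ω : Fin N → ℝ} {S₀ : Matrix (Fin N) (Fin N) ℝ}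
    {T₀ : Matrix (Fin 2) (Fin N) ℝ} {k : ℝ} {D : SeqCoeffs N} {δ q r a A : ℝ}
    (h : AprioriBound ω S₀ T₀ k D δ q r a A) (μ : Fin N → (Fin N → ℤ) → ℂ)
    (lam : Fin 2 → (Fin N → ℤ) → ℂ) (χ : Fin N → (Fin N → ℤ) → ℂ) (p : ℂ)
    (hs : SeqSol ω S₀ T₀ k D 0 0 0 μ lam χ p) :
    (∀ j, μ j = 0) ∧ (∀ i, lam i = 0) ∧ (∀ j, χ j = 0) ∧ p = 0 := by
  obtain ⟨h1, h2, h3, h4, -⟩ := h _ _ _ _ _ _ _ hs 0 (fun _ => 0) Bd.zero (fun _ => Bd.zero)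
  simp only [Finset.sum_const_zero, norm_zero, add_zero, mul_zero] at h1 h2 h3 h4
  exact ⟨fun j => (h1 j).eq_zero, fun j => (h2 j).eq_zero, fun j => (h3 j).eq_zero,
    norm_le_zero_iff.1 h4⟩

lemma sum_le_card_mul {r : ℕ} {f : Fin r → ℝ} {B : ℝ} (h : ∀ i, f i ≤ B) : ∑ i, f i ≤ r * B := by
  simpa using Finset.sum_le_card_nsmul Finset.univ f B fun i _ => h i

/-- Two a priori bounds are applied to one sequence solution. The width `3σϱ/8` lies strictly
between the `σϱ/4` of the solution and the `σϱ/2` of the data: the upper gap pays for multiplication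
by the coefficients, the lower one for passing from `ℓ²` to sup norms. The factor `2N + 2` counts
the components of `μ`, `λ`, `χ`. -/
theorem Coeffs.Admissible.exists_solution {n : ℕ} {c₀ ϱ σ k α δ s A₁ A₂ : ℝ} {ω : Fin N → ℝ}
    (hω : Diophantine n c₀ ω) {H₀ : (Fin N → ℝ) × ℝ → ℝ} {d : ℕ} {K : Coeffs N}
    (ha : 0 < σ * ϱ) (hk : 0 ≤ k) (hK : K.Admissible ϱ σ d H₀ α δ)
    (h₁ : AprioriBound ω (hessS H₀) (matT H₀) k (K.seq α H₀) δ (s + 4 * n + 6) s 0 A₁)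
    (h₂ : AprioriBound ω (hessS H₀) (matT H₀) k (K.seq α H₀) δ (0 + 4 * n + 6) 0
      (3 / 8 * (σ * ϱ)) A₂)
    {g₁ : CSpace N → ℂ} {g₂ : CSpace N → Fin 2 → ℂ} (γ : ℂ)
    (hg₁ : MemA ϱ (σ / 2) 0 g₁) (hg₂ : MemAVec ϱ (σ / 2) 0 g₂) {X₁ X₂ : ℝ}
    (hX₁ : X₁ = A₁ * ((nrm N)⁻¹ * sobolev (s + 4 * n + 6) g₁ +
      ∑ i, (nrm N)⁻¹ * sobolev (s + 4 * n + 6) (fun ξ => g₂ ξ i) + ‖γ‖))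
    (hX₂ : X₂ = A₂ * (normA ϱ (σ / 2) 0 g₁ * kc N (0 + 4 * n + 6) (3 / 8 * (σ * ϱ)) (σ / 2 * ϱ) +
      ∑ i, normA ϱ (σ / 2) 0 (fun ξ => g₂ ξ i) *
        kc N (0 + 4 * n + 6) (3 / 8 * (σ * ϱ)) (σ / 2 * ϱ) + ‖γ‖)) :
    ∃ (μ : CSpace N → Fin N → ℂ) (lam : CSpace N → Fin 2 → ℂ) (χ : CSpace N → Fin N → ℂ) (p : ℂ),
      IsSolution ϱ σ ω k K g₁ g₂ γ μ lam χ p ∧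
      (∀ μ' lam' χ' p', IsSolution ϱ σ ω k K g₁ g₂ γ μ' lam' χ' p' →
        EqOn μ' μ (closedStrip N (σ / 4 * ϱ)) ∧ EqOn lam' lam (closedStrip N (σ / 4 * ϱ)) ∧
        EqOn χ' χ (closedStrip N (σ / 4 * ϱ)) ∧ p' = p) ∧
      (K.IsReal → IsRealFun g₁ → (∀ i, IsRealFun (fun ξ => g₂ ξ i)) → γ.im = 0 →
        (∀ i, IsRealFun (fun ξ => μ ξ i)) ∧ (∀ i, IsRealFun (fun ξ => lam ξ i)) ∧
        (∀ i, IsRealFun (fun ξ => χ ξ i)) ∧ p.im = 0) ∧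
      (normAVec ϱ (σ / 4) 0 μ + normAVec ϱ (σ / 4) 0 lam + normAVec ϱ (σ / 4) 0 χ + ‖p‖ ≤
        (2 * N + 2) * ((∑' m : Fin N → ℤ,
          Real.exp (-(3 / 8 * (σ * ϱ) - σ / 4 * ϱ) * l1 m)) * X₂) + X₂) ∧
      (MemSobolevVec s μ ∧ MemSobolevVec s lam ∧ MemSobolevVec s χ ∧
        sobolevVec s μ + sobolevVec s lam + sobolevVec s χ + ‖p‖ ≤
          (2 * N + 2) * (nrm N * X₁) + X₁) ∧
      absVec (meanVec μ) ≤ A₁ * absVec (meanVec g₂) + δ * X₁ := by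
  have hb : 0 < σ / 2 * ϱ := by linarith
  have ha4 : 0 < σ / 4 * ϱ := by linarith
  have hD := hK.small hb
  have hg := hg₁.cf_mem_rapid hb
  have hg' := fun i => (hg₂ i).cf_mem_rapid hb
  obtain ⟨μ, lam, χ, p, hsol, hμ, hlam, hχ⟩ := exists_seqSol hω (hessS H₀) (matT H₀) hb hK.nonneg hk
    hD h₁.eq_zero hg (g₂ := fun i => cf fun ξ => g₂ ξ i) hg' γ
  have huniq : ∀ {μ' lam' χ' p'}, SeqSol ω (hessS H₀) (matT H₀) k (K.seq α H₀) (cf g₁)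
      (fun i => cf fun ξ => g₂ ξ i) γ μ' lam' χ' p' → (∀ j, μ' j ∈ Rapid N) →
      (∀ j, lam' j ∈ Rapid N) → (∀ j, χ' j ∈ Rapid N) →
      (∀ j, μ' j = μ j) ∧ (∀ j, lam' j = lam j) ∧ (∀ j, χ' j = χ j) ∧ p' = p := by
    intro μ' lam' χ' p' h' r₁ r₂ r₃
    obtain ⟨z₁, z₂, z₃, z₄⟩ := h₁.eq_zero _ _ _ _ (h'.sub hb hD hsol r₁ r₂ r₃ hμ hlam hχ)
    exact ⟨fun j => funext fun m => sub_eq_zero.1 (congrFun (z₁ j) m),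
      fun j => funext fun m => sub_eq_zero.1 (congrFun (z₂ j) m),
      fun j => funext fun m => sub_eq_zero.1 (congrFun (z₃ j) m), sub_eq_zero.1 z₄⟩
  -- The data are measured by Sobolev norms here, and by sup norms on the half strip in the next
  -- application.
  obtain ⟨bμ, blam, bχ, bp, bmean⟩ := h₁ _ _ _ _ _ _ _ hsol _
    (fun i => (nrm N)⁻¹ * sobolev (s + 4 * n + 6) (fun ξ => g₂ ξ i)) (bd_sobolev hg _)
    (fun i => bd_sobolev (hg' i) _)
  obtain ⟨aμ, alam, aχ, ap, -⟩ := h₂ _ _ _ _ _ _ _ hsol _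
    (fun i => normA ϱ (σ / 2) 0 (fun ξ => g₂ ξ i) *
        kc N (0 + 4 * n + 6) (3 / 8 * (σ * ϱ)) (σ / 2 * ϱ))
    (Bd.of_env _ (by linarith) (by linarith) normA_nonneg (hg₁.norm_cf_le_env hb))
    (fun i => Bd.of_env _ (by linarith) (by linarith) normA_nonneg ((hg₂ i).norm_cf_le_env hb))
  rw [← hX₁] at bμ blam bχ bp bmean
  rw [← hX₂] at aμ alam aχ ap
  have hlt : σ / 4 * ϱ < 3 / 8 * (σ * ϱ) := by linarith
  have hmem : ∀ {c : (Fin N → ℤ) → ℂ}, Bd (wt 0 (3 / 8 * (σ * ϱ))) c X₂ →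
      MemA ϱ (σ / 4) 0 (syn c) ∧ normA ϱ (σ / 4) 0 (syn c) ≤
        (∑' m : Fin N → ℤ, Real.exp (-(3 / 8 * (σ * ϱ) - σ / 4 * ϱ) * l1 m)) * X₂ ∧
      cf (syn c) = c := by
    intro c hc
    obtain ⟨e₁, e₂⟩ := hc.expSum hlt
    exact ⟨(memA_syn ha4 e₁).1, (memA_syn ha4 e₁).2.trans e₂, cf_syn (e₁.summable_norm ha4.le)⟩
  have cμ := fun j => (hmem (aμ j)).2.2
  have clam := fun j => (hmem (alam j)).2.2
  have cχ := fun j => (hmem (aχ j)).2.2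
  have hsob : ∀ {c : (Fin N → ℤ) → ℂ}, Bd (wt s 0) c X₁ → cf (syn c) = c →
      MemSobolev s (syn c) ∧ sobolev s (syn c) ≤ nrm N * X₁ := fun hc h =>
    sobolev_le (by rwa [h])
  have sμ := fun j => hsob (bμ j) (cμ j)
  have slam := fun j => hsob (blam j) (clam j)
  have sχ := fun j => hsob (bχ j) (cχ j)
  refine ⟨fun ξ j => syn (μ j) ξ, fun ξ j => syn (lam j) ξ, fun ξ j => syn (χ j) ξ, p,
    ?_, ?_, ?_, ?_, ⟨fun j => (sμ j).1, fun j => (slam j).1, fun j => (sχ j).1, ?_⟩, ?_⟩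
  · rw [isSolution_iff ha hK hg₁ hg₂ (fun j => (hmem (aμ j)).1) (fun j => (hmem (alam j)).1)
      (fun j => (hmem (aχ j)).1), funext cμ, funext clam, funext cχ]
    exact hsol
  · intro μ' lam' χ' p' h'
    have q := (isSolution_iff ha hK hg₁ hg₂ h'.mem_μ h'.mem_lam h'.mem_χ).1 h'
    obtain ⟨u₁, u₂, u₃, u₄⟩ := huniq q (fun j => (h'.mem_μ j).cf_mem_rapid ha4)
      (fun j => (h'.mem_lam j).cf_mem_rapid ha4) (fun j => (h'.mem_χ j).cf_mem_rapid ha4)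
    refine ⟨fun ξ hξ => funext fun j => ?_, fun ξ hξ => funext fun j => ?_,
      fun ξ hξ => funext fun j => ?_, u₄⟩
    · exact (h'.mem_μ j).eqOn_closedStrip (hmem (aμ j)).1 ha4 ((u₁ j).trans (cμ j).symm) hξ
    · exact (h'.mem_lam j).eqOn_closedStrip (hmem (alam j)).1 ha4 ((u₂ j).trans (clam j).symm) hξ
    · exact (h'.mem_χ j).eqOn_closedStrip (hmem (aχ j)).1 ha4 ((u₃ j).trans (cχ j).symm) hξ
  · intro hR hr₁ hr₂ hγ
    obtain ⟨u₁, u₂, u₃, u₄⟩ := huniq (hsol.rev hR.seq (rev_cf_of_isRealFun hr₁)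
      (fun i => rev_cf_of_isRealFun (hr₂ i)) (Complex.conj_eq_iff_im.2 hγ))
      (fun j => rev_mem_rapid (hμ j)) (fun j => rev_mem_rapid (hlam j))
      (fun j => rev_mem_rapid (hχ j))
    exact ⟨fun j => isRealFun_syn (u₁ j), fun j => isRealFun_syn (u₂ j),
      fun j => isRealFun_syn (u₃ j), Complex.conj_eq_iff_im.1 u₄⟩
  · have t₁ := sum_le_card_mul fun j => (hmem (aμ j)).2.1
    have t₂ := sum_le_card_mul fun j => (hmem (alam j)).2.1
    have t₃ := sum_le_card_mul fun j => (hmem (aχ j)).2.1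
    simp only [normAVec]
    push_cast at t₂
    linarith
  · have t₁ := sum_le_card_mul fun j => (sμ j).2
    have t₂ := sum_le_card_mul fun j => (slam j).2
    have t₃ := sum_le_card_mul fun j => (sχ j).2
    simp only [sobolevVec]
    push_cast at t₂
    linarith
  · simpa only [absVec, meanVec, mean_eq_cf, cμ] using bmean

end TorusLinear

/-! ### The theorem: choice of the constants. -/

theorem mainTheorem11 (n : ℕ) (hn : 2 ≤ n) (ϱ : ℝ) (hϱ : 0 < ϱ)
    (ω : Fin (n - 1) → ℝ) (c₀ : ℝ) (hω : TorusLinear.Diophantine n c₀ ω)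
    (H₀ : (Fin (n - 1) → ℝ) × ℝ → ℝ) (hH₀ : AnalyticAt ℝ H₀ 0)
    (hH₀y : ∀ j, fderiv ℝ H₀ 0 (Pi.single j 1, 0) = ω j)
    (hH₀z : fderiv ℝ H₀ 0 (0, 1) = 0)
    (hK₀ : (TorusLinear.matK H₀).det ≠ 0)
    (C : ℝ) (d : ℕ) (hd : 2 ≤ d) (s : ℝ) (σ : ℝ) (hσ : 1 / 2 < σ) (hσ' : σ ≤ 1) :
    ∃ c : ℝ, 0 < c ∧ ∃ ε₁ : ℝ, 0 < ε₁ ∧ ∀ ε₀ : ℝ, 0 < ε₀ → ε₀ ≤ ε₁ →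
      ∀ ε : ℝ, |ε| ≤ ε₀ → ∀ α k : ℝ, 0 ≤ k → k ≤ 1 →
      ∀ K : TorusLinear.Coeffs (n - 1), K.Admissible ϱ σ d H₀ α (C * |ε|) →
      ∀ (g₁ : TorusLinear.CSpace (n - 1) → ℂ) (g₂ : TorusLinear.CSpace (n - 1) → Fin 2 → ℂ) (γ : ℂ),
        TorusLinear.MemA ϱ (σ / 2) 0 g₁ → TorusLinear.MemAVec ϱ (σ / 2) 0 g₂ →
      ∃ (μ : TorusLinear.CSpace (n - 1) → Fin (n - 1) → ℂ)
        (lam : TorusLinear.CSpace (n - 1) → Fin 2 → ℂ)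
        (χ : TorusLinear.CSpace (n - 1) → Fin (n - 1) → ℂ) (p : ℂ),
        -- existence
        TorusLinear.IsSolution ϱ σ ω k K g₁ g₂ γ μ lam χ p ∧
        -- uniqueness
        (∀ μ' lam' χ' p', TorusLinear.IsSolution ϱ σ ω k K g₁ g₂ γ μ' lam' χ' p' →
          Set.EqOn μ' μ (TorusLinear.closedStrip (n - 1) (σ / 4 * ϱ)) ∧
          Set.EqOn lam' lam (TorusLinear.closedStrip (n - 1) (σ / 4 * ϱ)) ∧
          Set.EqOn χ' χ (TorusLinear.closedStrip (n - 1) (σ / 4 * ϱ)) ∧ p' = p) ∧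
        -- real coefficients and data give a real solution
        (K.IsReal → TorusLinear.IsRealFun g₁ → (∀ i, TorusLinear.IsRealFun (fun ξ => g₂ ξ i)) →
          γ.im = 0 →
          (∀ i, TorusLinear.IsRealFun (fun ξ => μ ξ i)) ∧
          (∀ i, TorusLinear.IsRealFun (fun ξ => lam ξ i)) ∧
          (∀ i, TorusLinear.IsRealFun (fun ξ => χ ξ i)) ∧ p.im = 0) ∧
        -- the estimate in spaces of analytic functions
        (TorusLinear.normAVec ϱ (σ / 4) 0 μ + TorusLinear.normAVec ϱ (σ / 4) 0 lam
            + TorusLinear.normAVec ϱ (σ / 4) 0 χ + ‖p‖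
          ≤ c * (TorusLinear.normA ϱ (σ / 2) 0 g₁ + TorusLinear.normAVec ϱ (σ / 2) 0 g₂ + ‖γ‖)) ∧
        -- the estimate in Sobolev spaces
        (TorusLinear.MemSobolevVec s μ ∧ TorusLinear.MemSobolevVec s lam ∧
          TorusLinear.MemSobolevVec s χ ∧
          TorusLinear.sobolevVec s μ + TorusLinear.sobolevVec s lam + TorusLinear.sobolevVec s χ + ‖p‖
          ≤ c * (TorusLinear.sobolev (s + 4 * n + 6) g₁
              + TorusLinear.sobolevVec (s + 4 * n + 6) g₂ + ‖γ‖)) ∧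
        -- the refined bound for the mean value
        (TorusLinear.absVec (TorusLinear.meanVec μ)
          ≤ c * TorusLinear.absVec (TorusLinear.meanVec g₂)
            + ε₀ * c * (TorusLinear.sobolev (s + 4 * n + 6) g₁
              + TorusLinear.sobolevVec (s + 4 * n + 6) g₂ + ‖γ‖)) := by
  have hσ0 : 0 < σ := by linarith
  have hσϱ : 0 < σ * ϱ := mul_pos hσ0 hϱ
  have hT₀ : ∀ j, TorusLinear.matT H₀ 0 j = 0 := fun j => by simp [TorusLinear.matT]
  -- Row `1` of `matT H₀` is `vecT H₀` by definition, so this is the assumption on `matK H₀`.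
  have hdet : (TorusLinear.hessS H₀ - Matrix.vecMulVec (TorusLinear.matT H₀ 1)
      (TorusLinear.matT H₀ 1)).det ≠ 0 := hK₀
  have hb : 0 < σ / 2 * ϱ := by linarith
  obtain ⟨A₁, hA₁, δ₁, hδ₁, h₁⟩ := TorusLinear.exists_apriori hω (TorusLinear.hessS H₀)
    (TorusLinear.matT H₀) hT₀ hdet s le_rfl hb
  obtain ⟨A₂, hA₂, δ₂, hδ₂, h₂⟩ := TorusLinear.exists_apriori hω (TorusLinear.hessS H₀)
    (TorusLinear.matT H₀) hT₀ hdet 0 (a := 3 / 8 * (σ * ϱ)) (b := σ / 2 * ϱ) (by linarith)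
    (by linarith)
  set ν := TorusLinear.nrm (n - 1) with hν
  have hν0 : 0 < ν := TorusLinear.nrm_pos _
  set κ := TorusLinear.kc (n - 1) (0 + 4 * n + 6) (3 / 8 * (σ * ϱ)) (σ / 2 * ϱ) with hκ
  have hκ0 : 0 ≤ κ := TorusLinear.kc_nonneg _ _ _
  set E := ∑' m : Fin (n - 1) → ℤ,
    Real.exp (-(3 / 8 * (σ * ϱ) - σ / 4 * ϱ) * TorusLinear.l1 m) with hE
  have hE0 : 0 ≤ E := tsum_nonneg fun _ => (Real.exp_pos _).le
  have hC := abs_nonneg C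
  -- `c₁` serves the Sobolev estimate, `c₂` the analytic one, and `c₃` the bound of `μ̄`.
  obtain ⟨c₁, hc₁⟩ : ∃ c, c = ((2 * (n - 1 : ℕ) + 2) * ν + 1) * (A₁ * (ν⁻¹ + 1)) := ⟨_, rfl⟩
  obtain ⟨c₂, hc₂⟩ : ∃ c, c = ((2 * (n - 1 : ℕ) + 2) * E + 1) * (A₂ * (κ + 1)) := ⟨_, rfl⟩
  obtain ⟨c₃, hc₃⟩ : ∃ c, c = A₁ + |C| * (A₁ * (ν⁻¹ + 1)) := ⟨_, rfl⟩
  have hc₁0 : 0 < c₁ := by rw [hc₁]; positivity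
  have hc₂0 : 0 < c₂ := by rw [hc₂]; positivity
  have hc₃0 : 0 < c₃ := by rw [hc₃]; positivity
  -- This `ε₁` keeps `C|ε|` below both thresholds; the summand `1` covers `C = 0`.
  refine ⟨c₁ + c₂ + c₃, by positivity, min δ₁ δ₂ / (|C| + 1), by positivity, ?_⟩
  intro ε₀ hε₀ hε₁ ε hε α k hk hk1 K hK g₁ g₂ γ hg₁ hg₂
  have hδ : C * |ε| ≤ |C| * ε₀ :=
    mul_le_mul (le_abs_self C) hε (abs_nonneg ε) hC
  have hδ' : C * |ε| ≤ min δ₁ δ₂ := by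
    have h := (le_div_iff₀ (by positivity)).1 hε₁
    linarith
  have hsmall := hK.small hb
  obtain ⟨X₁, hX₁⟩ : ∃ X, X = A₁ * (ν⁻¹ * TorusLinear.sobolev (s + 4 * n + 6) g₁ +
    ∑ i, ν⁻¹ * TorusLinear.sobolev (s + 4 * n + 6) (fun ξ => g₂ ξ i) + ‖γ‖) := ⟨_, rfl⟩
  obtain ⟨X₂, hX₂⟩ : ∃ X, X = A₂ * (TorusLinear.normA ϱ (σ / 2) 0 g₁ * κ +
    ∑ i, TorusLinear.normA ϱ (σ / 2) 0 (fun ξ => g₂ ξ i) * κ + ‖γ‖) := ⟨_, rfl⟩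
  obtain ⟨μ, lam, χ, p, hs, hu, hr, ha, ⟨hm₁, hm₂, hm₃, hb'⟩, hm⟩ := hK.exists_solution hω hσϱ hk
    (h₁ _ k hK.nonneg (hδ'.trans (min_le_left _ _)) hk hk1 _ hsmall)
    (h₂ _ k hK.nonneg (hδ'.trans (min_le_right _ _)) hk hk1 _ hsmall) γ hg₁ hg₂ hX₁ hX₂
  rw [← Finset.mul_sum] at hX₁
  rw [← Finset.sum_mul] at hX₂
  change X₁ = A₁ * (ν⁻¹ * _ + ν⁻¹ * TorusLinear.sobolevVec (s + 4 * n + 6) g₂ + ‖γ‖) at hX₁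
  change X₂ = A₂ * (_ * κ + TorusLinear.normAVec ϱ (σ / 2) 0 g₂ * κ + ‖γ‖) at hX₂
  have n₁ : 0 ≤ TorusLinear.sobolev (s + 4 * n + 6) g₁ := Real.sqrt_nonneg _
  have n₂ : 0 ≤ TorusLinear.sobolevVec (s + 4 * n + 6) g₂ :=
    Finset.sum_nonneg fun _ _ => Real.sqrt_nonneg _
  have n₃ : 0 ≤ TorusLinear.normA ϱ (σ / 2) 0 g₁ := TorusLinear.normA_nonneg
  have n₄ : 0 ≤ TorusLinear.normAVec ϱ (σ / 2) 0 g₂ :=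
    Finset.sum_nonneg fun _ _ => TorusLinear.normA_nonneg
  have n₅ : 0 ≤ TorusLinear.absVec (TorusLinear.meanVec g₂) :=
    Finset.sum_nonneg fun _ _ => norm_nonneg _
  set Y₁ := TorusLinear.sobolev (s + 4 * n + 6) g₁
    + TorusLinear.sobolevVec (s + 4 * n + 6) g₂ + ‖γ‖ with hY₁
  set Y₂ := TorusLinear.normA ϱ (σ / 2) 0 g₁ + TorusLinear.normAVec ϱ (σ / 2) 0 g₂ + ‖γ‖ with hY₂
  have nγ := norm_nonneg γ
  have hY₁0 : 0 ≤ Y₁ := by positivity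
  have hY₂0 : 0 ≤ Y₂ := by positivity
  have hXY₁ : X₁ ≤ A₁ * (ν⁻¹ + 1) * Y₁ := by
    rw [hX₁, mul_assoc]
    refine mul_le_mul_of_nonneg_left ?_ hA₁.le
    have := mul_nonneg (inv_pos.2 hν0).le nγ
    rw [hY₁]
    linarith
  have hXY₂ : X₂ ≤ A₂ * (κ + 1) * Y₂ := by
    rw [hX₂, mul_assoc]
    refine mul_le_mul_of_nonneg_left ?_ hA₂.le
    have := mul_nonneg hκ0 nγ
    rw [hY₂]
    linarith
  refine ⟨μ, lam, χ, p, hs, hu, hr, ha.trans ?_, ⟨hm₁, hm₂, hm₃, hb'.trans ?_⟩, hm.trans ?_⟩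
  · calc (2 * (n - 1 : ℕ) + 2) * (E * X₂) + X₂ = ((2 * (n - 1 : ℕ) + 2) * E + 1) * X₂ := by ring
      _ ≤ ((2 * (n - 1 : ℕ) + 2) * E + 1) * (A₂ * (κ + 1) * Y₂) := by gcongr
      _ = c₂ * Y₂ := by rw [hc₂]; ring
      _ ≤ (c₁ + c₂ + c₃) * Y₂ := by gcongr; linarith
  · calc (2 * (n - 1 : ℕ) + 2) * (ν * X₁) + X₁ = ((2 * (n - 1 : ℕ) + 2) * ν + 1) * X₁ := by ring
      _ ≤ ((2 * (n - 1 : ℕ) + 2) * ν + 1) * (A₁ * (ν⁻¹ + 1) * Y₁) := by gcongr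
      _ = c₁ * Y₁ := by rw [hc₁]; ring
      _ ≤ (c₁ + c₂ + c₃) * Y₁ := by gcongr; linarith
  · have hA₁c : A₁ ≤ c₃ := by rw [hc₃]; linarith [show 0 ≤ |C| * (A₁ * (ν⁻¹ + 1)) by positivity]
    have hCc : |C| * (A₁ * (ν⁻¹ + 1)) ≤ c₃ := by rw [hc₃]; linarith
    refine add_le_add (by gcongr; linarith) ?_
    -- The factor `ε₀` comes from the size `C|ε| ≤ |C| ε₀` of the perturbation.
    calc C * |ε| * X₁ ≤ C * |ε| * (A₁ * (ν⁻¹ + 1) * Y₁) :=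
          mul_le_mul_of_nonneg_left hXY₁ hK.nonneg
      _ ≤ |C| * ε₀ * (A₁ * (ν⁻¹ + 1) * Y₁) := by gcongr
      _ = ε₀ * (|C| * (A₁ * (ν⁻¹ + 1))) * Y₁ := by ring
      _ ≤ ε₀ * (c₁ + c₂ + c₃) * Y₁ := by gcongr; linarith
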